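/- Consider the two-dimensional pressureless gas dynamics system for $(\rho,u,v,H)$, $U=(u,v)$, $$q_t+(qu)_x+(qv)_y=0\quad\text{for } q\in\{\rho,\ \rho u,\ \rho v,\ H+\tfrac{\rho}{2}|U|^2\},$$ with the initial data $(\rho_1,u_1,v_1,H_1)$ for $x>0,y>0$, $(\rho_2,u_2,v_2,H_2)$ for $x<0,y>0$ and $(\rho_3,u_3,v_3,H_3)$ for $y<0$, where all $\rho_i,H_i>0$. Write $U_i=(u_i,v_i)$; the same point of the $(\xi,\eta)=(x/t,y/t)$-plane is denoted $\Xi_i$. Put $[P,Q,R]=\det\begin{pmatrix}P&1\\Q&1\\R&1\end{pmatrix}$ and $U_\delta^{ij}=(u_\delta^{ij},v_\delta^{ij})=\frac{\sqrt{\rho_i}U_i+\sqrt{\rho_j}U_j}{\sqrt{\rho_i}+\sqrt{\rho_j}}$. A delta shock with left state $L$ and right state $R$ is a curve $\Xi(\bar s)$ with velocity $U_\delta(\bar s)$ and positive weights $m(\bar s)$ on $\rho$ and $n(\bar s)$ on $H$, run through in the direction of decreasing $\bar s$, such that $\Xi-\Xi'=U_\delta$ and $$Q-Q'=\left(q_L[U_L,U_\delta,\Xi]-q_R[U_R,U_\delta,\Xi]\right)e^{-\bar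 s}$$ for $Q=m,\ mU_\delta,\ \frac m2|U_\delta|^2+n$ and $q=\rho,\ \rho U,\ \frac\rho2|U|^2+H$ respectively, and $[U_L,U_\delta,\Xi]>0>[U_R,U_\delta,\Xi]$ (on a vacuum side, $\rho=H=0$, the inequality is dropped). With $\bar s=\ln(s/t)$ it represents in space-time the surface $(x,y)=t\,\Xi(\bar s)$ carrying the measures $t\,m(\bar s)\,ds\,dt$ and $t\,n(\bar s)\,ds\,dt$. The straight exterior delta shock $\delta_{ij}$ (left state $i$, right state $j$) through a point $P$ is $\Xi=U_\delta^{ij}+e^{\bar s}(P-U_\delta^{ij})$, $\bar s\ge0$, with constant velocity $U_\delta^{ij}$ and constant weights $$m=\sqrt{\rho_i\rho_j}\,[U_i,U_j,P],\qquad n=\Big(\frac{\rho_i\rho_j|U_i-U_j|^2}{2(\sqrt{\rho_i}+\sqrt{\rho_j})}+\sqrt{\rho_i}H_j+\sqrt{\rho_j}H_i\Big)\frac{[U_i,U_j,P]}{\sqrt{\rho_i}+\sqrt{\rho_j}}.$$ Suppose $u_1=u_2<u_3$, let $A=(u_1,v_\delta^{23})$, and suppose that either * (Case 5) $v_2<v_\delta^{23}<v_1<v_3$,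 or * (Case 9) $v_2<v_1=v_3$. Then the initial value problem has a global self-similar solution in the sense of distributions (constant states, vacuum, and delta measures on the delta shocks), which contains a nonempty, connected vacuum region that is bounded in the $(\xi,\eta)$-plane, and which has the following structure. 1. The exterior delta shock $\delta_{23}$ comes from $\xi=-\infty$ along $\eta=v_\delta^{23}$, separates state 2 (above) from state 3 (below), and meets the contact line $J_{12}$, $\xi=u_1$, at $A$. There a delta shock $\delta_3^A$ between vacuum (left) and state 3 (right) emerges, with the mass, momentum and energy carried into $A$ by $\delta_{23}$. As a solution of the above relations on $\bar s\in(-\infty,0]$ it satisfies: $(m,n,U_\delta,\Xi)\to(0,0,U_3,U_3)$ as $\bar s\to-\infty$; $U_\delta$ moves strictly monotonically along a straight segment from $U_\delta(0)$ towards $U_3$; and the curve $\Xi$ is strictly convex and protrudes towards the line $\Xi(0)U_\delta(0)$, lying for $\bar s<0$ in the open triangle $\Xi(0)\,U_\delta(0)\,\Xi_3$. 2. In Case 5, $\delta_3^A$ meets the exterior delta shock $\delta_{31}$ (which comes from $\xi=+\infty$ along $\eta=v_\delta^{31}$, with state 1 above and state 3 below) for the first time at a point $B$ with $\xi_B>u_\delta^{31}$.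 There $\delta_3^A$ and $\delta_{31}$ end, and a delta shock $\delta_1^B$ between vacuum (left) and state 1 (right) emerges, with the sums of the masses, momenta and energies carried into $B$. It has the properties in 1 with $\Xi_3$, $U_3$ replaced by $\Xi_1$, $U_1$; in particular it ends at $\Xi_1$. The plane is divided by $\delta_{23}$, the arc $AB$ of $\delta_3^A$, $\delta_{31}$, $\delta_1^B$ and the contact line $\{\xi=u_1,\ \eta\ge v_\delta^{23}\}$ into the regions of states 1, 2, 3 and the vacuum; the contact line separates state 2 from vacuum for $\eta<v_1$ and from state 1 for $\eta>v_1$. 3. In Case 9, $\delta_3^A$ ends at $\Xi_3$. The plane is divided by $\delta_{23}$, $\delta_3^A$, the contact line $\{\xi=u_1,\ \eta\ge v_\delta^{23}\}$ and the contact line $\{\eta=v_1,\ \xi\ge u_1\}$ into the regions of states 1, 2, 3 and the vacuum. The first contact line is as in 2; the second separates state 1 from vacuum for $u_1<\xi<u_3$ and from state 3 for $\xi>u_3$. -/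

import Mathlib

open Set Filter Topology MeasureTheory

open scoped ContDiff

noncomputable section

/-- A constant state `(ρ, u, v, H)`: density, velocity components, internal energy. -/
structure State where
  ρ : ℝ
  u : ℝ
  v : ℝ
  H : ℝ

/-- The velocity `U = (u, v)`; the same point of the `(ξ, η)`-plane is the singular point `Ξ` of
the state. -/
def State.vel (S : State) : ℝ × ℝ := (S.u, S.v)

/-- The vacuum. Its velocity is irrelevant: it is always multiplied by `ρ = 0` or `H = 0`. -/
def vacuum : State := ⟨0, 0, 0, 0⟩

/-- The conserved quantities (mass, two momenta, total energy) of a density `ρ` (or a concentrated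
mass), a velocity `U` and an internal energy `H` (or a concentrated internal energy). In
pressureless flow the flux of each of them is the quantity times `U`. -/
def conserved (ρ : ℝ) (U : ℝ × ℝ) (H : ℝ) : Fin 4 → ℝ :=
  ![ρ, ρ * U.1, ρ * U.2, H + ρ / 2 * (U.1 ^ 2 + U.2 ^ 2)]

def State.cons (S : State) : Fin 4 → ℝ := conserved S.ρ S.vel S.H

/-- The determinant `[P, Q, R]` of three points of the plane. -/
def br (P Q R : ℝ × ℝ) : ℝ :=
  Matrix.det !![P.1, P.2, 1; Q.1, Q.2, 1; R.1, R.2, 1]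

/-- Rotation by a right angle, counterclockwise: `rot d` points to the left of the direction `d`. -/
def rot (d : ℝ × ℝ) : ℝ × ℝ := (-d.2, d.1)

/-- The open triangle with positively oriented vertices `P, Q, R`. -/
def openTriangle (P Q R : ℝ × ℝ) : Set (ℝ × ℝ) :=
  {X | 0 < br P Q X ∧ 0 < br Q R X ∧ 0 < br R P X}

/-- The data of a pseudo-self-similar delta shock: the shock curve `Ξ`, the velocity `U`, and the
weights `m` on the density and `n` on the internal energy, as functions of `s̄ = log (s / t)`.
In space-time it is `X(t,s) = t Ξ(s̄)`, `w(t,s) = t m(s̄)`, `h(t,s) = t n(s̄)`. The curve is run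
through in the direction of decreasing `s̄`. -/
structure DeltaCurve where
  Ξ : ℝ → ℝ × ℝ
  U : ℝ → ℝ × ℝ
  m : ℝ → ℝ
  n : ℝ → ℝ

def DeltaCurve.cons (d : DeltaCurve) (s : ℝ) : Fin 4 → ℝ := conserved (d.m s) (d.U s) (d.n s)

/-- The generalized Rankine-Hugoniot relations in self-similar form, with the state `L` on the
left and the state `R` on the right of the curve, for the parameters in `I`. -/
def DeltaCurve.GeneralizedRH (L R : State) (d : DeltaCurve) (I : Set ℝ) : Prop :=
  ∀ s ∈ I,
    HasDerivWithinAt d.Ξ (d.Ξ s - d.U s) I s ∧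
    ∀ k : Fin 4, HasDerivWithinAt (fun r => d.cons r k)
      (d.cons s k -
        (L.cons k * br L.vel (d.U s) (d.Ξ s) - R.cons k * br R.vel (d.U s) (d.Ξ s))
          * Real.exp (-s)) I s

/-- The entropy condition. A vacuum has no characteristics of its own (its velocity is arbitrary),
so the condition concerns the sides that are not vacuum. -/
def DeltaCurve.Entropy (L R : State) (d : DeltaCurve) (I : Set ℝ) : Prop :=
  ∀ s ∈ I, (0 < L.ρ → 0 < br L.vel (d.U s) (d.Ξ s)) ∧
    (0 < R.ρ → br R.vel (d.U s) (d.Ξ s) < 0)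

/-- An admissible delta shock, with positive weights, between `L` (left) and `R` (right). -/
def IsDeltaShock (L R : State) (d : DeltaCurve) (I : Set ℝ) : Prop :=
  (∀ s ∈ I, 0 < d.m s ∧ 0 < d.n s) ∧ d.GeneralizedRH L R I ∧ d.Entropy L R I

/-- The velocity `U_δ` of the straight delta shock between two states. -/
def deltaVel (L R : State) : ℝ × ℝ :=
  (√L.ρ + √R.ρ)⁻¹ • (√L.ρ • L.vel + √R.ρ • R.vel)

/-- The straight (exterior) delta shock between `L` and `R`, coming from infinity (`s̄ = ∞`) and
heading for its singular point `U_δ`, with the parametrization in which it passes through `P` at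
`s̄ = 0`; it has constant velocity and weights. The factor `[U_L, U_R, P]` in the weights is the
jump of the normal velocity times the distance from `U_δ` to `P`, the latter because the weights
are taken with respect to `s` and not with respect to the length along the shock. -/
def straightDelta (L R : State) (P : ℝ × ℝ) : DeltaCurve where
  Ξ s := deltaVel L R + Real.exp s • (P - deltaVel L R)
  U _ := deltaVel L R
  m _ := √(L.ρ * R.ρ) * br L.vel R.vel P
  n _ := (L.ρ * R.ρ * ((L.u - R.u) ^ 2 + (L.v - R.v) ^ 2) / (2 * (√L.ρ + √R.ρ))
      + √L.ρ * R.H + √R.ρ * L.H) * (br L.vel R.vel P / (√L.ρ + √R.ρ))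

/-- The qualitative behaviour of a delta shock (`s̄ ≤ 0`) with vacuum on its left and the state `R`
on its right: the weights die out and curve and velocity end at `U_R`; the velocity moves strictly
monotonically along a straight segment from its value at `s̄ = 0` to `U_R`, which it only reaches
asymptotically; the curve is strictly convex (it always turns to the left), and it protrudes
towards the line through `Ξ₀` and `U_δ⁰`, inside the triangle `Ξ₀ U_δ⁰ U_R`. -/
def VacuumShockBehaviour (R : State) (d : DeltaCurve) : Prop :=
  Tendsto (fun s => (d.m s, d.n s, d.U s, d.Ξ s)) atBot (𝓝 (0, 0, R.vel, R.vel)) ∧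
  (∃ c : ℝ → ℝ, StrictMonoOn c (Iic 0) ∧ c 0 = 1 ∧ Tendsto c atBot (𝓝 0) ∧
    ∀ s ≤ 0, d.U s = R.vel + c s • (d.U 0 - R.vel)) ∧
  (∀ s₁ s₂ s₃ : ℝ, s₃ < s₂ → s₂ < s₁ → s₁ ≤ 0 → 0 < br (d.Ξ s₁) (d.Ξ s₂) (d.Ξ s₃)) ∧
  (∀ s < 0, d.Ξ s ∈ openTriangle (d.Ξ 0) (d.U 0) R.vel)

/-- Near its points with parameter in `I`, the delta shock has the region `DL` on its left and `DR`
on its right (its direction at `Ξ` is `U_δ - Ξ`). -/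
def DeltaCurve.Separates (d : DeltaCurve) (I : Set ℝ) (DL DR : Set (ℝ × ℝ)) : Prop :=
  ∀ s ∈ I, ∀ᶠ ε in 𝓝[>] (0 : ℝ),
    d.Ξ s + ε • rot (d.U s - d.Ξ s) ∈ DL ∧ d.Ξ s - ε • rot (d.U s - d.Ξ s) ∈ DR

/-- `X` lies on a contact discontinuity with direction `e` that has the state `L` in the region
`DL` on its left and the state `R` in `DR` on its right: the Rankine-Hugoniot conditions for each
conserved quantity hold, and no mass crosses. -/
def IsContactAt (X e : ℝ × ℝ) (L R : State) (DL DR : Set (ℝ × ℝ)) : Prop :=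
  (∀ k : Fin 4, L.cons k * br X (X + e) L.vel = R.cons k * br X (X + e) R.vel) ∧
  L.ρ * br X (X + e) L.vel = 0 ∧
  ∀ᶠ ε in 𝓝[>] (0 : ℝ), X + ε • rot e ∈ DL ∧ X - ε • rot e ∈ DR

/-- The three-state initial data in the `(x, y)`-plane (the values on the axes are immaterial). -/
def riemannData (S₁ S₂ S₃ : State) (q : ℝ × ℝ) : State :=
  open Classical in if q.2 < 0 then S₃ else if q.1 < 0 then S₂ else S₁

/-- The parameters `(t, s)` of the part of a self-similar surface with `s̄ = log (s / t) ∈ I`. -/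
def paramSet (I : Set ℝ) : Set (ℝ × ℝ) :=
  {q | 0 < q.1 ∧ 0 < q.2 ∧ Real.log (q.2 / q.1) ∈ I}

/-- The integrand, in `(t, s)`, of the pairing of a weighted delta measure with a test function:
`w ∂φ/∂t + w u_δ ∂φ/∂x + w v_δ ∂φ/∂y` at `(t, X(t,s))`, where `w` is the weight of the conserved
quantity number `k`. -/
def DeltaCurve.pairing (d : DeltaCurve) (φ : ℝ × ℝ × ℝ → ℝ) (k : Fin 4) (q : ℝ × ℝ) : ℝ :=
  (q.1 * d.cons (Real.log (q.2 / q.1)) k) *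
    fderiv ℝ φ (q.1, q.1 • d.Ξ (Real.log (q.2 / q.1)))
      (1, (d.U (Real.log (q.2 / q.1))).1, (d.U (Real.log (q.2 / q.1))).2)

/-- The same integrand for the bounded part `(ρ, u, v, H)(x / t, y / t)` of the solution, at
`p = (t, x, y)`. -/
def bulkPairing (W : ℝ × ℝ → State) (φ : ℝ × ℝ × ℝ → ℝ) (k : Fin 4) (p : ℝ × ℝ × ℝ) : ℝ :=
  (W (p.1⁻¹ • p.2)).cons k *
    fderiv ℝ φ p (1, (W (p.1⁻¹ • p.2)).u, (W (p.1⁻¹ • p.2)).v)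

/-- The self-similar field `W` together with the delta shocks `d j`, `s̄ ∈ I j`, is a solution in
the sense of distributions of the conservation laws of mass, momentum and energy, with initial data
`W₀`: for every test function on `[0, ∞) × ℝ²` and every conserved quantity `q`,
`∫∫∫ q (φ_t + u φ_x + v φ_y) + ∫∫ q₀ φ(0, ·) = 0`, where `q` comprises the delta measures. -/
def IsDistributionalSolution {N : ℕ} (W : ℝ × ℝ → State) (d : Fin N → DeltaCurve)
    (I : Fin N → Set ℝ) (W₀ : ℝ × ℝ → State) : Prop :=
  ∀ φ : ℝ × ℝ × ℝ → ℝ, ContDiff ℝ ∞ φ → HasCompactSupport φ → ∀ k : Fin 4,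
    IntegrableOn (bulkPairing W φ k) {p | 0 < p.1} ∧
    (∀ j, IntegrableOn ((d j).pairing φ k) (paramSet (I j))) ∧
    Integrable (fun q => (W₀ q).cons k * φ (0, q)) ∧
    (∫ p in {p : ℝ × ℝ × ℝ | 0 < p.1}, bulkPairing W φ k p)
      + (∑ j, ∫ q in paramSet (I j), (d j).pairing φ k q)
      + (∫ q : ℝ × ℝ, (W₀ q).cons k * φ (0, q)) = 0

/-- The plane is divided by the curves of `waves` into the vacuum region `D 0`, nonempty, connected
and bounded, and the regions `D 1, D 2, D 3` of the three states; along rays to infinity in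
`x, y > 0`, in `x < 0 < y` and in `y < 0`, the points end up in `D 1`, `D 2` and `D 3`. The field
`W` has the value `S i` in `D i`, and vacuum in `D 0`. -/
def IsWavePattern (S₁ S₂ S₃ : State) (W : ℝ × ℝ → State) (D : Fin 4 → Set (ℝ × ℝ))
    (waves : Set (ℝ × ℝ)) : Prop :=
  (∀ i, IsOpen (D i)) ∧ Pairwise (Function.onFun Disjoint D) ∧ (⋃ i, D i) = wavesᶜ ∧
  IsConnected (D 0) ∧ Bornology.IsBounded (D 0) ∧
  (∀ X : ℝ × ℝ, 0 < X.1 → 0 < X.2 → ∀ᶠ r in atTop, (r : ℝ) • X ∈ D 1) ∧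
  (∀ X : ℝ × ℝ, X.1 < 0 → 0 < X.2 → ∀ᶠ r in atTop, (r : ℝ) • X ∈ D 2) ∧
  (∀ X : ℝ × ℝ, X.2 < 0 → ∀ᶠ r in atTop, (r : ℝ) • X ∈ D 3) ∧
  (∀ X ∈ D 0, (W X).ρ = 0 ∧ (W X).H = 0) ∧
  (∀ X ∈ D 1, W X = S₁) ∧ (∀ X ∈ D 2, W X = S₂) ∧ (∀ X ∈ D 3, W X = S₃)

/-- `d` is the delta shock that emerges from the point `A` where the straight delta shock between
`S₂` and `S₃` meets the contact discontinuity, with conserved mass, momentum and energy; it has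
vacuum on the left and `S₃` on the right. -/
def EmergesAt (A : ℝ × ℝ) (S₂ S₃ : State) (d : DeltaCurve) : Prop :=
  d.Ξ 0 = A ∧ (∀ k, d.cons 0 k = (straightDelta S₂ S₃ A).cons 0 k) ∧
  IsDeltaShock vacuum S₃ d (Iic 0) ∧ VacuumShockBehaviour S₃ d

/-- The solution of the first configuration (two delta shocks from infinity). -/
def HasCaseFiveSolution (S₁ S₂ S₃ : State) : Prop :=
  ∃ (d₃ d₁ : DeltaCurve) (sB : ℝ) (D : Fin 4 → Set (ℝ × ℝ)) (W : ℝ × ℝ → State),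
    let A : ℝ × ℝ := (S₁.u, (deltaVel S₂ S₃).2)
    let B : ℝ × ℝ := d₃.Ξ sB
    let d₂₃ := straightDelta S₂ S₃ A
    let d₃₁ := straightDelta S₃ S₁ B
    -- the exterior delta shocks
    IsDeltaShock S₂ S₃ d₂₃ (Ici 0) ∧ IsDeltaShock S₃ S₁ d₃₁ (Ici 0) ∧
    -- the delta shock between vacuum and state 3, emerging at `A`
    EmergesAt A S₂ S₃ d₃ ∧
    -- it meets the horizontal exterior delta shock at `B`, before the latter's singular point
    sB < 0 ∧ B.2 = (deltaVel S₃ S₁).2 ∧ (deltaVel S₃ S₁).1 < B.1 ∧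
    (∀ s ∈ Ioc sB 0, (d₃.Ξ s).2 < (deltaVel S₃ S₁).2) ∧
    -- a delta shock between vacuum and state 1 emerges there; mass, momentum and energy are
    -- conserved (per unit `s`, which `exp sB` converts between the two parametrizations)
    d₁.Ξ 0 = B ∧ (∀ k, d₁.cons 0 k = Real.exp sB * d₃.cons sB k + d₃₁.cons 0 k) ∧
    -- it ends at the singular point of state 1
    IsDeltaShock vacuum S₁ d₁ (Iic 0) ∧ VacuumShockBehaviour S₁ d₁ ∧
    -- the wave pattern in the plane
    IsWavePattern S₁ S₂ S₃ W D
      (d₂₃.Ξ '' Ici 0 ∪ d₃.Ξ '' Icc sB 0 ∪ d₃₁.Ξ '' Ici 0 ∪ d₁.Ξ '' Iic 0 ∪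
        {X | X.1 = S₁.u ∧ A.2 ≤ X.2}) ∧
    d₂₃.Separates (Ioi 0) (D 2) (D 3) ∧ d₃.Separates (Ioo sB 0) (D 0) (D 3) ∧
    d₃₁.Separates (Ioi 0) (D 3) (D 1) ∧ d₁.Separates (Iio 0) (D 0) (D 1) ∧
    (∀ y, S₁.v < y → IsContactAt (S₁.u, y) (0, -1) S₁ S₂ (D 1) (D 2)) ∧
    (∀ y, A.2 < y → y < S₁.v → IsContactAt (S₁.u, y) (0, -1) vacuum S₂ (D 0) (D 2)) ∧
    -- the global solution
    IsDistributionalSolution W ![d₂₃, d₃, d₃₁, d₁] ![Ici 0, Icc sB 0, Ici 0, Iic 0]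
      (riemannData S₁ S₂ S₃)

/-- The solution of the second configuration (one delta shock from infinity). -/
def HasCaseNineSolution (S₁ S₂ S₃ : State) : Prop :=
  ∃ (d₃ : DeltaCurve) (D : Fin 4 → Set (ℝ × ℝ)) (W : ℝ × ℝ → State),
    let A : ℝ × ℝ := (S₁.u, (deltaVel S₂ S₃).2)
    let d₂₃ := straightDelta S₂ S₃ A
    IsDeltaShock S₂ S₃ d₂₃ (Ici 0) ∧
    -- the delta shock between vacuum and state 3 emerges at `A` and ends at the singular point of
    -- state 3
    EmergesAt A S₂ S₃ d₃ ∧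
    -- the wave pattern in the plane
    IsWavePattern S₁ S₂ S₃ W D
      (d₂₃.Ξ '' Ici 0 ∪ d₃.Ξ '' Iic 0 ∪ {X | X.1 = S₁.u ∧ A.2 ≤ X.2} ∪
        {X | X.2 = S₁.v ∧ S₁.u ≤ X.1}) ∧
    d₂₃.Separates (Ioi 0) (D 2) (D 3) ∧ d₃.Separates (Iio 0) (D 0) (D 3) ∧
    (∀ y, S₁.v < y → IsContactAt (S₁.u, y) (0, -1) S₁ S₂ (D 1) (D 2)) ∧
    (∀ y, A.2 < y → y < S₁.v → IsContactAt (S₁.u, y) (0, -1) vacuum S₂ (D 0) (D 2)) ∧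
    (∀ x, S₃.u < x → IsContactAt (x, S₁.v) (-1, 0) S₃ S₁ (D 3) (D 1)) ∧
    (∀ x, S₁.u < x → x < S₃.u → IsContactAt (x, S₁.v) (-1, 0) vacuum S₁ (D 0) (D 1)) ∧
    -- the global solution
    IsDistributionalSolution W ![d₂₃, d₃] ![Ici 0, Iic 0] (riemannData S₁ S₂ S₃)

end

/-! Everything is explicit. Beside a vacuum, the flux into the shock carries no momentum relative to
the frame of the state `R` on the other side. So `m (U - U_R)` satisfies `Q' = Q` and equals `exp s̄
· m₀ (U₀ - U_R)`. Writing `m = exp s̄ · m₀ r`, this gives `U - U_R = (U₀ - U_R) / r`, and the mass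
balance becomes `κ r r' = -exp (-s̄)` with `κ = m₀ / (ρ_R · (-[U_R, U₀, P]))`. Its solution is
`shockRatio`, with `r ^ 2 = 1 + (2 / κ) (exp (-s̄) - 1)`. Let `α, γ, β` be the barycentric
coordinates for the vertices `P, U₀, U_R`. On the shock `(α : γ : β) = (1 : κ (r - 1) : κ (r - 1) ^
2 / 2)`, so it is an arc of the conic `γ ^ 2 = 2 κ α β`, which touches the line `P U₀` at `P` and
the line `U_R U₀` at `U_R`. The strict convexity of the shock, its position in the triangle and the
convexity of the region behind it are all read off from this (`vacuumShockBehaviour`,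
`image_vacuumShock`, `vacuumShock_separates`, `convex_conicRegion`).

The weak form of the equations is checked in Lagrangian terms. On a delta shock, the point `t Ξ (log
(s / t))` at fixed `s` moves with velocity `U`. Hence the pairing with a test function is a
`t`-derivative minus a source term, and integrating it leaves integrals of the test function over
the cones through the end points of the shock (`DeltaCurve.Tame.integral_pairing`). In a region of
constant velocity `V` the particles run along the lines `x + t V`, and the derivative of the test
function along such a line integrates to its value at the exit minus its value at time zero. The
change of variables from the foot point `x = t (Ξ - V)` to the parameters `(t, s)` of the shock has
Jacobian `exp (-s̄) |[V, U, Ξ]|`, the very factor in the generalized Rankine-Hugoniot relations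
(`IsSweptBy.integral_region`). So sources cancel against fluxes, initial values against the initial
data, and the end point terms cancel at `A` and `B` by conservation of mass, momentum and energy.

What remains is geometry. In the self-similar plane a particle of velocity `V` runs along a ray
towards `V`. A conic through `V` meets such a ray at most once more, so it is clear which shock, if
any, the particle hits. In Case 5 the height of the shock from `A` increases strictly from `v_δ²³`
to the limit `v₃`, hence passes `v_δ³¹` at exactly one point `B`. There the concentrated masses
merge inelastically. The merged velocity is a convex combination of the two incoming ones; both
satisfy the inequality `[U₁, ·, B] < 0`, hence so does the combination, and the explicit shock
applies again with state 1. The vacuum then consists of two convex pieces glued along the segment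
from `U₁` to `B`. -/

theorem br_eq (P Q R : ℝ × ℝ) :
    br P Q R = (Q.1 - P.1) * (R.2 - P.2) - (Q.2 - P.2) * (R.1 - P.1) := by
  simp [br, Matrix.det_fin_three]; ring

@[simp] theorem conserved_zero (ρ : ℝ) (U : ℝ × ℝ) (H : ℝ) : conserved ρ U H 0 = ρ := rfl

@[simp] theorem conserved_one (ρ : ℝ) (U : ℝ × ℝ) (H : ℝ) : conserved ρ U H 1 = ρ * U.1 := rfl

@[simp] theorem conserved_two (ρ : ℝ) (U : ℝ × ℝ) (H : ℝ) : conserved ρ U H 2 = ρ * U.2 := rfl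

@[simp] theorem conserved_three (ρ : ℝ) (U : ℝ × ℝ) (H : ℝ) :
    conserved ρ U H 3 = H + ρ / 2 * (U.1 ^ 2 + U.2 ^ 2) := rfl

theorem forall_fin_four {p : Fin 4 → Prop} (h0 : p 0) (h1 : p 1) (h2 : p 2) (h3 : p 3) (k : Fin 4) :
    p k := by
  fin_cases k <;> assumption

theorem vacuum_cons (k : Fin 4) : vacuum.cons k = 0 := by
  revert k
  refine forall_fin_four ?_ ?_ ?_ ?_ <;> simp [State.cons, vacuum]

/-! ### The explicit delta shock between vacuum and a constant state -/

/-- The ratio `m₀ / (c m)` of the velocity scale along a vacuum shock, as a function of `s̄`. -/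
noncomputable def shockRatio (κ s : ℝ) : ℝ := √(1 + 2 / κ * (Real.exp (-s) - 1))

/-- The shape parameter of the vacuum shock through `P` with velocity `U₀` and mass `m₀`. -/
noncomputable def shockShape (R : State) (P U₀ : ℝ × ℝ) (m₀ : ℝ) : ℝ :=
  m₀ / (R.ρ * -br R.vel U₀ P)

/-- The delta shock with vacuum on the left and `R` on the right that starts at `P` with velocity
`U₀` and weights `m₀`, `n₀`. -/
noncomputable def vacuumShock (R : State) (P U₀ : ℝ × ℝ) (m₀ n₀ : ℝ) : DeltaCurve where
  Ξ s := R.vel + Real.exp s • ((P - R.vel) +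
    (shockShape R P U₀ m₀ * (shockRatio (shockShape R P U₀ m₀) s - 1)) • (U₀ - R.vel))
  U s := R.vel + (shockRatio (shockShape R P U₀ m₀) s)⁻¹ • (U₀ - R.vel)
  m s := Real.exp s * (m₀ * shockRatio (shockShape R P U₀ m₀) s)
  n s := Real.exp s * (n₀ + R.H / R.ρ * (m₀ * (shockRatio (shockShape R P U₀ m₀) s - 1)) +
    m₀ / 2 * ((U₀.1 - R.u) ^ 2 + (U₀.2 - R.v) ^ 2) *
      (1 - (shockRatio (shockShape R P U₀ m₀) s)⁻¹))

theorem shockRatio_zero (κ : ℝ) : shockRatio κ 0 = 1 := by simp [shockRatio]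

theorem shockRatio_arg_pos {κ s : ℝ} (hκ : 0 < κ) (hs : s ≤ 0) :
    1 ≤ 1 + 2 / κ * (Real.exp (-s) - 1) := by
  have : 1 ≤ Real.exp (-s) := Real.one_le_exp (by linarith)
  have h2 : 0 ≤ 2 / κ * (Real.exp (-s) - 1) := by
    apply mul_nonneg (by positivity); linarith
  linarith

theorem one_le_shockRatio {κ s : ℝ} (hκ : 0 < κ) (hs : s ≤ 0) : 1 ≤ shockRatio κ s :=
  Real.one_le_sqrt.2 (shockRatio_arg_pos hκ hs)

theorem shockRatio_sq {κ s : ℝ} (hκ : 0 < κ) (hs : s ≤ 0) :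
    shockRatio κ s ^ 2 = 1 + 2 / κ * (Real.exp (-s) - 1) :=
  Real.sq_sqrt (by linarith [shockRatio_arg_pos hκ hs])

theorem exp_neg_eq_shockRatio {κ s : ℝ} (hκ : 0 < κ) (hs : s ≤ 0) :
    Real.exp (-s) = 1 + κ * (shockRatio κ s ^ 2 - 1) / 2 := by
  rw [shockRatio_sq hκ hs]; field_simp; ring

theorem exp_mul_shockRatio {κ s : ℝ} (hκ : 0 < κ) (hs : s ≤ 0) :
    Real.exp s * (1 + κ * (shockRatio κ s ^ 2 - 1) / 2) = 1 := by
  rw [← exp_neg_eq_shockRatio hκ hs, ← Real.exp_add]; simp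

theorem shockRatio_strictAntiOn {κ : ℝ} (hκ : 0 < κ) : StrictAntiOn (shockRatio κ) (Iic 0) := by
  intro s _ t ht hst
  apply Real.sqrt_lt_sqrt (by linarith [shockRatio_arg_pos hκ (mem_Iic.1 ht)])
  have : Real.exp (-t) < Real.exp (-s) := Real.exp_lt_exp.2 (by linarith)
  have := mul_lt_mul_of_pos_left this (show 0 < 2 / κ by positivity)
  linarith

theorem one_lt_shockRatio {κ s : ℝ} (hκ : 0 < κ) (hs : s < 0) : 1 < shockRatio κ s := by
  have := shockRatio_strictAntiOn hκ (mem_Iic.2 hs.le) (mem_Iic.2 le_rfl) hs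
  rwa [shockRatio_zero] at this

/-- This is the mass balance `κ r r' = -exp (-s)`; the radicand in `shockRatio` is its integral with
value `1` at `s = 0`. -/
theorem hasDerivAt_shockRatio {κ s : ℝ} (hκ : 0 < κ) (hs : s ≤ 0) :
    HasDerivAt (shockRatio κ) (-(Real.exp (-s)) / (κ * shockRatio κ s)) s := by
  have h1 : HasDerivAt (fun s => 1 + 2 / κ * (Real.exp (-s) - 1)) (2 / κ * (Real.exp (-s) * -1))
    s :=
    (((hasDerivAt_neg s).exp.sub_const 1).const_mul (2 / κ)).const_add 1
  have h2 := h1.sqrt (by linarith [shockRatio_arg_pos hκ hs])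
  refine h2.congr_deriv ?_
  have : 0 < shockRatio κ s := by linarith [one_le_shockRatio hκ hs]
  change _ / (2 * shockRatio κ s) = _
  field_simp

theorem tendsto_shockRatio {κ : ℝ} (hκ : 0 < κ) : Tendsto (shockRatio κ) atBot atTop := by
  apply Real.tendsto_sqrt_atTop.comp
  apply tendsto_atTop_add_const_left
  apply Tendsto.const_mul_atTop (by positivity)
  exact tendsto_atTop_add_const_right _ _ (Real.tendsto_exp_atTop.comp tendsto_neg_atBot_atTop)

/-- For `κ > 0` the ratio grows only like `exp (-s / 2)`, as one sees after pulling the factor `exp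
s` under the root. This makes the weights die out and the curve end at the singular point. -/
theorem tendsto_exp_mul_shockRatio {κ : ℝ} :
    Tendsto (fun s => Real.exp s * shockRatio κ s) atBot (𝓝 0) := by
  have h : Tendsto (fun s => √(Real.exp s ^ 2 * (1 - 2 / κ) + 2 / κ * Real.exp s)) atBot
      (𝓝 √(0 ^ 2 * (1 - 2 / κ) + 2 / κ * 0)) :=
    (((Real.tendsto_exp_atBot.pow 2).mul_const _).add (Real.tendsto_exp_atBot.const_mul _)).sqrt
  simp only [ne_eq, OfNat.ofNat_ne_zero, not_false_eq_true, zero_pow, zero_mul, mul_zero, add_zero,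
    Real.sqrt_zero] at h
  refine h.congr fun s => ?_
  rw [shockRatio, ← Real.sqrt_sq (Real.exp_pos s).le, ← Real.sqrt_mul (sq_nonneg _),
    Real.sqrt_sq (Real.exp_pos s).le]
  congr 1
  have : Real.exp s * Real.exp (-s) = 1 := by rw [← Real.exp_add]; simp
  linear_combination (-2 / κ * Real.exp s) * this

section
variable {R : State} {P U₀ : ℝ × ℝ} {m₀ n₀ : ℝ}

theorem shockShape_pos (hρ : 0 < R.ρ) (hm : 0 < m₀) (hb : br R.vel U₀ P < 0) :
    0 < shockShape R P U₀ m₀ :=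
  div_pos hm (mul_pos hρ (by linarith))

theorem shockShape_mul (hρ : 0 < R.ρ) (hb : br R.vel U₀ P < 0) :
    R.ρ * br R.vel U₀ P * shockShape R P U₀ m₀ = -m₀ := by
  have : br R.vel U₀ P ≠ 0 := hb.ne
  rw [shockShape]; field_simp

@[simp] theorem vacuumShock_Ξ_zero : (vacuumShock R P U₀ m₀ n₀).Ξ 0 = P := by
  simp [vacuumShock, shockRatio_zero]

@[simp] theorem vacuumShock_U_zero : (vacuumShock R P U₀ m₀ n₀).U 0 = U₀ := by
  simp [vacuumShock, shockRatio_zero]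

@[simp] theorem vacuumShock_m_zero : (vacuumShock R P U₀ m₀ n₀).m 0 = m₀ := by
  simp [vacuumShock, shockRatio_zero]

@[simp] theorem vacuumShock_n_zero : (vacuumShock R P U₀ m₀ n₀).n 0 = n₀ := by
  simp [vacuumShock, shockRatio_zero]

/-- The part of `Ξ` along `U₀ - R.vel` is parallel to `U - R.vel` and drops out of the determinant.
-/
theorem br_vacuumShock {s : ℝ} :
    br R.vel ((vacuumShock R P U₀ m₀ n₀).U s) ((vacuumShock R P U₀ m₀ n₀).Ξ s) =
      Real.exp s * (shockRatio (shockShape R P U₀ m₀) s)⁻¹ * br R.vel U₀ P := by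
  simp only [br_eq, vacuumShock, Prod.fst_add, Prod.snd_add, Prod.smul_fst, Prod.smul_snd,
    Prod.fst_sub, Prod.snd_sub, smul_eq_mul]
  ring

theorem hasDerivAt_vacuumShock_Ξ (hρ : 0 < R.ρ) (hm : 0 < m₀) (hb : br R.vel U₀ P < 0)
    {s : ℝ} (hs : s ≤ 0) :
    HasDerivAt (vacuumShock R P U₀ m₀ n₀).Ξ
      ((vacuumShock R P U₀ m₀ n₀).Ξ s - (vacuumShock R P U₀ m₀ n₀).U s) s := by
  have hκ := shockShape_pos hρ hm hb
  set κ := shockShape R P U₀ m₀ with hκd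
  have hr := hasDerivAt_shockRatio hκ hs
  have hr1 := one_le_shockRatio hκ hs
  have h1 := (((hr.sub_const 1).const_mul κ).smul_const (U₀ - R.vel)).const_add (P - R.vel)
  have h2 := ((Real.hasDerivAt_exp s).smul h1).const_add R.vel
  refine h2.congr_deriv ?_
  have he : Real.exp s * Real.exp (-s) = 1 := by rw [← Real.exp_add]; simp
  -- Differentiating the ratio yields precisely the coefficient `-r⁻¹` of `U₀ - R.vel` that turns
  -- `Ξ` into `Ξ - U`.
  have hc : Real.exp s * (κ * (-Real.exp (-s) / (κ * shockRatio κ s))) =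
      -(shockRatio κ s)⁻¹ := by
    field_simp; linarith
  simp only [smul_smul]
  rw [hc]
  simp only [vacuumShock, ← hκd]
  module

/-- Each conserved quantity has the form `exp s * (A + B * r)` with `B` proportional to the
corresponding quantity of `R`. The derivative of `exp s` reproduces the quantity itself, and `r'`
produces the source. -/
theorem hasDerivAt_vacuumShock_cons (hρ : 0 < R.ρ) (hm : 0 < m₀) (hb : br R.vel U₀ P < 0)
    {s : ℝ} (hs : s ≤ 0) (k : Fin 4) :
    HasDerivAt (fun r => (vacuumShock R P U₀ m₀ n₀).cons r k)
      ((vacuumShock R P U₀ m₀ n₀).cons s k + R.cons k *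
        br R.vel ((vacuumShock R P U₀ m₀ n₀).U s) ((vacuumShock R P U₀ m₀ n₀).Ξ s) *
        Real.exp (-s)) s := by
  have hκ := shockShape_pos hρ hm hb
  have hκm := shockShape_mul (m₀ := m₀) hρ hb
  rw [br_vacuumShock]
  set κ := shockShape R P U₀ m₀ with hκd
  set b := br R.vel U₀ P
  have hr := hasDerivAt_shockRatio hκ hs
  have hr1 := one_le_shockRatio hκ hs
  have hr0 : shockRatio κ s ≠ 0 := by linarith
  have hee : Real.exp s * Real.exp (-s) = 1 := by rw [← Real.exp_add]; simp
  have key : ∀ A B : ℝ, B * R.ρ = m₀ * R.cons k →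
      (∀ r ≤ 0, (vacuumShock R P U₀ m₀ n₀).cons r k = Real.exp r * (A + B * shockRatio κ r)) →
      (∀ᶠ r in 𝓝 s, (vacuumShock R P U₀ m₀ n₀).cons r k =
        Real.exp r * (A + B * shockRatio κ r)) →
      HasDerivAt (fun r => (vacuumShock R P U₀ m₀ n₀).cons r k)
      ((vacuumShock R P U₀ m₀ n₀).cons s k + R.cons k *
        (Real.exp s * (shockRatio κ s)⁻¹ * b) * Real.exp (-s)) s := by
    intro A B hB h0 h1
    have h2 := (Real.hasDerivAt_exp s).mul ((hr.const_mul B).const_add A)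
    refine (h2.congr_deriv ?_).congr_of_eventuallyEq h1
    rw [h0 s hs]
    have : R.cons k = -(B / (b * κ)) := by
      have hb0 : b ≠ 0 := hb.ne
      field_simp
      have h3 : R.ρ * (B + R.cons k * b * κ) = 0 := by
        linear_combination hB + R.cons k * hκm
      rcases mul_eq_zero.1 h3 with h | h
      · exact absurd h hρ.ne'
      · linarith
    rw [this]
    have hb0 : b ≠ 0 := hb.ne
    field_simp
  -- The derivative at `s = 0` is two-sided, so the formula is also needed for small positive
  -- parameters; there it persists as long as the ratio does not vanish.
  have hrn : ∀ᶠ r in 𝓝 s, shockRatio κ r ≠ 0 := hr.continuousAt.eventually_ne hr0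
  have hmain : ∃ A B, B * R.ρ = m₀ * R.cons k ∧ ∀ r, shockRatio κ r ≠ 0 →
      (vacuumShock R P U₀ m₀ n₀).cons r k = Real.exp r * (A + B * shockRatio κ r) := by
    revert k
    refine forall_fin_four ?_ ?_ ?_ ?_
    · intros
      refine ⟨0, m₀, by simp [State.cons], fun r h => ?_⟩
      simp [DeltaCurve.cons, vacuumShock, ← hκd]
    · intros
      refine ⟨m₀ * (U₀.1 - R.u), m₀ * R.u, by simp [State.cons, State.vel]; ring,
        fun r h => ?_⟩
      simp [DeltaCurve.cons, vacuumShock, ← hκd, State.vel]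
      field_simp
      ring
    · intros
      refine ⟨m₀ * (U₀.2 - R.v), m₀ * R.v, by simp [State.cons, State.vel]; ring,
        fun r h => ?_⟩
      simp [DeltaCurve.cons, vacuumShock, ← hκd, State.vel]
      field_simp
      ring
    · intros
      -- The kinetic energy contributes a term in `r⁻¹`; the last summand of the weight `n` is
      -- chosen to cancel it.
      refine ⟨n₀ - R.H / R.ρ * m₀ + m₀ / 2 * ((U₀.1 - R.u) ^ 2 + (U₀.2 - R.v) ^ 2)
        + m₀ * (R.u * (U₀.1 - R.u) + R.v * (U₀.2 - R.v)),
        R.H / R.ρ * m₀ + m₀ / 2 * (R.u ^ 2 + R.v ^ 2), ?_, fun r h => ?_⟩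
      · simp [State.cons, State.vel]; field_simp
      · simp [DeltaCurve.cons, vacuumShock, ← hκd, State.vel]
        field_simp
        ring
  obtain ⟨A, B, hB, hAB⟩ := hmain
  exact key A B hB (fun r hr' => hAB r (by linarith [one_le_shockRatio hκ hr']))
    (hrn.mono hAB)

theorem br_vacuumShock_neg (hρ : 0 < R.ρ) (hm : 0 < m₀) (hb : br R.vel U₀ P < 0) {s : ℝ}
    (hs : s ≤ 0) :
    br R.vel ((vacuumShock R P U₀ m₀ n₀).U s) ((vacuumShock R P U₀ m₀ n₀).Ξ s) < 0 := by
  rw [br_vacuumShock]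
  have hr := one_le_shockRatio (shockShape_pos hρ hm hb) hs
  exact mul_neg_of_pos_of_neg (by positivity) hb

theorem isDeltaShock_vacuumShock (hρ : 0 < R.ρ) (hH : 0 < R.H) (hm : 0 < m₀) (hn : 0 < n₀)
    (hb : br R.vel U₀ P < 0) :
    IsDeltaShock vacuum R (vacuumShock R P U₀ m₀ n₀) (Iic 0) := by
  have hκ := shockShape_pos hρ hm hb
  refine ⟨fun s hs => ?_, fun s hs => ⟨(hasDerivAt_vacuumShock_Ξ hρ hm hb hs).hasDerivWithinAt,
    fun k => ?_⟩, fun s hs => ⟨fun h => absurd h (lt_irrefl _), fun _ => ?_⟩⟩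
  · have hr := one_le_shockRatio hκ hs
    have hi : (shockRatio (shockShape R P U₀ m₀) s)⁻¹ ≤ 1 := inv_le_one_of_one_le₀ hr
    refine ⟨by simp only [vacuumShock]; positivity, ?_⟩
    simp only [vacuumShock]
    have h1 : 0 ≤ R.H / R.ρ * (m₀ * (shockRatio (shockShape R P U₀ m₀) s - 1)) :=
      mul_nonneg (by positivity) (mul_nonneg hm.le (by linarith))
    have h2 : 0 ≤ m₀ / 2 * ((U₀.1 - R.u) ^ 2 + (U₀.2 - R.v) ^ 2) *
      (1 - (shockRatio (shockShape R P U₀ m₀) s)⁻¹) :=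
      mul_nonneg (by positivity) (by linarith)
    exact mul_pos (Real.exp_pos s) (by linarith)
  · refine ((hasDerivAt_vacuumShock_cons hρ hm hb hs k).congr_deriv ?_).hasDerivWithinAt
    rw [vacuum_cons]; ring
  · exact br_vacuumShock_neg hρ hm hb hs

/-- The limits follow from `r → ∞` and `exp s * r → 0`, and the velocity from `c = r⁻¹`. Convexity
is a Vandermonde determinant, because the barycentric coordinates are, up to the factor `exp s`,
polynomials of degree 0, 1, 2 in `r`. -/
theorem vacuumShockBehaviour (hρ : 0 < R.ρ) (hm : 0 < m₀) (hb : br R.vel U₀ P < 0) :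
    VacuumShockBehaviour R (vacuumShock R P U₀ m₀ n₀) := by
  have hκ := shockShape_pos hρ hm hb
  have ht := tendsto_shockRatio hκ
  have hte := tendsto_exp_mul_shockRatio (κ := shockShape R P U₀ m₀)
  have hti : Tendsto (fun s => (shockRatio (shockShape R P U₀ m₀) s)⁻¹) atBot (𝓝 0) :=
    tendsto_inv_atTop_zero.comp ht
  have he := Real.tendsto_exp_atBot
  refine ⟨?_, ⟨fun s => (shockRatio (shockShape R P U₀ m₀) s)⁻¹, ?_, by simp [shockRatio_zero], hti,
    fun s _ => by simp [vacuumShock, shockRatio_zero]⟩, ?_, ?_⟩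
  · refine Tendsto.prodMk_nhds ?_ (Tendsto.prodMk_nhds ?_ (Tendsto.prodMk_nhds ?_ ?_))
    · have := hte.const_mul m₀
      rw [mul_zero] at this
      refine this.congr fun s => ?_
      simp only [vacuumShock]; ring
    · have h1 := ((he.mul_const (n₀ - R.H / R.ρ * m₀)).add (hte.const_mul (R.H / R.ρ * m₀))).add
        ((he.mul ((tendsto_const_nhds (x := (1 : ℝ))).sub hti)).const_mul
          (m₀ / 2 * ((U₀.1 - R.u) ^ 2 + (U₀.2 - R.v) ^ 2)))
      simp only [zero_mul, mul_zero, add_zero] at h1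
      refine h1.congr fun s => ?_
      simp only [vacuumShock]; ring
    · have := (hti.smul_const (U₀ - R.vel)).const_add R.vel
      simpa [vacuumShock] using this
    · have := ((he.smul_const ((P - R.vel) - shockShape R P U₀ m₀ • (U₀ - R.vel))).add
        ((hte.const_mul (shockShape R P U₀ m₀)).smul_const (U₀ - R.vel))).const_add R.vel
      simp only [zero_smul, mul_zero, add_zero] at this
      refine this.congr fun s => ?_
      simp only [vacuumShock]; module
  · intro s hs t ht hst
    have h1 := shockRatio_strictAntiOn hκ hs ht hst
    have h2 := one_le_shockRatio hκ ht
    exact inv_strictAnti₀ (by linarith) h1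
  · intro s₁ s₂ s₃ h32 h21 h1
    have e1 := exp_mul_shockRatio hκ h1
    have e2 := exp_mul_shockRatio hκ (h21.le.trans h1)
    have e3 := exp_mul_shockRatio hκ (h32.le.trans (h21.le.trans h1))
    have r21 := shockRatio_strictAntiOn hκ (mem_Iic.2 (h21.le.trans h1)) (mem_Iic.2 h1) h21
    have r32 := shockRatio_strictAntiOn hκ (mem_Iic.2 (h32.le.trans (h21.le.trans h1)))
      (mem_Iic.2 (h21.le.trans h1)) h32
    simp only [br_eq, vacuumShock, Prod.fst_add, Prod.snd_add, Prod.smul_fst, Prod.smul_snd,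
      Prod.fst_sub, Prod.snd_sub, smul_eq_mul] at *
    set κ := shockShape R P U₀ m₀
    set a1 := shockRatio κ s₁
    set a2 := shockRatio κ s₂
    set a3 := shockRatio κ s₃
    set x1 := Real.exp s₁
    set x2 := Real.exp s₂
    set x3 := Real.exp s₃
    have hx1 : 0 < x1 := Real.exp_pos _
    have hx2 : 0 < x2 := Real.exp_pos _
    have hx3 : 0 < x3 := Real.exp_pos _
    -- The Vandermonde product of the three ratios, positive because the ratio decreases in `s`.
    have hpos : 0 < x1 * x2 * x3 * (κ ^ 2 / 2) * ((a2 - a1) * (a3 - a2) * (a3 - a1)) *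
        -((U₀.1 - R.vel.1) * (P.2 - R.vel.2) - (U₀.2 - R.vel.2) * (P.1 - R.vel.1)) := by
      have := sub_pos.2 r21
      have := sub_pos.2 r32
      have : 0 < a3 - a1 := by linarith
      have := neg_pos.2 hb
      positivity
    refine hpos.trans_eq ?_
    have f1 : x1 * (κ * (a1 ^ 2 - 1) / 2) = 1 - x1 := by linear_combination e1
    have f2 : x2 * (κ * (a2 ^ 2 - 1) / 2) = 1 - x2 := by linear_combination e2
    have f3 : x3 * (κ * (a3 ^ 2 - 1) / 2) = 1 - x3 := by linear_combination e3
    generalize R.vel = V at *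
    clear_value κ a1 a2 a3 x1 x2 x3
    set p := P.1 - V.1
    set q := P.2 - V.2
    set c := U₀.1 - V.1
    set d := U₀.2 - V.2
    linear_combination (-(c * q - d * p)) * κ * (x2 * x3 * (a3 - a2) * e1 - x1 * x3 * (a3 - a1) * e2
      + x1 * x2 * (a2 - a1) * e3)
  · intro s hs
    have e1 := exp_mul_shockRatio hκ hs.le
    have r1 := one_lt_shockRatio hκ hs
    have hx : 0 < Real.exp s := Real.exp_pos _
    simp only [openTriangle, mem_ofPred_eq, vacuumShock_Ξ_zero, vacuumShock_U_zero]
    have hb' := neg_pos.2 hb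
    set κ := shockShape R P U₀ m₀ with hκd
    -- `h2`, `h3`, `h4` are the barycentric coordinates for `R.vel`, `U₀` and `P`, each multiplied
    -- by twice the area of the triangle.
    have h2 : 0 < Real.exp s * (κ * (shockRatio κ s - 1) ^ 2 / 2) * -br R.vel U₀ P := by
      have := sub_pos.2 r1
      positivity
    have h3 : 0 < Real.exp s * (κ * (shockRatio κ s - 1)) * -br R.vel U₀ P := by
      have := sub_pos.2 r1
      positivity
    have h4 : 0 < Real.exp s * -br R.vel U₀ P := by positivity
    simp only [br_eq, vacuumShock, Prod.fst_add, Prod.snd_add, Prod.smul_fst, Prod.smul_snd,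
      Prod.fst_sub, Prod.snd_sub, smul_eq_mul, ← hκd] at *
    refine ⟨h2.trans_eq ?_, h4.trans_eq ?_, h3.trans_eq ?_⟩
    · linear_combination (-((U₀.1 - R.vel.1) * (P.2 - R.vel.2) - (U₀.2 - R.vel.2) *
        (P.1 - R.vel.1))) * e1
    · ring
    · ring

end

/-! ### The straight delta shocks -/

section
variable {L R : State} {P : ℝ × ℝ}

@[simp] theorem straightDelta_Ξ_zero : (straightDelta L R P).Ξ 0 = P := by
  simp [straightDelta]

theorem hasDerivAt_straightDelta_Ξ (s : ℝ) :
    HasDerivAt (straightDelta L R P).Ξ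
      ((straightDelta L R P).Ξ s - (straightDelta L R P).U s) s := by
  have := ((Real.hasDerivAt_exp s).smul_const (P - deltaVel L R)).const_add (deltaVel L R)
  refine this.congr_deriv ?_
  simp [straightDelta]

/-- The velocity of the shock lies on the segment between the two states, so `U - L.vel` is a fixed
multiple of `R.vel - L.vel`; adding multiples of it to `Ξ - L.vel` does not change the determinant.
-/
theorem br_left_straightDelta (hL : 0 < L.ρ) (hR : 0 < R.ρ) (s : ℝ) :
    br L.vel ((straightDelta L R P).U s) ((straightDelta L R P).Ξ s) =
      Real.exp s * (√R.ρ / (√L.ρ + √R.ρ) * br L.vel R.vel P) := by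
  have h1 := Real.sqrt_pos.2 hL
  have h2 := Real.sqrt_pos.2 hR
  simp only [br_eq, straightDelta, deltaVel, Prod.fst_add, Prod.snd_add, Prod.smul_fst,
    Prod.smul_snd, Prod.fst_sub, Prod.snd_sub, smul_eq_mul]
  field_simp
  ring

theorem br_right_straightDelta (hL : 0 < L.ρ) (hR : 0 < R.ρ) (s : ℝ) :
    br R.vel ((straightDelta L R P).U s) ((straightDelta L R P).Ξ s) =
      -(Real.exp s * (√L.ρ / (√L.ρ + √R.ρ) * br L.vel R.vel P)) := by
  have h1 := Real.sqrt_pos.2 hL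
  have h2 := Real.sqrt_pos.2 hR
  simp only [br_eq, straightDelta, deltaVel, Prod.fst_add, Prod.snd_add, Prod.smul_fst,
    Prod.smul_snd, Prod.fst_sub, Prod.snd_sub, smul_eq_mul]
  field_simp
  ring

/-- With constant weights the Rankine-Hugoniot relations say that each weight equals its source. The
fluxes from left and right are in the ratio `√R.ρ : √L.ρ`, hence the mass inflows in the ratio `√L.ρ
: √R.ρ`, and their mean velocity is `deltaVel L R`. -/
theorem straightDelta_balance (hL : 0 < L.ρ) (hR : 0 < R.ρ) (s : ℝ) (k : Fin 4) :
    (straightDelta L R P).cons s k =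
      (L.cons k * br L.vel ((straightDelta L R P).U s) ((straightDelta L R P).Ξ s) -
        R.cons k * br R.vel ((straightDelta L R P).U s) ((straightDelta L R P).Ξ s)) *
          Real.exp (-s) := by
  rw [br_left_straightDelta hL hR, br_right_straightDelta hL hR]
  have he : Real.exp s * Real.exp (-s) = 1 := by rw [← Real.exp_add]; simp
  have h1 := Real.sqrt_pos.2 hL
  have h2 := Real.sqrt_pos.2 hR
  have e1 := Real.sq_sqrt hL.le
  have e2 := Real.sq_sqrt hR.le
  have e3 : √(L.ρ * R.ρ) = √L.ρ * √R.ρ := Real.sqrt_mul hL.le _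
  suffices h : (straightDelta L R P).cons s k = (L.cons k * (√R.ρ / (√L.ρ + √R.ρ) * br L.vel R.vel
    P)
      + R.cons k * (√L.ρ / (√L.ρ + √R.ρ) * br L.vel R.vel P)) by
    rw [h]; linear_combination (-(L.cons k * (√R.ρ / (√L.ρ + √R.ρ) * br L.vel R.vel P)
      + R.cons k * (√L.ρ / (√L.ρ + √R.ρ) * br L.vel R.vel P))) * he
  generalize hlr : br L.vel R.vel P = b
  replace hlr : br (L.u, L.v) (R.u, R.v) P = b := hlr
  revert k
  refine forall_fin_four ?_ ?_ ?_ ?_ <;>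
    simp only [DeltaCurve.cons, straightDelta, deltaVel, State.cons, conserved_zero, conserved_one,
      conserved_two, conserved_three, Prod.fst_add, Prod.snd_add, Prod.smul_fst,
      Prod.smul_snd, smul_eq_mul, State.vel, e3, hlr] <;>
    generalize √L.ρ = x at * <;> generalize √R.ρ = y at * <;> rw [← e1, ← e2] <;>
    field_simp
  all_goals ring

theorem isDeltaShock_straightDelta (hL : 0 < L.ρ) (hR : 0 < R.ρ) (hHL : 0 < L.H) (hHR : 0 < R.H)
    (hb : 0 < br L.vel R.vel P) (I : Set ℝ) : IsDeltaShock L R (straightDelta L R P) I := by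
  have h1 := Real.sqrt_pos.2 hL
  have h2 := Real.sqrt_pos.2 hR
  refine ⟨fun s _ => ⟨?_, ?_⟩, fun s _ => ⟨(hasDerivAt_straightDelta_Ξ s).hasDerivWithinAt,
    fun k => ?_⟩, fun s _ => ⟨fun _ => ?_, fun _ => ?_⟩⟩
  · have := Real.sqrt_pos.2 (mul_pos hL hR)
    simp only [straightDelta]; positivity
  · simp only [straightDelta]; positivity
  · rw [← straightDelta_balance hL hR, sub_self]
    exact (hasDerivAt_const s ((straightDelta L R P).cons 0 k)).hasDerivWithinAt
  · rw [br_left_straightDelta hL hR]; positivity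
  · rw [br_right_straightDelta hL hR]
    have : 0 < Real.exp s * (√L.ρ / (√L.ρ + √R.ρ) * br L.vel R.vel P) := by positivity
    linarith

theorem straightDelta_pos (hL : 0 < L.ρ) (hR : 0 < R.ρ) (hHL : 0 < L.H) (hHR : 0 < R.H)
    (hb : 0 < br L.vel R.vel P) (s : ℝ) :
    0 < (straightDelta L R P).m s ∧ 0 < (straightDelta L R P).n s :=
  (isDeltaShock_straightDelta hL hR hHL hHR hb univ).1 s trivial

end

/-! ### Test functions on delta shocks, and the Lagrangian form of the pairing -/

section
variable {φ : ℝ × ℝ × ℝ → ℝ}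

theorem exists_testFunction_bounds (hφ : ContDiff ℝ ∞ φ) (hc : HasCompactSupport φ) :
    ∃ T C : ℝ, 0 < T ∧ 0 < C ∧ (∀ p, T < ‖p‖ → φ p = 0 ∧ fderiv ℝ φ p = 0) ∧
      ∀ p, |φ p| ≤ C ∧ ‖fderiv ℝ φ p‖ ≤ C := by
  obtain ⟨T, hT⟩ := hc.isBounded.exists_norm_le
  obtain ⟨C₁, h₁⟩ := hc.exists_bound_of_continuous hφ.continuous
  obtain ⟨C₂, h₂⟩ := (hc.fderiv (𝕜 := ℝ)).exists_bound_of_continuous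
    (hφ.continuous_fderiv (by simp))
  refine ⟨max T 1, max (max C₁ C₂) 1, by positivity, by positivity, fun p hp => ?_,
    fun p => ⟨((h₁ p).trans (le_max_left _ _)).trans (le_max_left _ _),
      ((h₂ p).trans (le_max_right _ _)).trans (le_max_left _ _)⟩⟩
  have hp' : p ∉ tsupport φ := fun h => by
    have := hT p h
    have := le_max_left T 1
    linarith
  refine ⟨image_eq_zero_of_notMem_tsupport hp', ?_⟩
  by_contra h
  exact hp' (support_fderiv_subset ℝ h)

theorem integrableOn_of_bounded_of_bounded_support {F : ℝ × ℝ → ℝ} {K : Set (ℝ × ℝ)}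
    (hK : MeasurableSet K) (hF : ContinuousOn F K) {C T : ℝ} (hC : ∀ q ∈ K, |F q| ≤ C)
    (hT : ∀ q ∈ K, T < ‖q‖ → F q = 0) : IntegrableOn F K := by
  have h1 : IntegrableOn F (K ∩ Metric.closedBall 0 T) := by
    refine IntegrableOn.of_bound ?_ ?_ C ?_
    · exact (measure_mono inter_subset_right).trans_lt
        (isCompact_closedBall (0 : ℝ × ℝ) T).measure_lt_top
    · exact (hF.mono inter_subset_left).aestronglyMeasurable
        (hK.inter Metric.isClosed_closedBall.measurableSet)
    · exact (ae_restrict_iff' (hK.inter Metric.isClosed_closedBall.measurableSet)).2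
        (ae_of_all _ fun q hq => hC q hq.1)
  refine h1.of_forall_sdiff_eq_zero hK fun q hq => hT q hq.1 ?_
  by_contra h
  exact hq.2 ⟨hq.1, by simpa using not_lt.1 h⟩

theorem isOpen_paramSet {I : Set ℝ} (hI : IsOpen I) : IsOpen (paramSet I) := by
  have h : ContinuousOn (fun q : ℝ × ℝ => Real.log (q.2 / q.1)) {q | 0 < q.1 ∧ 0 < q.2} := by
    refine ContinuousOn.log (continuousOn_snd.div continuousOn_fst fun q hq => hq.1.ne')
      fun q hq => (div_pos hq.2 hq.1).ne'
  have ho : IsOpen {q : ℝ × ℝ | 0 < q.1 ∧ 0 < q.2} :=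
    (isOpen_lt continuous_const continuous_fst).inter (isOpen_lt continuous_const continuous_snd)
  have := h.isOpen_inter_preimage ho hI
  convert this using 1
  ext q; simp [paramSet, and_assoc]

theorem continuousOn_log_div (I : Set ℝ) :
    ContinuousOn (fun q : ℝ × ℝ => Real.log (q.2 / q.1)) (paramSet I) :=
  ContinuousOn.log (continuousOn_snd.div continuousOn_fst fun _ hq => hq.1.ne')
    fun _ hq => (div_pos hq.2.1 hq.1).ne'

/-- Regularity and bounds for a delta shock curve on an open parameter interval that suffice for
pairing it with test functions. -/
structure DeltaCurve.Tame (d : DeltaCurve) (I : Set ℝ) : Prop where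
  isOpen : IsOpen I
  hasDerivAt : ∀ s ∈ I, HasDerivAt d.Ξ (d.Ξ s - d.U s) s
  continuousOn_U : ContinuousOn d.U I
  bounded_U : ∃ C, ∀ s ∈ I, ‖d.U s‖ ≤ C
  continuousOn_cons : ∀ k, ContinuousOn (fun s => d.cons s k) I
  bounded_cons : ∀ k, ∃ C, ∀ s ∈ I, |d.cons s k| ≤ C
  bounded_param : ∀ T, ∃ T', ∀ q ∈ paramSet I, q.1 ≤ T →
    ‖q.1 • d.Ξ (Real.log (q.2 / q.1))‖ ≤ T → q.2 ≤ T'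

theorem DeltaCurve.Tame.mono {d : DeltaCurve} {I J : Set ℝ} (h : d.Tame I) (hJ : IsOpen J)
    (hJI : J ⊆ I) : d.Tame J where
  isOpen := hJ
  hasDerivAt s hs := h.hasDerivAt s (hJI hs)
  continuousOn_U := h.continuousOn_U.mono hJI
  bounded_U := h.bounded_U.imp fun _ hC s hs => hC s (hJI hs)
  continuousOn_cons k := (h.continuousOn_cons k).mono hJI
  bounded_cons k := (h.bounded_cons k).imp fun _ hC s hs => hC s (hJI hs)
  bounded_param T := (h.bounded_param T).imp fun _ hT q hq => hT q ⟨hq.1, hq.2.1, hJI hq.2.2⟩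

variable {d : DeltaCurve} {I : Set ℝ}

theorem DeltaCurve.Tame.continuousOn_Ξ (h : d.Tame I) : ContinuousOn d.Ξ I :=
  fun s hs => (h.hasDerivAt s hs).continuousAt.continuousWithinAt

theorem DeltaCurve.Tame.continuousOn_point (h : d.Tame I) :
    ContinuousOn (fun q : ℝ × ℝ => (q.1, q.1 • d.Ξ (Real.log (q.2 / q.1)))) (paramSet I) :=
  continuousOn_fst.prodMk (continuousOn_fst.smul
    (h.continuousOn_Ξ.comp (continuousOn_log_div I) fun _ hq => hq.2.2))

/-- Test functions vanish far out in space-time; this transfers the vanishing to the parameter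
plane, so that the integrands are supported in bounded sets. -/
theorem DeltaCurve.Tame.exists_support_bound (h : d.Tame I) (T : ℝ) :
    ∃ T', ∀ q ∈ paramSet I, T' < ‖q‖ → T < ‖(q.1, q.1 • d.Ξ (Real.log (q.2 / q.1)))‖ := by
  obtain ⟨T', hT'⟩ := h.bounded_param T
  refine ⟨max T T', fun q hq hlt => ?_⟩
  by_contra hle
  rw [not_lt, Prod.norm_def, max_le_iff] at hle
  have h1 : q.1 ≤ T := (le_abs_self _).trans hle.1
  have h2 := hT' q hq h1 hle.2
  have h3 : ‖q‖ ≤ max T T' := by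
    rw [Prod.norm_def]
    refine max_le_max ?_ ?_
    · rwa [Real.norm_of_nonneg hq.1.le]
    · rwa [Real.norm_of_nonneg hq.2.1.le]
  linarith

theorem DeltaCurve.Tame.integrableOn_mul (h : d.Tame I) (hφ : ContDiff ℝ ∞ φ)
    (hc : HasCompactSupport φ) {g : ℝ → ℝ} (hg : ContinuousOn g I) (hgb : ∃ C, ∀ s ∈ I, |g s| ≤ C) :
    IntegrableOn (fun q : ℝ × ℝ => g (Real.log (q.2 / q.1)) *
      φ (q.1, q.1 • d.Ξ (Real.log (q.2 / q.1)))) (paramSet I) := by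
  obtain ⟨T, C, hT, hC, h0, hb⟩ := exists_testFunction_bounds hφ hc
  obtain ⟨T', hT'⟩ := h.exists_support_bound T
  obtain ⟨D, hD⟩ := hgb
  refine integrableOn_of_bounded_of_bounded_support (isOpen_paramSet h.isOpen).measurableSet
    ((hg.comp (continuousOn_log_div I) fun _ hq => hq.2.2).mul
      (hφ.continuous.comp_continuousOn h.continuousOn_point)) (C := D * C) (T := T')
    (fun q hq => ?_) fun q hq hlt => ?_
  · rw [abs_mul]
    exact mul_le_mul (hD _ hq.2.2) (hb _).1 (abs_nonneg _) ((abs_nonneg _).trans (hD _ hq.2.2))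
  · rw [(h0 _ (hT' q hq hlt)).1, mul_zero]

theorem DeltaCurve.Tame.integrableOn_pairing (h : d.Tame I) (hφ : ContDiff ℝ ∞ φ)
    (hc : HasCompactSupport φ) (k : Fin 4) : IntegrableOn (d.pairing φ k) (paramSet I) := by
  obtain ⟨T, C, hT, hC, h0, hb⟩ := exists_testFunction_bounds hφ hc
  obtain ⟨T', hT'⟩ := h.exists_support_bound T
  obtain ⟨D, hD⟩ := h.bounded_cons k
  obtain ⟨E, hE⟩ := h.bounded_U
  have hlog := continuousOn_log_div I
  have hmap : MapsTo (fun q : ℝ × ℝ => Real.log (q.2 / q.1)) (paramSet I) I := fun _ hq => hq.2.2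
  refine integrableOn_of_bounded_of_bounded_support (isOpen_paramSet h.isOpen).measurableSet
    ?_ (C := T * D * (C * max 1 E)) (T := T') (fun q hq => ?_) fun q hq hlt => ?_
  · refine (continuousOn_fst.mul ((h.continuousOn_cons k).comp hlog hmap)).mul
      (ContinuousOn.clm_apply ((hφ.continuous_fderiv (by simp)).comp_continuousOn
        h.continuousOn_point) (continuousOn_const.prodMk ?_))
    exact (continuous_fst.comp_continuousOn (h.continuousOn_U.comp hlog hmap)).prodMk
      (continuous_snd.comp_continuousOn (h.continuousOn_U.comp hlog hmap))
  · rw [DeltaCurve.pairing]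
    by_cases hq1 : T < ‖(q.1, q.1 • d.Ξ (Real.log (q.2 / q.1)))‖
    · rw [(h0 _ hq1).2]
      have : 0 ≤ D := (abs_nonneg _).trans (hD _ hq.2.2)
      simp only [zero_apply, mul_zero, abs_zero]
      positivity
    rw [abs_mul, abs_mul]
    have h1 : |q.1| ≤ T := by
      rw [not_lt, Prod.norm_def, max_le_iff] at hq1; exact hq1.1
    refine mul_le_mul (mul_le_mul h1 (hD _ hq.2.2) (abs_nonneg _) hT.le) ?_ (abs_nonneg _)
      (mul_nonneg hT.le ((abs_nonneg _).trans (hD _ hq.2.2)))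
    refine (ContinuousLinearMap.le_opNorm _ _).trans (mul_le_mul (hb _).2 ?_ (norm_nonneg _) hC.le)
    rw [Prod.norm_def]
    exact max_le_max (by simp) (hE _ hq.2.2)
  · rw [DeltaCurve.pairing, (h0 _ (hT' q hq hlt)).2]; simp

/-- The slice of the parameter set at fixed `s`. -/
def paramSlice (I : Set ℝ) (s : ℝ) : Set ℝ := {t | 0 < t ∧ Real.log (s / t) ∈ I}

/-- Fubini with `s` as the outer variable. Integrability of the slices is known for almost every `s`
only, which suffices for `hb`. -/
theorem setIntegral_paramSet {F : ℝ × ℝ → ℝ} (hI : IsOpen I) (hF : IntegrableOn F (paramSet I))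
    {b : ℝ → ℝ} (hb : ∀ s, 0 < s → IntegrableOn (fun t => F (t, s)) (paramSlice I s) →
      ∫ t in paramSlice I s, F (t, s) = b s) :
    ∫ q in paramSet I, F q = ∫ s in Ioi 0, b s := by
  have hm := (isOpen_paramSet hI).measurableSet
  rw [← integral_indicator hm, Measure.volume_eq_prod, integral_prod_symm _
    (by rw [← Measure.volume_eq_prod]; exact hF.integrable_indicator hm),
    ← integral_indicator measurableSet_Ioi]
  have hi := Integrable.prod_left_ae (μ := (volume : Measure ℝ)) (ν := (volume : Measure ℝ))
    (f := (paramSet I).indicator F)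
    (by rw [← Measure.volume_eq_prod]; exact hF.integrable_indicator hm)
  refine integral_congr_ae (hi.mono fun s hs => ?_)
  by_cases h0 : 0 < s
  · have hsl : MeasurableSet (paramSlice I s) := by
      have : paramSlice I s = (fun t => (t, s)) ⁻¹' paramSet I := by
        ext t; simp [paramSlice, paramSet, h0]
      rw [this]
      exact measurable_prodMk_right hm
    have he : (fun t => (paramSet I).indicator F (t, s)) =
        (paramSlice I s).indicator fun t => F (t, s) := by
      ext t
      by_cases h : 0 < t ∧ Real.log (s / t) ∈ I
      · rw [indicator_of_mem (show (t, s) ∈ paramSet I from ⟨h.1, h0, h.2⟩),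
          indicator_of_mem (show t ∈ paramSlice I s from h)]
      · rw [indicator_of_notMem (fun h' : (t, s) ∈ paramSet I => h ⟨h'.1, h'.2.2⟩),
          indicator_of_notMem (show t ∉ paramSlice I s from h)]
    simp only [he] at hs ⊢
    rw [integral_indicator hsl, indicator_of_mem (mem_Ioi.2 h0)]
    exact hb s h0 ((integrable_indicator_iff hsl).1 hs)
  · rw [indicator_of_notMem (by simpa using h0)]
    have : ∀ t, (paramSet I).indicator F (t, s) = 0 := fun t =>
      indicator_of_notMem (fun h => h0 h.2.1) _
    simp [this]

theorem hasDerivAt_log_div {s t : ℝ} (hs : 0 < s) (ht : 0 < t) :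
    HasDerivAt (fun t => Real.log (s / t)) (-t⁻¹) t := by
  have h : HasDerivAt (fun t => Real.log s - Real.log t) (-t⁻¹) t :=
    (Real.hasDerivAt_log ht.ne').const_sub _
  refine h.congr_of_eventuallyEq ?_
  filter_upwards [lt_mem_nhds ht] with x hx
  exact Real.log_div hs.ne' hx.ne'

/-- At fixed `s` the point `t • Ξ (log (s / t))` has velocity `Ξ - Ξ' = U`, and `t * Q (log (s /
t))` grows at the rate `Q - Q' = N`. Thus `s` labels the material carried by the shock. -/
theorem hasDerivAt_slice (hφ : ContDiff ℝ ∞ φ) {Q : ℝ → ℝ} {N s t : ℝ} (hs : 0 < s) (ht : 0 < t)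
    {Ξ : ℝ → ℝ × ℝ} {U : ℝ × ℝ}
    (hΞ : HasDerivAt Ξ (Ξ (Real.log (s / t)) - U) (Real.log (s / t)))
    (hQ : HasDerivAt Q (Q (Real.log (s / t)) - N) (Real.log (s / t))) :
    HasDerivAt (fun t => t * Q (Real.log (s / t)) * φ (t, t • Ξ (Real.log (s / t))))
      (t * Q (Real.log (s / t)) * fderiv ℝ φ (t, t • Ξ (Real.log (s / t))) (1, U.1, U.2) +
        N * φ (t, t • Ξ (Real.log (s / t)))) t := by
  have hl := hasDerivAt_log_div hs ht
  have h1 := (hasDerivAt_id t).mul (hQ.comp t hl)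
  have h2 := (hasDerivAt_id t).smul (hΞ.scomp t hl)
  have h3 := (hasDerivAt_id t).prodMk h2
  have h4 := ((hφ.differentiable (by simp)) (t, t • Ξ (Real.log
    (s / t)))).hasFDerivAt.comp_hasDerivAt
    t h3
  refine (h1.mul h4).congr_deriv ?_
  simp only [id, Function.comp]
  have e : (1, t • -t⁻¹ • (Ξ (Real.log (s / t)) - U) + (1 : ℝ) • Ξ (Real.log (s / t))) =
      ((1 : ℝ), U.1, U.2) := by
    rw [smul_smul, mul_neg, mul_inv_cancel₀ ht.ne']
    ext <;> simp
  rw [e]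
  have : 1 * Q (Real.log (s / t)) + t * ((Q (Real.log (s / t)) - N) * -t⁻¹) = N := by
    field_simp; ring
  change (1 * Q (Real.log (s / t)) + t * ((Q (Real.log (s / t)) - N) * -t⁻¹)) *
    φ (t, t • Ξ (Real.log (s / t))) + t * Q (Real.log (s / t)) * _ = _
  rw [this]; ring

end

/-! ### Integration by parts along a delta shock -/

section
variable {φ : ℝ × ℝ × ℝ → ℝ} {d : DeltaCurve} {I : Set ℝ}

/-- The pairing of a test function with the cone over a point of the self-similar plane. -/
noncomputable def conePairing (φ : ℝ × ℝ × ℝ → ℝ) (P : ℝ × ℝ) : ℝ :=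
  ∫ t in Ioi (0 : ℝ), t * φ (t, t • P)

theorem integrable_cone (hφ : ContDiff ℝ ∞ φ) (hc : HasCompactSupport φ) (P : ℝ × ℝ) :
    Integrable fun t : ℝ => t * φ (t, t • P) := by
  have hcont : Continuous fun t : ℝ => t * φ (t, t • P) :=
    continuous_id.mul (hφ.continuous.comp (continuous_id.prodMk
      (continuous_id.smul continuous_const)))
  obtain ⟨T, C, hT, hC, h0, hb⟩ := exists_testFunction_bounds hφ hc
  refine hcont.integrable_of_hasCompactSupport
    (HasCompactSupport.of_support_subset_isCompact (isCompact_Icc (a := -T) (b := T)) fun t ht =>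
      ?_)
  by_contra h
  apply ht
  have : T < ‖(t, t • P)‖ := by
    rw [Prod.norm_def]
    refine lt_of_lt_of_le ?_ (le_max_left _ _)
    rw [Real.norm_eq_abs]
    by_contra h'
    exact h (abs_le.1 (not_lt.1 h'))
  simp only [(h0 _ this).1, mul_zero]

theorem log_div_mem_Ioo {s t a b : ℝ} (hs : 0 < s) (ht : 0 < t) :
    Real.log (s / t) ∈ Ioo a b ↔ t ∈ Ioo (s * Real.exp (-b)) (s * Real.exp (-a)) := by
  have h := Real.log_div hs.ne' ht.ne'
  have e : ∀ c, s * Real.exp (-c) = Real.exp (Real.log s - c) := fun c => by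
    rw [sub_eq_add_neg, Real.exp_add, Real.exp_log hs]
  rw [mem_Ioo, mem_Ioo, e, e, h, ← Real.lt_log_iff_exp_lt ht, ← Real.log_lt_iff_lt_exp ht]
  constructor <;> rintro ⟨h1, h2⟩ <;> constructor <;> linarith

theorem paramSlice_Ioo {s a b : ℝ} (hs : 0 < s) :
    paramSlice (Ioo a b) s = Ioo (s * Real.exp (-b)) (s * Real.exp (-a)) := by
  ext t
  constructor
  · exact fun h => (log_div_mem_Ioo hs h.1).1 h.2
  · intro h
    have ht : 0 < t := lt_trans (by positivity) h.1
    exact ⟨ht, (log_div_mem_Ioo hs ht).2 h⟩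

theorem log_div_neg_iff {s t : ℝ} (hs : 0 < s) (ht : 0 < t) : Real.log (s / t) < 0 ↔ s < t := by
  rw [Real.log_neg_iff (div_pos hs ht), div_lt_one ht]

theorem paramSlice_Iio {s : ℝ} (hs : 0 < s) : paramSlice (Iio 0) s = Ioi s := by
  ext t
  constructor
  · exact fun h => (log_div_neg_iff hs h.1).1 h.2
  · intro h
    have ht : 0 < t := hs.trans h
    exact ⟨ht, (log_div_neg_iff hs ht).2 h⟩

theorem log_div_pos_iff {s t : ℝ} (hs : 0 < s) (ht : 0 < t) : 0 < Real.log (s / t) ↔ t < s := by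
  rw [Real.log_pos_iff (div_pos hs ht).le, one_lt_div ht]

theorem paramSlice_Ioi {s : ℝ} (hs : 0 < s) : paramSlice (Ioi 0) s = Ioo 0 s := by
  ext t
  constructor
  · exact fun h => ⟨h.1, (log_div_pos_iff hs h.1).1 h.2⟩
  · exact fun h => ⟨h.1, (log_div_pos_iff hs h.1).2 h.2⟩

/-- The source term of a conserved quantity on a tame curve. -/
def DeltaCurve.HasSource (d : DeltaCurve) (I : Set ℝ) (k : Fin 4) (N : ℝ → ℝ) : Prop :=
  ContinuousOn N I ∧ (∃ C, ∀ s ∈ I, |N s| ≤ C) ∧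
    ∀ s ∈ I, HasDerivAt (fun r => d.cons r k) (d.cons s k - N s) s

variable {k : Fin 4} {N : ℝ → ℝ}

/-- The pairing plus the source term is a total `t`-derivative by `hasDerivAt_slice`. Only the
boundary values on the slice, collected in `b`, depend on the kind of interval. -/
theorem DeltaCurve.Tame.integral_pairing (h : d.Tame I) (hφ : ContDiff ℝ ∞ φ)
    (hc : HasCompactSupport φ) (hN : d.HasSource I k N) {b : ℝ → ℝ}
    (hb : ∀ s, 0 < s → ∀ f f' : ℝ → ℝ,
      (∀ t, f t = t * d.cons (Real.log (s / t)) k * φ (t, t • d.Ξ (Real.log (s / t)))) →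
      (∀ t ∈ paramSlice I s, HasDerivAt f (f' t) t) → IntegrableOn f' (paramSlice I s) →
      ∫ t in paramSlice I s, f' t = b s) :
    ∫ q in paramSet I, d.pairing φ k q = (∫ s in Ioi 0, b s) -
      ∫ q in paramSet I, N (Real.log (q.2 / q.1)) * φ (q.1, q.1 • d.Ξ (Real.log (q.2 / q.1))) := by
  have h1 := h.integrableOn_pairing hφ hc k
  have h2 := h.integrableOn_mul hφ hc hN.1 hN.2.1
  rw [eq_sub_iff_add_eq, ← integral_add h1 h2]
  refine setIntegral_paramSet h.isOpen (h1.add h2) fun s hs hint => ?_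
  refine hb s hs (fun t => t * d.cons (Real.log (s / t)) k * φ (t, t • d.Ξ (Real.log (s / t)))) _
    (fun t => rfl) (fun t ht => ?_) hint
  exact hasDerivAt_slice hφ hs ht.1 (h.hasDerivAt _ ht.2) (hN.2.2 _ ht.2)

/-- The slice at `s` is `t > s`: its lower end is on the cone over `Ξ 0`, and at infinity the test
function vanishes. -/
theorem DeltaCurve.Tame.integral_pairing_Iio (h : d.Tame (Iio 0)) (hφ : ContDiff ℝ ∞ φ)
    (hc : HasCompactSupport φ) (hN : d.HasSource (Iio 0) k N)
    (hQ : ContinuousAt (fun s => d.cons s k) 0) (hΞ : ContinuousAt d.Ξ 0) :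
    ∫ q in paramSet (Iio 0), d.pairing φ k q = -(d.cons 0 k * conePairing φ (d.Ξ 0)) -
      ∫ q in paramSet (Iio 0), N (Real.log (q.2 / q.1)) *
        φ (q.1, q.1 • d.Ξ (Real.log (q.2 / q.1))) := by
  obtain ⟨T, C, hT, hC, h0, hb⟩ := exists_testFunction_bounds hφ hc
  rw [h.integral_pairing hφ hc hN (b := fun s => -(d.cons 0 k * (s * φ (s, s • d.Ξ 0)))),
    integral_neg, integral_const_mul, conePairing]
  intro s hs f f' hf hf' hint
  rw [paramSlice_Iio hs] at hf' hint ⊢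
  have hl : ContinuousAt (fun t => Real.log (s / t)) s := (hasDerivAt_log_div hs hs).continuousAt
  have hl0 : Real.log (s / s) = 0 := by rw [div_self hs.ne', Real.log_one]
  have hcont : ContinuousAt f s := by
    have e : f = fun t => t * d.cons (Real.log (s / t)) k *
      φ (t, t • d.Ξ (Real.log (s / t))) := funext hf
    rw [e]
    refine (continuousAt_id.mul (ContinuousAt.comp (f := fun t => Real.log (s / t))
      (g := fun r => d.cons r k) (by rwa [hl0]) hl)).mul ?_
    refine hφ.continuous.continuousAt.comp (continuousAt_id.prodMk (continuousAt_id.smul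
      (ContinuousAt.comp (f := fun t => Real.log (s / t)) (g := d.Ξ) (by rwa [hl0]) hl)))
  have hlim : Tendsto f atTop (𝓝 0) := by
    refine tendsto_const_nhds.congr' ?_
    filter_upwards [eventually_gt_atTop T] with t ht
    have : T < ‖(t, t • d.Ξ (Real.log (s / t)))‖ := by
      rw [Prod.norm_def]
      exact lt_of_lt_of_le (ht.trans_le (le_abs_self t)) (le_max_left _ _)
    rw [hf, (h0 _ this).1, mul_zero]
  rw [integral_Ioi_of_hasDerivAt_of_tendsto hcont.continuousWithinAt hf' hint hlim, hf, hl0]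
  ring

/-- Both ends of the slice contribute. Its upper end is `t = s * exp (-a)`, and rescaling `s` to
this variable produces the factor `exp a`, the same conversion as in the conservation laws at `B`.
-/
theorem DeltaCurve.Tame.integral_pairing_Ioo {a : ℝ} (ha : a < 0) (h : d.Tame (Ioo a 0))
    (hφ : ContDiff ℝ ∞ φ)
    (hc : HasCompactSupport φ) (hN : d.HasSource (Ioo a 0) k N)
    (hQ : ∀ s ∈ Icc a 0, ContinuousAt (fun s => d.cons s k) s)
    (hΞ : ∀ s ∈ Icc a 0, ContinuousAt d.Ξ s) :
    ∫ q in paramSet (Ioo a 0), d.pairing φ k q =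
      Real.exp a * d.cons a k * conePairing φ (d.Ξ a) - d.cons 0 k * conePairing φ (d.Ξ 0) -
      ∫ q in paramSet (Ioo a 0), N (Real.log (q.2 / q.1)) *
        φ (q.1, q.1 • d.Ξ (Real.log (q.2 / q.1))) := by
  have hi := fun P => integrable_cone hφ hc P
  have hg : IntegrableOn (fun s => d.cons a k * ((s * Real.exp (-a)) *
      φ (s * Real.exp (-a), (s * Real.exp (-a)) • d.Ξ a))) (Ioi 0) :=
    (((hi (d.Ξ a)).comp_mul_right' (Real.exp_pos (-a)).ne').const_mul _).integrableOn
  rw [h.integral_pairing hφ hc hN (b := fun s => d.cons a k * ((s * Real.exp (-a)) *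
      φ (s * Real.exp (-a), (s * Real.exp (-a)) • d.Ξ a)) - d.cons 0 k * (s * φ (s, s • d.Ξ 0))),
    integral_sub hg ((hi _).const_mul _).integrableOn, integral_const_mul, integral_const_mul,
    integral_comp_mul_right_Ioi (fun t => t * φ (t, t • d.Ξ a)) 0 (Real.exp_pos (-a)), zero_mul,
    conePairing, conePairing, Real.exp_neg, inv_inv, smul_eq_mul]
  · ring
  intro s hs f f' hf hf' hint
  rw [paramSlice_Ioo hs, neg_zero, Real.exp_zero, mul_one] at hf' hint ⊢
  have hlt : s < s * Real.exp (-a) := by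
    have : 1 < Real.exp (-a) := Real.one_lt_exp_iff.2 (by linarith)
    nlinarith
  have hcont : ∀ t, 0 < t → Real.log (s / t) ∈ Icc a 0 → ContinuousAt f t := by
    intro t ht hmem
    have hl : ContinuousAt (fun t => Real.log (s / t)) t := (hasDerivAt_log_div hs ht).continuousAt
    have e : f = fun t => t * d.cons (Real.log (s / t)) k *
      φ (t, t • d.Ξ (Real.log (s / t))) := funext hf
    rw [e]
    refine (continuousAt_id.mul (ContinuousAt.comp (f := fun t => Real.log (s / t))
      (g := fun r => d.cons r k) (hQ _ hmem) hl)).mul ?_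
    refine hφ.continuous.continuousAt.comp (continuousAt_id.prodMk (continuousAt_id.smul
      (ContinuousAt.comp (f := fun t => Real.log (s / t)) (g := d.Ξ) (hΞ _ hmem) hl)))
  have hl0 : Real.log (s / s) = 0 := by rw [div_self hs.ne', Real.log_one]
  have hla : Real.log (s / (s * Real.exp (-a))) = a := by
    rw [div_mul_eq_div_div, div_self hs.ne', Real.exp_neg, one_div, inv_inv, Real.log_exp]
  rw [← integral_Ioc_eq_integral_Ioo, ← intervalIntegral.integral_of_le hlt.le,
    intervalIntegral.integral_eq_sub_of_hasDerivAt_of_tendsto hlt hf'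
      ((intervalIntegrable_iff_integrableOn_Ioo_of_le hlt.le).2 hint)
      ((hcont s hs (by rw [hl0]; exact ⟨ha.le, le_rfl⟩)).tendsto.mono_left nhdsWithin_le_nhds)
      ((hcont _ (by positivity) (by rw [hla]; exact ⟨le_rfl, ha.le⟩)).tendsto.mono_left
        nhdsWithin_le_nhds), hf, hf, hl0, hla]
  ring

/-- The slice at `s` is `0 < t < s`. Nothing is contributed at `t = 0`, where the concentrated
quantities `t * Q` tend to zero because `Q` is bounded. -/
theorem DeltaCurve.Tame.integral_pairing_Ioi (h : d.Tame (Ioi 0)) (hφ : ContDiff ℝ ∞ φ)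
    (hc : HasCompactSupport φ) (hN : d.HasSource (Ioi 0) k N)
    (hQ : ContinuousAt (fun s => d.cons s k) 0) (hΞ : ContinuousAt d.Ξ 0) :
    ∫ q in paramSet (Ioi 0), d.pairing φ k q = d.cons 0 k * conePairing φ (d.Ξ 0) -
      ∫ q in paramSet (Ioi 0), N (Real.log (q.2 / q.1)) *
        φ (q.1, q.1 • d.Ξ (Real.log (q.2 / q.1))) := by
  obtain ⟨T, C, hT, hC, h0, hb⟩ := exists_testFunction_bounds hφ hc
  rw [h.integral_pairing hφ hc hN (b := fun s => d.cons 0 k * (s * φ (s, s • d.Ξ 0))),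
    integral_const_mul, conePairing]
  intro s hs f f' hf hf' hint
  rw [paramSlice_Ioi hs] at hf' hint ⊢
  have hl : ContinuousAt (fun t => Real.log (s / t)) s := (hasDerivAt_log_div hs hs).continuousAt
  have hl0 : Real.log (s / s) = 0 := by rw [div_self hs.ne', Real.log_one]
  have hcont : ContinuousAt f s := by
    have e : f = fun t => t * d.cons (Real.log (s / t)) k *
      φ (t, t • d.Ξ (Real.log (s / t))) := funext hf
    rw [e]
    refine (continuousAt_id.mul (ContinuousAt.comp (f := fun t => Real.log (s / t))
      (g := fun r => d.cons r k) (by rwa [hl0]) hl)).mul ?_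
    refine hφ.continuous.continuousAt.comp (continuousAt_id.prodMk (continuousAt_id.smul
      (ContinuousAt.comp (f := fun t => Real.log (s / t)) (g := d.Ξ) (by rwa [hl0]) hl)))
  obtain ⟨D, hD⟩ := h.bounded_cons k
  have hlim : Tendsto f (𝓝[>] 0) (𝓝 0) := by
    have h1 : Tendsto (fun t : ℝ => t * (D * C)) (𝓝[>] 0) (𝓝 0) := by
      have : Tendsto (fun t : ℝ => t * (D * C)) (𝓝 0) (𝓝 (0 * (D * C))) :=
        tendsto_id.mul_const _
      rw [zero_mul] at this
      exact this.mono_left nhdsWithin_le_nhds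
    refine squeeze_zero_norm' ?_ h1
    filter_upwards [Ioo_mem_nhdsGT hs] with t ht
    have hm : Real.log (s / t) ∈ Ioi 0 := (log_div_pos_iff hs ht.1).2 ht.2
    rw [hf, Real.norm_eq_abs, abs_mul, abs_mul, abs_of_pos ht.1, mul_assoc]
    exact mul_le_mul_of_nonneg_left (mul_le_mul (hD _ hm) (hb _).1 (abs_nonneg _)
      ((abs_nonneg _).trans (hD _ hm))) ht.1.le
  rw [← integral_Ioc_eq_integral_Ioo, ← intervalIntegral.integral_of_le hs.le,
    intervalIntegral.integral_eq_sub_of_hasDerivAt_of_tendsto hs hf'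
      ((intervalIntegrable_iff_integrableOn_Ioo_of_le hs.le).2 hint) hlim
      (hcont.tendsto.mono_left nhdsWithin_le_nhds), hf, hl0]
  ring

end

/-! ### Constant states as streams of particles on straight paths -/

section
variable {φ : ℝ × ℝ × ℝ → ℝ}

theorem det_prod_smulRight (a b : ℝ × ℝ) :
    ((ContinuousLinearMap.fst ℝ ℝ ℝ).smulRight a +
      (ContinuousLinearMap.snd ℝ ℝ ℝ).smulRight b).det = a.1 * b.2 - a.2 * b.1 := by
  have : (ContinuousLinearMap.fst ℝ ℝ ℝ).smulRight a + (ContinuousLinearMap.snd ℝ ℝ ℝ).smulRight b =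
      LinearMap.toContinuousLinearMap (Matrix.toLin (Module.Basis.finTwoProd ℝ)
        (Module.Basis.finTwoProd ℝ) !![a.1, b.1; a.2, b.2]) := by
    rw [Matrix.toLin_finTwoProd_toContinuousLinearMap]
    ext <;> simp
  rw [this, LinearMap.det_toContinuousLinearMap, LinearMap.det_toLin, Matrix.det_fin_two_of]
  ring

/-- The map sends the parameters `(t, s)` of a shock point to the position at time zero of the
particle of velocity `V` that arrives there. The partial derivatives `U - V` and `(t / s) • (Ξ - U)`
come from `Ξ' = Ξ - U`. -/
theorem hasFDerivAt_footpoint {Ξ : ℝ → ℝ × ℝ} {U V : ℝ × ℝ} {q : ℝ × ℝ} (h1 : 0 < q.1)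
    (h2 : 0 < q.2)
    (h : HasDerivAt Ξ (Ξ (Real.log (q.2 / q.1)) - U) (Real.log (q.2 / q.1))) :
    HasFDerivAt (fun q : ℝ × ℝ => q.1 • (Ξ (Real.log (q.2 / q.1)) - V))
      ((ContinuousLinearMap.fst ℝ ℝ ℝ).smulRight (U - V) +
        (ContinuousLinearMap.snd ℝ ℝ ℝ).smulRight
          ((q.1 / q.2) • (Ξ (Real.log (q.2 / q.1)) - U))) q := by
  have hl : HasFDerivAt (fun q : ℝ × ℝ => Real.log q.2 - Real.log q.1)
      (q.2⁻¹ • ContinuousLinearMap.snd ℝ ℝ ℝ - q.1⁻¹ • ContinuousLinearMap.fst ℝ ℝ ℝ) q :=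
    (hasFDerivAt_snd.log h2.ne').sub (hasFDerivAt_fst.log h1.ne')
  have hl' : HasFDerivAt (fun q : ℝ × ℝ => Real.log (q.2 / q.1))
      (q.2⁻¹ • ContinuousLinearMap.snd ℝ ℝ ℝ - q.1⁻¹ • ContinuousLinearMap.fst ℝ ℝ ℝ) q := by
    refine hl.congr_of_eventuallyEq ?_
    filter_upwards [(isOpen_lt continuous_const continuous_fst).mem_nhds h1,
      (isOpen_lt continuous_const continuous_snd).mem_nhds h2] with x hx1 hx2
    exact Real.log_div (ne_of_gt hx2) (ne_of_gt hx1)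
  have hc := (h.hasFDerivAt.comp q hl').sub_const V
  have hm := hasFDerivAt_fst.smul (𝕜 := ℝ) (c := fun q : ℝ × ℝ => q.1) hc
  refine hm.congr_fderiv ?_
  ext <;> simp <;> field_simp <;> ring

/-- The coordinates `(t, x)` with `x` the foot point straighten the particle paths without a
Jacobian. -/
theorem measurePreserving_shear (V : ℝ × ℝ) :
    MeasurePreserving (fun p : ℝ × ℝ × ℝ => (p.1, p.2 + p.1 • V)) := by
  rw [Measure.volume_eq_prod]
  refine MeasurePreserving.skew_product (MeasurePreserving.id _) (g := fun t x => x + t • V) ?_ ?_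
  · have : Continuous (Function.uncurry fun (t : ℝ) (x : ℝ × ℝ) => x + t • V) := by
      simp only [Function.uncurry_def]; fun_prop
    exact this.measurable
  · exact ae_of_all _ fun t => (measurePreserving_add_right volume (t • V)).map_eq

theorem integrable_fderiv_apply (hφ : ContDiff ℝ ∞ φ) (hc : HasCompactSupport φ)
    (v : ℝ × ℝ × ℝ) : Integrable fun p => fderiv ℝ φ p v := by
  have hcont : Continuous fun p => fderiv ℝ φ p v :=
    (hφ.continuous_fderiv (by simp)).clm_apply continuous_const
  refine hcont.integrable_of_hasCompactSupport ?_
  exact (hc.fderiv (𝕜 := ℝ)).comp_left (g := fun L : ℝ × ℝ × ℝ →L[ℝ] ℝ => L v) rfl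

theorem measurableSet_cone {D : Set (ℝ × ℝ)} (hD : MeasurableSet D) :
    MeasurableSet {p : ℝ × ℝ × ℝ | 0 < p.1 ∧ p.1⁻¹ • p.2 ∈ D} := by
  have hm : Measurable fun p : ℝ × ℝ × ℝ => p.1⁻¹ • p.2 :=
    measurable_fst.inv.smul measurable_snd
  exact (measurableSet_lt measurable_const measurable_fst).inter (hm hD)

theorem hasDerivAt_ray (hφ : ContDiff ℝ ∞ φ) (x V : ℝ × ℝ) (t : ℝ) :
    HasDerivAt (fun t : ℝ => φ (t, x + t • V)) (fderiv ℝ φ (t, x + t • V) (1, V.1, V.2)) t := by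
  have h2 : HasDerivAt (fun t : ℝ => x + t • V) V t := by
    simpa using ((hasDerivAt_id t).smul_const V).const_add x
  exact ((hφ.differentiable (by simp)) _).hasFDerivAt.comp_hasDerivAt t
    ((hasDerivAt_id t).prodMk h2)

theorem integral_ray_Ioo (hφ : ContDiff ℝ ∞ φ) (x V : ℝ × ℝ) {τ : ℝ} (hτ : 0 < τ) :
    ∫ t in Ioo 0 τ, fderiv ℝ φ (t, x + t • V) (1, V.1, V.2) = φ (τ, x + τ • V) - φ (0, x) := by
  rw [← integral_Ioc_eq_integral_Ioo, ← intervalIntegral.integral_of_le hτ.le,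
    intervalIntegral.integral_eq_sub_of_hasDerivAt (fun t _ => hasDerivAt_ray hφ x V t)]
  · simp
  · refine Continuous.intervalIntegrable ?_ _ _
    refine Continuous.clm_apply ((hφ.continuous_fderiv (by simp)).comp ?_) continuous_const
    fun_prop

theorem integral_ray_Ioi (hφ : ContDiff ℝ ∞ φ) (hc : HasCompactSupport φ) (x V : ℝ × ℝ)
    (hi : IntegrableOn (fun t : ℝ => fderiv ℝ φ (t, x + t • V) (1, V.1, V.2)) (Ioi 0)) :
    ∫ t in Ioi (0 : ℝ), fderiv ℝ φ (t, x + t • V) (1, V.1, V.2) = -φ (0, x) := by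
  obtain ⟨T, C, hT, hC, h0, hb⟩ := exists_testFunction_bounds hφ hc
  have hlim : Tendsto (fun t : ℝ => φ (t, x + t • V)) atTop (𝓝 0) := by
    refine tendsto_const_nhds.congr' ?_
    filter_upwards [eventually_gt_atTop T] with t ht
    have : T < ‖(t, x + t • V)‖ := by
      rw [Prod.norm_def]
      exact lt_of_lt_of_le (ht.trans_le (le_abs_self t)) (le_max_left _ _)
    rw [(h0 _ this).1]
  rw [integral_Ioi_of_hasDerivAt_of_tendsto (hasDerivAt_ray hφ x V
    0).continuousAt.continuousWithinAt
    (fun t _ => hasDerivAt_ray hφ x V t) hi hlim]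
  simp

/-- A region `D` of the self-similar plane that is filled by particles of velocity `V` which come
from the set `Q` at time zero and which leave `D` through the curves `c j`, or never. -/
structure IsSweptBy {ι : Type} (V : ℝ × ℝ) (D Q : Set (ℝ × ℝ)) (c : ι → DeltaCurve)
    (I : ι → Set ℝ) : Prop where
  tame : ∀ j, (c j).Tame (I j)
  bounded_flux : ∀ j, ∃ C, ∀ s ∈ I j, Real.exp (-s) * |br V ((c j).U s) ((c j).Ξ s)| ≤ C
  measurableSet_region : MeasurableSet D
  measurableSet_source : MeasurableSet Q
  injective : ∀ j k s s', s ∈ I j → s' ∈ I k → (c j).Ξ s = (c k).Ξ s' → j = k ∧ s = s'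
  source : ∀ j, ∀ s ∈ I j, ∀ r : ℝ, 0 < r → r • ((c j).Ξ s - V) ∈ Q
  exit : ∀ j, ∀ s ∈ I j, ∀ r : ℝ, 0 < r → (V + r • ((c j).Ξ s - V) ∈ D ↔ 1 < r)
  hit_or_stay : ∀ᵐ x : ℝ × ℝ, x ∈ Q →
    (∃ j, ∃ s ∈ I j, ∃ r : ℝ, 0 < r ∧ x = r • ((c j).Ξ s - V)) ∨ ∀ r : ℝ, 0 < r → V + r • x ∈ D
  not_mem : ∀ᵐ x : ℝ × ℝ, x ∉ Q → ∀ r : ℝ, 0 < r → V + r • x ∉ D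

theorem DeltaCurve.Tame.continuousOn_flux {d : DeltaCurve} {I : Set ℝ} (h : d.Tame I) (V : ℝ × ℝ) :
    ContinuousOn (fun s => br V (d.U s) (d.Ξ s)) I := by
  simp only [br_eq]
  have h1 := h.continuousOn_U
  have h2 := h.continuousOn_Ξ
  fun_prop

/-- Along the path with foot point `x` the integrand is the derivative of `φ`. The path is in the
region until its exit time, for all time, or never, so the integral over it is `φ` at the exit minus
`φ (0, x)`, or just `-φ (0, x)`, or zero. The exit values are then rewritten as integrals over the
shocks, with the foot point map as change of variables. -/
theorem IsSweptBy.integral_region {ι : Type} [Fintype ι] {V : ℝ × ℝ} {D Q : Set (ℝ × ℝ)}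
    {c : ι → DeltaCurve} {I : ι → Set ℝ} (h : IsSweptBy V D Q c I) (hφ : ContDiff ℝ ∞ φ)
    (hc : HasCompactSupport φ) :
    ∫ p in {p : ℝ × ℝ × ℝ | 0 < p.1 ∧ p.1⁻¹ • p.2 ∈ D}, fderiv ℝ φ p (1, V.1, V.2) =
      (∑ j, ∫ q in paramSet (I j), (Real.exp (-(Real.log (q.2 / q.1))) *
        |br V ((c j).U (Real.log (q.2 / q.1))) ((c j).Ξ (Real.log (q.2 / q.1)))|) *
          φ (q.1, q.1 • (c j).Ξ (Real.log (q.2 / q.1)))) - ∫ x in Q, φ (0, x) := by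
  have hE := measurableSet_cone h.measurableSet_region
  set E := {p : ℝ × ℝ × ℝ | 0 < p.1 ∧ p.1⁻¹ • p.2 ∈ D} with hEd
  set g : ℝ × ℝ × ℝ → ℝ := fun p => fderiv ℝ φ p (1, V.1, V.2)
  have hg : Integrable (E.indicator g) :=
    (integrable_fderiv_apply hφ hc _).indicator hE
  have hsh := measurePreserving_shear V
  have hcont : Continuous fun p : ℝ × ℝ × ℝ => (p.1, p.2 + p.1 • V) := by fun_prop
  have hemb : MeasurableEmbedding fun p : ℝ × ℝ × ℝ => (p.1, p.2 + p.1 • V) := by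
    refine Continuous.measurableEmbedding hcont fun p q hpq => ?_
    simp only [Prod.mk.injEq] at hpq
    obtain ⟨h1, h2⟩ := hpq
    rw [h1] at h2
    exact Prod.ext h1 (add_right_cancel h2)
  have hF : Integrable fun p : ℝ × ℝ × ℝ => E.indicator g (p.1, p.2 + p.1 • V) :=
    (hsh.integrable_comp hg.aestronglyMeasurable).2 hg
  rw [← integral_indicator hE, ← hsh.integral_comp hemb, Measure.volume_eq_prod,
    integral_prod_symm _ (by rw [← Measure.volume_eq_prod]; exact hF)]
  have hsl := Integrable.prod_left_ae (μ := (volume : Measure ℝ))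
    (ν := (volume : Measure (ℝ × ℝ))) (by rw [← Measure.volume_eq_prod]; exact hF)
  let f : ι → ℝ × ℝ → ℝ × ℝ := fun j q => q.1 • ((c j).Ξ (Real.log (q.2 / q.1)) - V)
  -- In the self-similar plane the particle with foot point `x` is at `V + t⁻¹ • x` at time `t`.
  -- Growing time means a shrinking factor in `exit`, so the particle is in `D` precisely before the
  -- hit.
  have key : ∀ j, ∀ q ∈ paramSet (I j), ∀ t, 0 < t → (V + t⁻¹ • f j q ∈ D ↔ t < q.1) := by
    intro j q hq t ht
    have := h.exit j _ hq.2.2 (t⁻¹ * q.1) (mul_pos (inv_pos.2 ht) hq.1)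
    rw [← smul_smul] at this
    rw [this, inv_mul_eq_div, one_lt_div ht]
  -- If one particle had two hits, at the earlier time it would have left `D` according to one and
  -- still be in `D` according to the other.
  have htime : ∀ j k, ∀ q ∈ paramSet (I j), ∀ q' ∈ paramSet (I k), f j q = f k q' →
      q.1 = q'.1 := by
    intro j k q hq q' hq' he
    by_contra hne
    rcases lt_or_gt_of_ne hne with hlt | hlt
    · have h1 := (key k q' hq' q.1 hq.1).2 hlt
      rw [← he, key j q hq _ hq.1] at h1
      exact lt_irrefl _ h1
    · have h1 := (key j q hq q'.1 hq'.1).2 hlt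
      rw [he, key k q' hq' _ hq'.1] at h1
      exact lt_irrefl _ h1
  have hinj : ∀ j k, ∀ q ∈ paramSet (I j), ∀ q' ∈ paramSet (I k), f j q = f k q' →
      j = k ∧ q = q' := by
    intro j k q hq q' hq' he
    have ht := htime j k q hq q' hq' he
    have h1 : (c j).Ξ (Real.log (q.2 / q.1)) = (c k).Ξ (Real.log (q'.2 / q'.1)) := by
      simp only [f] at he
      rw [← show q.1 = q'.1 from ht] at he
      have h2 := smul_right_injective _ hq.1.ne' he
      rw [sub_left_inj] at h2
      rw [h2, ht]
    obtain ⟨hjk, hs⟩ := h.injective j k _ _ hq.2.2 hq'.2.2 h1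
    refine ⟨hjk, Prod.ext ht ?_⟩
    have h2 := Real.log_injOn_pos (mem_Ioi.2 (div_pos hq.2.1 hq.1))
      (mem_Ioi.2 (div_pos hq'.2.1 hq'.1)) hs
    rw [← ht] at h2
    exact (div_left_inj' hq.1.ne').1 h2
  have hinjOn : ∀ j, InjOn (f j) (paramSet (I j)) := fun j q hq q' hq' he =>
    (hinj j j q hq q' hq' he).2
  -- The hit time as a function of the foot point. Off the image of the foot point map its value is
  -- arbitrary, and it is only used under the indicator of that image.
  let τ : ι → ℝ × ℝ → ℝ := fun j x => (Function.invFunOn (f j) (paramSet (I j)) x).1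
  have hτ : ∀ j, ∀ q ∈ paramSet (I j), τ j (f j q) = q.1 := fun j q hq => by
    simp only [τ]; rw [(hinjOn j).leftInvOn_invFunOn hq]
  let G : ι → ℝ × ℝ → ℝ := fun j x => φ (τ j x, x + τ j x • V)
  have hGf : ∀ j, ∀ q ∈ paramSet (I j),
      G j (f j q) = φ (q.1, q.1 • (c j).Ξ (Real.log (q.2 / q.1))) := by
    intro j q hq
    simp only [G, hτ j q hq]
    simp only [f, smul_sub, sub_add_cancel]
  have hmeas : ∀ j, MeasurableSet (paramSet (I j)) := fun j =>
    (isOpen_paramSet (h.tame j).isOpen).measurableSet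
  have hder : ∀ j, ∀ q ∈ paramSet (I j), HasFDerivWithinAt (f j)
      ((ContinuousLinearMap.fst ℝ ℝ ℝ).smulRight ((c j).U (Real.log (q.2 / q.1)) - V) +
        (ContinuousLinearMap.snd ℝ ℝ ℝ).smulRight ((q.1 / q.2) •
          ((c j).Ξ (Real.log (q.2 / q.1)) - (c j).U (Real.log (q.2 / q.1))))) (paramSet (I j)) q :=
    fun j q hq => (hasFDerivAt_footpoint hq.1 hq.2.1
      ((h.tame j).hasDerivAt _ hq.2.2)).hasFDerivWithinAt
  have himg : ∀ j, MeasurableSet (f j '' paramSet (I j)) := fun j =>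
    measurable_image_of_fderivWithin (hmeas j) (hder j) (hinjOn j)
  -- The Jacobian is `(t / s) |[V, U, Ξ]|`, and `t / s = exp (-log (s / t))`.
  have hdet : ∀ j, ∀ q ∈ paramSet (I j),
      |((ContinuousLinearMap.fst ℝ ℝ ℝ).smulRight ((c j).U (Real.log (q.2 / q.1)) - V) +
        (ContinuousLinearMap.snd ℝ ℝ ℝ).smulRight ((q.1 / q.2) •
          ((c j).Ξ (Real.log (q.2 / q.1)) - (c j).U (Real.log (q.2 / q.1))))).det| • G j (f j q) =
      (Real.exp (-(Real.log (q.2 / q.1))) *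
        |br V ((c j).U (Real.log (q.2 / q.1))) ((c j).Ξ (Real.log (q.2 / q.1)))|) *
          φ (q.1, q.1 • (c j).Ξ (Real.log (q.2 / q.1))) := by
    intro j q hq
    rw [hGf j q hq, det_prod_smulRight, smul_eq_mul]
    congr 1
    have hd : Real.exp (-(Real.log (q.2 / q.1))) = q.1 / q.2 := by
      rw [Real.exp_neg, Real.exp_log (div_pos hq.2.1 hq.1), inv_div]
    rw [hd, ← abs_of_pos (div_pos hq.1 hq.2.1), ← abs_mul, abs_of_pos (div_pos hq.1 hq.2.1), br_eq]
    congr 1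
    simp only [Prod.fst_sub, Prod.snd_sub, Prod.smul_fst, Prod.smul_snd, smul_eq_mul]
    ring
  have hGint : ∀ j, IntegrableOn (G j) (f j '' paramSet (I j)) := by
    intro j
    rw [integrableOn_image_iff_integrableOn_abs_det_fderiv_smul volume (hmeas j) (hder j)
      (hinjOn j), integrableOn_congr_fun (hdet j) (hmeas j)]
    refine (h.tame j).integrableOn_mul hφ hc (g := fun s => Real.exp (-s) *
      |br V ((c j).U s) ((c j).Ξ s)|) ?_
      ((h.bounded_flux j).imp fun C hC s hs => by rw [abs_of_nonneg (by positivity)]; exact hC s hs)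
    exact (Real.continuous_exp.comp continuous_neg).continuousOn.mul
      ((h.tame j).continuousOn_flux V).abs
  have hQint : Integrable fun x : ℝ × ℝ => φ (0, x) := by
    have hcont : Continuous fun x : ℝ × ℝ => φ (0, x) := hφ.continuous.comp (by fun_prop)
    refine hcont.integrable_of_hasCompactSupport ?_
    exact hc.comp_isClosedEmbedding (Isometry.isClosedEmbedding
      (f := fun x : ℝ × ℝ => ((0 : ℝ), x)) (Isometry.of_dist_eq fun x y => by simp [Prod.dist_eq]))
  have hfin : (∑ j, ∫ q in paramSet (I j), (Real.exp (-(Real.log (q.2 / q.1))) *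
        |br V ((c j).U (Real.log (q.2 / q.1))) ((c j).Ξ (Real.log (q.2 / q.1)))|) *
          φ (q.1, q.1 • (c j).Ξ (Real.log (q.2 / q.1)))) - ∫ x in Q, φ (0, x) =
      ∫ x, ((∑ j, (f j '' paramSet (I j)).indicator (G j) x) - Q.indicator (fun x => φ (0, x))
        x) := by
    rw [integral_sub, integral_finsetSum, integral_indicator h.measurableSet_source]
    · congr 1
      refine Finset.sum_congr rfl fun j _ => ?_
      rw [integral_indicator (himg j), integral_image_eq_integral_abs_det_fderiv_smul volume
        (hmeas j) (hder j) (hinjOn j), setIntegral_congr_fun (hmeas j) (hdet j)]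
    · exact fun j _ => (hGint j).integrable_indicator (himg j)
    · exact integrable_finsetSum _ fun j _ => (hGint j).integrable_indicator (himg j)
    · exact hQint.indicator h.measurableSet_source
  rw [hfin]
  refine integral_congr_ae ?_
  filter_upwards [hsl, h.hit_or_stay, h.not_mem] with x hx hstay hnot
  have hmemE : ∀ t : ℝ, ((t, x + t • V) ∈ E ↔ 0 < t ∧ V + t⁻¹ • x ∈ D) := by
    intro t
    simp only [hEd, mem_ofPred_eq]
    refine and_congr_right fun ht => ?_
    rw [smul_add, smul_smul, inv_mul_cancel₀ ht.ne', one_smul, add_comm]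
  have hset : ∀ S : Set ℝ, MeasurableSet S → (∀ t, (t, x + t • V) ∈ E ↔ t ∈ S) →
      (∀ t, E.indicator g (t, x + t • V) = S.indicator (fun t => g (t, x + t • V)) t) := by
    intro S _ hS t
    by_cases ht : t ∈ S
    · rw [indicator_of_mem ht, indicator_of_mem ((hS t).2 ht)]
    · rw [indicator_of_notMem ht, indicator_of_notMem fun h => ht ((hS t).1 h)]
  by_cases hhit : ∃ j, ∃ q ∈ paramSet (I j), f j q = x
  · obtain ⟨j, q, hq, rfl⟩ := hhit
    have hS := hset (Ioo 0 q.1) measurableSet_Ioo fun t => by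
      rw [hmemE, mem_Ioo]
      exact and_congr_right fun ht => key j q hq t ht
    have hQx : f j q ∈ Q := h.source j _ hq.2.2 _ hq.1
    rw [integral_congr_ae (ae_of_all _ hS), integral_indicator measurableSet_Ioo,
      integral_ray_Ioo hφ _ _ hq.1, indicator_of_mem hQx, Finset.sum_eq_single j,
      indicator_of_mem (mem_image_of_mem _ hq)]
    · simp only [G, hτ j q hq]
    · intro k _ hkj
      refine indicator_of_notMem ?_ _
      rintro ⟨q', hq', he⟩
      exact hkj (hinj k j q' hq' q hq he).1
    · simp
  · have hsum : ∑ j, (f j '' paramSet (I j)).indicator (G j) x = 0 := by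
      refine Finset.sum_eq_zero fun j _ => indicator_of_notMem ?_ _
      rintro ⟨q, hq, he⟩
      exact hhit ⟨j, q, hq, he⟩
    rw [hsum, zero_sub]
    by_cases hQx : x ∈ Q
    · have hall : ∀ r : ℝ, 0 < r → V + r • x ∈ D := by
        refine (hstay hQx).resolve_left ?_
        rintro ⟨j, s, hs, r, hr, rfl⟩
        have hlog : Real.log (r * Real.exp s / r) = s := by
          rw [mul_div_assoc, mul_comm, div_mul_cancel₀ _ hr.ne', Real.log_exp]
        -- A hit with factor `r` at curve parameter `s` happens at time `r`, with label `r * exp s`.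
        exact hhit ⟨j, (r, r * Real.exp s), ⟨hr, by positivity, by simpa [hlog] using hs⟩,
          by simp only [f, hlog]⟩
      have hS := hset (Ioi 0) measurableSet_Ioi fun t => by
        rw [hmemE, mem_Ioi]
        exact ⟨fun h => h.1, fun ht => ⟨ht, hall _ (inv_pos.2 ht)⟩⟩
      rw [indicator_of_mem hQx, integral_congr_ae (ae_of_all _ hS),
        integral_indicator measurableSet_Ioi, integral_ray_Ioi hφ hc]
      rw [← integrable_indicator_iff measurableSet_Ioi]
      exact hx.congr (ae_of_all _ hS)
    · have hS := hset ∅ MeasurableSet.empty fun t => by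
        rw [hmemE]
        exact ⟨fun h => hnot hQx _ (inv_pos.2 h.1) h.2, fun h => absurd h (notMem_empty _)⟩
      rw [indicator_of_notMem hQx, integral_congr_ae (ae_of_all _ hS)]
      simp

end

/-! ### Weak form for the two kinds of shocks, the piecewise constant field and the initial data -/

section
variable {φ : ℝ × ℝ × ℝ → ℝ} {d : DeltaCurve} {I : Set ℝ} {L R : State} {P U₀ : ℝ × ℝ} {m₀ n₀ : ℝ}

/-- The pairing of a test function with the flux of particles of velocity `V` into `d`. -/
noncomputable def fluxPairing (φ : ℝ × ℝ × ℝ → ℝ) (V : ℝ × ℝ) (d : DeltaCurve) (I : Set ℝ) : ℝ :=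
  ∫ q in paramSet I, (Real.exp (-(Real.log (q.2 / q.1))) *
    |br V (d.U (Real.log (q.2 / q.1))) (d.Ξ (Real.log (q.2 / q.1)))|) *
      φ (q.1, q.1 • d.Ξ (Real.log (q.2 / q.1)))

theorem volume_paramSet_singleton (a : ℝ) : volume (paramSet {a}) = 0 := by
  have hsub : paramSet {a} ⊆ (LinearMap.ker (LinearMap.snd ℝ ℝ ℝ - Real.exp a • LinearMap.fst ℝ ℝ
    ℝ) :
      Submodule ℝ (ℝ × ℝ)) := by
    intro q hq
    have h : Real.log (q.2 / q.1) = a := hq.2.2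
    simp only [SetLike.mem_coe, LinearMap.mem_ker, LinearMap.sub_apply, LinearMap.smul_apply,
      LinearMap.snd_apply, LinearMap.fst_apply, smul_eq_mul]
    rw [← h, Real.exp_log (div_pos hq.2.1 hq.1), div_mul_cancel₀ _ hq.1.ne', sub_self]
  refine measure_mono_null hsub (Measure.addHaar_submodule _ _ fun h => ?_)
  have : ((0 : ℝ), (1 : ℝ)) ∈ LinearMap.ker (LinearMap.snd ℝ ℝ ℝ - Real.exp a • LinearMap.fst ℝ ℝ
    ℝ) := by
    rw [h]; trivial
  simp at this

/-- End points of parameter intervals correspond to rays in the `(t, s)`-plane, which are null sets.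
So tameness is only asked on open intervals although the solution uses closed ones. -/
theorem paramSet_ae_eq {I J : Set ℝ} {a b : ℝ} (h1 : J ⊆ I) (h2 : I ⊆ J ∪ {a} ∪ {b}) :
    (paramSet I : Set (ℝ × ℝ)) =ᵐ[volume] paramSet J := by
  refine (ae_eq_set).2 ⟨?_, ?_⟩
  · refine measure_mono_null (t := paramSet {a} ∪ paramSet {b}) ?_ (measure_union_null
      (volume_paramSet_singleton a) (volume_paramSet_singleton b))
    rintro q ⟨hq, hn⟩
    rcases h2 hq.2.2 with (h | h) | h
    · exact absurd ⟨hq.1, hq.2.1, h⟩ hn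
    · exact Or.inl ⟨hq.1, hq.2.1, h⟩
    · exact Or.inr ⟨hq.1, hq.2.1, h⟩
  · have : paramSet J \ paramSet I = ∅ :=
      sdiff_eq_empty.2 fun q hq => ⟨hq.1, hq.2.1, h1 hq.2.2⟩
    rw [this]; simp

theorem Ici_ae {F : ℝ × ℝ → ℝ} (a : ℝ) : (IntegrableOn F (paramSet (Ioi a)) →
    IntegrableOn F (paramSet (Ici a))) ∧
    ∫ q in paramSet (Ici a), F q = ∫ q in paramSet (Ioi a), F q := by
  have h : (paramSet (Ici a) : Set (ℝ × ℝ)) =ᵐ[volume] paramSet (Ioi a) :=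
    paramSet_ae_eq (a := a) (b := a) Ioi_subset_Ici_self fun x hx => by
      rcases eq_or_lt_of_le (mem_Ici.1 hx) with h | h
      · exact Or.inr h.symm
      · exact Or.inl (Or.inl h)
  exact ⟨fun hi => hi.congr_set_ae h, setIntegral_congr_set h⟩

theorem Iic_ae {F : ℝ × ℝ → ℝ} (a : ℝ) : (IntegrableOn F (paramSet (Iio a)) →
    IntegrableOn F (paramSet (Iic a))) ∧
    ∫ q in paramSet (Iic a), F q = ∫ q in paramSet (Iio a), F q := by
  have h : (paramSet (Iic a) : Set (ℝ × ℝ)) =ᵐ[volume] paramSet (Iio a) :=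
    paramSet_ae_eq (a := a) (b := a) Iio_subset_Iic_self fun x hx => by
      rcases eq_or_lt_of_le (mem_Iic.1 hx) with h | h
      · exact Or.inr h
      · exact Or.inl (Or.inl h)
  exact ⟨fun hi => hi.congr_set_ae h, setIntegral_congr_set h⟩

theorem Icc_ae {F : ℝ × ℝ → ℝ} (a b : ℝ) : (IntegrableOn F (paramSet (Ioo a b)) →
    IntegrableOn F (paramSet (Icc a b))) ∧
    ∫ q in paramSet (Icc a b), F q = ∫ q in paramSet (Ioo a b), F q := by
  have h : (paramSet (Icc a b) : Set (ℝ × ℝ)) =ᵐ[volume] paramSet (Ioo a b) :=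
    paramSet_ae_eq (a := a) (b := b) Ioo_subset_Icc_self fun x hx => by
      rcases eq_or_lt_of_le hx.1 with h | h
      · exact Or.inl (Or.inr h.symm)
      rcases eq_or_lt_of_le hx.2 with h' | h'
      · exact Or.inr h'
      · exact Or.inl (Or.inl ⟨h, h'⟩)
  exact ⟨fun hi => hi.congr_set_ae h, setIntegral_congr_set h⟩

theorem ne_of_br_ne_zero (h : br L.vel R.vel P ≠ 0) (hL : 0 < L.ρ) (hR : 0 < R.ρ) :
    P ≠ deltaVel L R := by
  rintro rfl
  apply h
  have h1 := Real.sqrt_pos.2 hL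
  have h2 := Real.sqrt_pos.2 hR
  simp only [br_eq, deltaVel, Prod.fst_add, Prod.snd_add, Prod.smul_fst, Prod.smul_snd,
    smul_eq_mul]
  field_simp
  ring

theorem tame_straightDelta (hL : 0 < L.ρ) (hR : 0 < R.ρ) (hb : 0 < br L.vel R.vel P) :
    (straightDelta L R P).Tame (Ioi 0) where
  isOpen := isOpen_Ioi
  hasDerivAt s _ := hasDerivAt_straightDelta_Ξ s
  continuousOn_U := continuousOn_const
  bounded_U := ⟨‖deltaVel L R‖, fun _ _ => le_rfl⟩
  continuousOn_cons k := (continuousOn_const (c := (straightDelta L R P).cons 0 k))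
  bounded_cons k := ⟨|(straightDelta L R P).cons 0 k|, fun _ _ => le_rfl⟩
  bounded_param T := by
    have hne : 0 < ‖P - deltaVel L R‖ := norm_pos_iff.2 (sub_ne_zero.2
      (ne_of_br_ne_zero hb.ne' hL hR))
    refine ⟨(T + T * ‖deltaVel L R‖) / ‖P - deltaVel L R‖, fun q hq h1 h2 => ?_⟩
    rw [le_div_iff₀ hne]
    have e : q.2 • (P - deltaVel L R) = q.1 • (straightDelta L R P).Ξ (Real.log (q.2 / q.1)) -
        q.1 • deltaVel L R := by
      simp only [straightDelta]
      rw [Real.exp_log (div_pos hq.2.1 hq.1), smul_add, add_sub_cancel_left, smul_smul,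
        mul_div_cancel₀ _ hq.1.ne']
    calc q.2 * ‖P - deltaVel L R‖ = ‖q.2 • (P - deltaVel L R)‖ := by
          rw [norm_smul, Real.norm_of_nonneg hq.2.1.le]
      _ ≤ T + T * ‖deltaVel L R‖ := by
          rw [e]
          refine (norm_sub_le _ _).trans (add_le_add h2 ?_)
          rw [norm_smul, Real.norm_of_nonneg hq.1.le]
          exact mul_le_mul_of_nonneg_right h1 (norm_nonneg _)

theorem exp_neg_mul_abs_flux_left (hL : 0 < L.ρ) (hR : 0 < R.ρ) (hb : 0 < br L.vel R.vel P)
    (s : ℝ) :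
    Real.exp (-s) * |br L.vel ((straightDelta L R P).U s) ((straightDelta L R P).Ξ s)| =
      √R.ρ / (√L.ρ + √R.ρ) * br L.vel R.vel P := by
  have h1 := Real.sqrt_pos.2 hL
  have h2 := Real.sqrt_pos.2 hR
  rw [br_left_straightDelta hL hR, abs_of_pos (by positivity), ← mul_assoc, ← Real.exp_add]
  simp

theorem exp_neg_mul_abs_flux_right (hL : 0 < L.ρ) (hR : 0 < R.ρ) (hb : 0 < br L.vel R.vel P)
    (s : ℝ) :
    Real.exp (-s) * |br R.vel ((straightDelta L R P).U s) ((straightDelta L R P).Ξ s)| =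
      √L.ρ / (√L.ρ + √R.ρ) * br L.vel R.vel P := by
  have h1 := Real.sqrt_pos.2 hL
  have h2 := Real.sqrt_pos.2 hR
  rw [br_right_straightDelta hL hR, abs_neg, abs_of_pos (by positivity), ← mul_assoc, ←
    Real.exp_add]
  simp

/-- The entropy condition fixes the signs of the two determinants. With absolute values, the source
is the sum of what both sides feed into the shock. -/
theorem straightDelta_cons_eq (hL : 0 < L.ρ) (hR : 0 < R.ρ) (hb : 0 < br L.vel R.vel P) (s : ℝ)
    (k : Fin 4) : (straightDelta L R P).cons s k =
      L.cons k * (Real.exp (-s) * |br L.vel ((straightDelta L R P).U s)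
        ((straightDelta L R P).Ξ s)|) +
      R.cons k * (Real.exp (-s) * |br R.vel ((straightDelta L R P).U s)
        ((straightDelta L R P).Ξ s)|) := by
  rw [exp_neg_mul_abs_flux_left hL hR hb, exp_neg_mul_abs_flux_right hL hR hb,
    straightDelta_balance hL hR, br_left_straightDelta hL hR, br_right_straightDelta hL hR]
  have he : Real.exp s * Real.exp (-s) = 1 := by rw [← Real.exp_add]; simp
  linear_combination (L.cons k * (√R.ρ / (√L.ρ + √R.ρ) * br L.vel R.vel P) +
    R.cons k * (√L.ρ / (√L.ρ + √R.ρ) * br L.vel R.vel P)) * he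

theorem DeltaCurve.Tame.integrableOn_flux (h : d.Tame I) (hφ : ContDiff ℝ ∞ φ)
    (hc : HasCompactSupport φ) {V : ℝ × ℝ}
    (hV : ∃ C, ∀ s ∈ I, Real.exp (-s) * |br V (d.U s) (d.Ξ s)| ≤ C) :
    IntegrableOn (fun q : ℝ × ℝ => (Real.exp (-(Real.log (q.2 / q.1))) *
    |br V (d.U (Real.log (q.2 / q.1))) (d.Ξ (Real.log (q.2 / q.1)))|) *
      φ (q.1, q.1 • d.Ξ (Real.log (q.2 / q.1)))) (paramSet I) := by
  refine h.integrableOn_mul hφ hc (g := fun s => Real.exp (-s) * |br V (d.U s) (d.Ξ s)|) ?_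
    (hV.imp fun C hC s hs => by rw [abs_of_nonneg (by positivity)]; exact hC s hs)
  exact (Real.continuous_exp.comp continuous_neg).continuousOn.mul (h.continuousOn_flux V).abs

theorem bounded_flux_left (hL : 0 < L.ρ) (hR : 0 < R.ρ) (hb : 0 < br L.vel R.vel P) (I : Set ℝ) :
    ∃ C, ∀ s ∈ I, Real.exp (-s) *
      |br L.vel ((straightDelta L R P).U s) ((straightDelta L R P).Ξ s)| ≤ C :=
  ⟨_, fun s _ => (exp_neg_mul_abs_flux_left hL hR hb s).le⟩

theorem bounded_flux_right (hL : 0 < L.ρ) (hR : 0 < R.ρ) (hb : 0 < br L.vel R.vel P) (I : Set ℝ) :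
    ∃ C, ∀ s ∈ I, Real.exp (-s) *
      |br R.vel ((straightDelta L R P).U s) ((straightDelta L R P).Ξ s)| ≤ C :=
  ⟨_, fun s _ => (exp_neg_mul_abs_flux_right hL hR hb s).le⟩

/-- Since the weights are constant, the source is the weight itself; `straightDelta_cons_eq` splits
it into the two fluxes that reappear in the adjacent regions. -/
theorem integral_pairing_straightDelta (hL : 0 < L.ρ) (hR : 0 < R.ρ) (hb : 0 < br L.vel R.vel P)
    (hφ : ContDiff ℝ ∞ φ) (hc : HasCompactSupport φ) (k : Fin 4) :
    IntegrableOn ((straightDelta L R P).pairing φ k) (paramSet (Ici 0)) ∧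
    ∫ q in paramSet (Ici 0), (straightDelta L R P).pairing φ k q =
      (straightDelta L R P).cons 0 k * conePairing φ P -
        (L.cons k * fluxPairing φ L.vel (straightDelta L R P) (Ioi 0) +
          R.cons k * fluxPairing φ R.vel (straightDelta L R P) (Ioi 0)) := by
  have ht := tame_straightDelta hL hR hb
  have hN : (straightDelta L R P).HasSource (Ioi 0) k fun s => (straightDelta L R P).cons s k := by
    refine ⟨ht.continuousOn_cons k, ht.bounded_cons k, fun s _ => ?_⟩
    rw [sub_self]
    exact hasDerivAt_const s ((straightDelta L R P).cons 0 k)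
  refine ⟨(Ici_ae 0).1 (ht.integrableOn_pairing hφ hc k), ?_⟩
  rw [(Ici_ae 0).2, ht.integral_pairing_Ioi hφ hc hN (continuousAt_const)
    (hasDerivAt_straightDelta_Ξ 0).continuousAt, straightDelta_Ξ_zero, fluxPairing, fluxPairing,
    ← integral_const_mul, ← integral_const_mul, ← integral_add
      ((ht.integrableOn_flux hφ hc (bounded_flux_left hL hR hb _)).const_mul _)
      ((ht.integrableOn_flux hφ hc (bounded_flux_right hL hR hb _)).const_mul _)]
  congr 2
  ext q
  rw [straightDelta_cons_eq hL hR hb]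
  ring

theorem exp_neg_mul_abs_flux_vacuum (hρ : 0 < R.ρ) (hm : 0 < m₀) (hb : br R.vel U₀ P < 0) {s : ℝ}
    (hs : s ≤ 0) : Real.exp (-s) * |br R.vel ((vacuumShock R P U₀ m₀ n₀).U s)
      ((vacuumShock R P U₀ m₀ n₀).Ξ s)| =
        (shockRatio (shockShape R P U₀ m₀) s)⁻¹ * -br R.vel U₀ P := by
  have hr := one_le_shockRatio (shockShape_pos hρ hm hb) hs
  rw [br_vacuumShock, abs_mul, abs_of_neg hb, abs_of_pos (by positivity), ← mul_assoc, ← mul_assoc,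
    ← Real.exp_add]
  simp

theorem bounded_flux_vacuum (hρ : 0 < R.ρ) (hm : 0 < m₀) (hb : br R.vel U₀ P < 0) {I : Set ℝ}
    (hI : I ⊆ Iic 0) : ∃ C, ∀ s ∈ I, Real.exp (-s) * |br R.vel ((vacuumShock R P U₀ m₀ n₀).U s)
      ((vacuumShock R P U₀ m₀ n₀).Ξ s)| ≤ C := by
  refine ⟨1 * -br R.vel U₀ P, fun s hs => ?_⟩
  rw [exp_neg_mul_abs_flux_vacuum hρ hm hb (hI hs)]
  exact mul_le_mul_of_nonneg_right (inv_le_one_of_one_le₀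
    (one_le_shockRatio (shockShape_pos hρ hm hb) (hI hs))) (by linarith)

theorem tame_vacuumShock (hρ : 0 < R.ρ) (hm : 0 < m₀) (hb : br R.vel U₀ P < 0) :
    (vacuumShock R P U₀ m₀ n₀).Tame (Iio 0) where
  isOpen := isOpen_Iio
  hasDerivAt s hs := hasDerivAt_vacuumShock_Ξ hρ hm hb (le_of_lt hs)
  continuousOn_U := fun s hs => by
    have hκ := shockShape_pos hρ hm hb
    have h1 := hasDerivAt_shockRatio hκ (le_of_lt hs)
    have h2 := one_le_shockRatio hκ (le_of_lt hs)
    exact (((h1.continuousAt.inv₀ (by linarith)).smul continuousAt_const).const_add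
      _).continuousWithinAt
  bounded_U := by
    refine ⟨‖R.vel‖ + 1 * ‖U₀ - R.vel‖, fun s hs => ?_⟩
    have h2 := one_le_shockRatio (shockShape_pos hρ hm hb) (le_of_lt hs)
    refine (norm_add_le _ _).trans (add_le_add le_rfl ?_)
    rw [norm_smul]
    refine mul_le_mul_of_nonneg_right ?_ (norm_nonneg _)
    rw [Real.norm_of_nonneg (by positivity)]
    exact inv_le_one_of_one_le₀ h2
  continuousOn_cons k s hs :=
    (hasDerivAt_vacuumShock_cons hρ hm hb (le_of_lt hs) k).continuousAt.continuousWithinAt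
  bounded_cons k := by
    have h := (vacuumShockBehaviour (n₀ := n₀) hρ hm hb).1
    -- Near `-∞` the quantities are bounded because they converge; the remaining parameters form a
    -- compact interval.
    have hlim : ∃ l, Tendsto (fun s => (vacuumShock R P U₀ m₀ n₀).cons s k) atBot (𝓝 l) := by
      have h1 := h.fst_nhds
      have h2 := h.snd_nhds.fst_nhds
      have h3 := h.snd_nhds.snd_nhds.fst_nhds
      simp only at h1 h2 h3
      revert k
      refine forall_fin_four ⟨_, h1⟩ ⟨_, h1.mul h3.fst_nhds⟩ ⟨_, h1.mul h3.snd_nhds⟩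
        ⟨_, h2.add ((h1.div_const 2).mul ((h3.fst_nhds.pow 2).add (h3.snd_nhds.pow 2)))⟩
    obtain ⟨l, hl⟩ := hlim
    obtain ⟨M, hM⟩ := eventually_atBot.1 (hl.abs.eventually (eventually_lt_nhds (lt_add_one |l|)))
    have hcont : ContinuousOn (fun s => (vacuumShock R P U₀ m₀ n₀).cons s k) (Icc M 0) :=
      fun s hs => (hasDerivAt_vacuumShock_cons hρ hm hb hs.2 k).continuousAt.continuousWithinAt
    obtain ⟨C, hC⟩ := isCompact_Icc.exists_bound_of_continuousOn hcont
    refine ⟨max (|l| + 1) C, fun s hs => ?_⟩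
    rcases le_total s M with h | h
    · exact (hM s h).le.trans (le_max_left _ _)
    · exact (hC s ⟨h, le_of_lt hs⟩).trans (le_max_right _ _)
  -- A negative parameter means `s < t`, so bounded time alone bounds `s`.
  bounded_param T := ⟨T, fun q hq h1 _ => ((log_div_neg_iff hq.2.1 hq.1).1 hq.2.2).le.trans h1⟩

theorem hasSource_vacuumShock (hρ : 0 < R.ρ) (hm : 0 < m₀) (hb : br R.vel U₀ P < 0) (k : Fin 4) :
    (vacuumShock R P U₀ m₀ n₀).HasSource (Iio 0) k fun s => R.cons k * (Real.exp (-s) *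
      |br R.vel ((vacuumShock R P U₀ m₀ n₀).U s) ((vacuumShock R P U₀ m₀ n₀).Ξ s)|) := by
  have ht := tame_vacuumShock (n₀ := n₀) hρ hm hb
  refine ⟨?_, ?_, fun s hs => ?_⟩
  · exact continuousOn_const.mul ((Real.continuous_exp.comp continuous_neg).continuousOn.mul
      (ht.continuousOn_flux _).abs)
  · obtain ⟨C, hC⟩ := bounded_flux_vacuum (n₀ := n₀) hρ hm hb Iio_subset_Iic_self
    refine ⟨|R.cons k| * C, fun s hs => ?_⟩
    rw [abs_mul, abs_of_nonneg (a := Real.exp _ * _) (by positivity)]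
    exact mul_le_mul_of_nonneg_left (hC s hs) (abs_nonneg _)
  · refine (hasDerivAt_vacuumShock_cons hρ hm hb (le_of_lt hs) k).congr_deriv ?_
    simp only [abs_of_neg (br_vacuumShock_neg (n₀ := n₀) hρ hm hb (le_of_lt hs))]
    ring

theorem DeltaCurve.HasSource.mono {d : DeltaCurve} {I J : Set ℝ} {k : Fin 4} {N : ℝ → ℝ}
    (h : d.HasSource I k N) (hJ : J ⊆ I) : d.HasSource J k N :=
  ⟨h.1.mono hJ, h.2.1.imp fun _ hC s hs => hC s (hJ hs), fun s hs => h.2.2 s (hJ hs)⟩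

theorem integral_pairing_vacuumShock_Iic (hρ : 0 < R.ρ) (hm : 0 < m₀) (hb : br R.vel U₀ P < 0)
    (hφ : ContDiff ℝ ∞ φ) (hc : HasCompactSupport φ) (k : Fin 4) :
    IntegrableOn ((vacuumShock R P U₀ m₀ n₀).pairing φ k) (paramSet (Iic 0)) ∧
    ∫ q in paramSet (Iic 0), (vacuumShock R P U₀ m₀ n₀).pairing φ k q =
      -((vacuumShock R P U₀ m₀ n₀).cons 0 k * conePairing φ P) -
        R.cons k * fluxPairing φ R.vel (vacuumShock R P U₀ m₀ n₀) (Iio 0) := by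
  have ht := tame_vacuumShock (n₀ := n₀) hρ hm hb
  refine ⟨(Iic_ae 0).1 (ht.integrableOn_pairing hφ hc k), ?_⟩
  rw [(Iic_ae 0).2, ht.integral_pairing_Iio hφ hc (hasSource_vacuumShock hρ hm hb k)
    (hasDerivAt_vacuumShock_cons hρ hm hb le_rfl k).continuousAt
    (hasDerivAt_vacuumShock_Ξ hρ hm hb le_rfl).continuousAt, vacuumShock_Ξ_zero, fluxPairing,
    ← integral_const_mul]
  congr 2
  ext q
  ring

/-- For a shock that is cut off at a collision: the term at `a` is what it hands over there. -/
theorem integral_pairing_vacuumShock_Icc (hρ : 0 < R.ρ) (hm : 0 < m₀) (hb : br R.vel U₀ P < 0)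
    (hφ : ContDiff ℝ ∞ φ) (hc : HasCompactSupport φ) (k : Fin 4) {a : ℝ} (ha : a < 0) :
    IntegrableOn ((vacuumShock R P U₀ m₀ n₀).pairing φ k) (paramSet (Icc a 0)) ∧
    ∫ q in paramSet (Icc a 0), (vacuumShock R P U₀ m₀ n₀).pairing φ k q =
      Real.exp a * (vacuumShock R P U₀ m₀ n₀).cons a k *
        conePairing φ ((vacuumShock R P U₀ m₀ n₀).Ξ a) -
      (vacuumShock R P U₀ m₀ n₀).cons 0 k * conePairing φ P -
        R.cons k * fluxPairing φ R.vel (vacuumShock R P U₀ m₀ n₀) (Ioo a 0) := by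
  have hs : Ioo a 0 ⊆ Iio 0 := fun s hs => hs.2
  have ht := (tame_vacuumShock (n₀ := n₀) hρ hm hb).mono isOpen_Ioo hs
  refine ⟨(Icc_ae a 0).1 (ht.integrableOn_pairing hφ hc k), ?_⟩
  rw [(Icc_ae a 0).2, ht.integral_pairing_Ioo ha hφ hc ((hasSource_vacuumShock hρ hm hb k).mono hs)
    (fun s hs => (hasDerivAt_vacuumShock_cons hρ hm hb hs.2 k).continuousAt)
    (fun s hs => (hasDerivAt_vacuumShock_Ξ hρ hm hb hs.2).continuousAt), vacuumShock_Ξ_zero,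
    fluxPairing, ← integral_const_mul]
  congr 2
  ext q
  ring

theorem integral_add_add {α : Type*} [MeasurableSpace α] {μ : Measure α} {f g h : α → ℝ}
    (hf : Integrable f μ) (hg : Integrable g μ) (hh : Integrable h μ) :
    ∫ x, (f x + g x + h x) ∂μ = ∫ x, f x ∂μ + ∫ x, g x ∂μ + ∫ x, h x ∂μ := by
  rw [← integral_add hf hg]
  exact integral_add (hf.add hg) hh

/-- The field with the value `S i` in the region `D i`, and vacuum elsewhere. -/
noncomputable def patch (S₁ S₂ S₃ : State) (D : Fin 4 → Set (ℝ × ℝ)) (X : ℝ × ℝ) : State :=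
  open Classical in if X ∈ D 1 then S₁ else if X ∈ D 2 then S₂ else if X ∈ D 3 then S₃ else vacuum

variable {S₁ S₂ S₃ : State} {D : Fin 4 → Set (ℝ × ℝ)}

theorem bulkPairing_patch (hD : Pairwise (Function.onFun Disjoint D)) (k : Fin 4)
    {p : ℝ × ℝ × ℝ} (hp : 0 < p.1) :
    bulkPairing (patch S₁ S₂ S₃ D) φ k p =
      S₁.cons k * {p : ℝ × ℝ × ℝ | 0 < p.1 ∧ p.1⁻¹ • p.2 ∈ D 1}.indicator
        (fun p => fderiv ℝ φ p (1, S₁.vel.1, S₁.vel.2)) p +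
      S₂.cons k * {p : ℝ × ℝ × ℝ | 0 < p.1 ∧ p.1⁻¹ • p.2 ∈ D 2}.indicator
        (fun p => fderiv ℝ φ p (1, S₂.vel.1, S₂.vel.2)) p +
      S₃.cons k * {p : ℝ × ℝ × ℝ | 0 < p.1 ∧ p.1⁻¹ • p.2 ∈ D 3}.indicator
        (fun p => fderiv ℝ φ p (1, S₃.vel.1, S₃.vel.2)) p := by
  have d12 : Disjoint (D 1) (D 2) := hD (by decide)
  have d13 : Disjoint (D 1) (D 3) := hD (by decide)
  have d23 : Disjoint (D 2) (D 3) := hD (by decide)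
  classical
  have hi : ∀ i, ∀ f : ℝ × ℝ × ℝ → ℝ, {p : ℝ × ℝ × ℝ | 0 < p.1 ∧ p.1⁻¹ • p.2 ∈ D i}.indicator f p =
      if p.1⁻¹ • p.2 ∈ D i then f p else 0 := by
    intro i f
    rw [indicator_apply]
    simp only [mem_ofPred_eq, hp, true_and]
  rw [hi, hi, hi]
  simp only [bulkPairing, patch]
  by_cases h1 : p.1⁻¹ • p.2 ∈ D 1
  · have h2 : p.1⁻¹ • p.2 ∉ D 2 := disjoint_left.1 d12 h1
    have h3 : p.1⁻¹ • p.2 ∉ D 3 := disjoint_left.1 d13 h1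
    simp [h1, h2, h3, State.vel]
  · by_cases h2 : p.1⁻¹ • p.2 ∈ D 2
    · have h3 : p.1⁻¹ • p.2 ∉ D 3 := disjoint_left.1 d23 h2
      simp [h1, h2, h3, State.vel]
    · by_cases h3 : p.1⁻¹ • p.2 ∈ D 3
      · simp [h1, h2, h3, State.vel]
      · simp [h1, h2, h3, vacuum_cons]

theorem integral_bulkPairing_patch (hD : Pairwise (Function.onFun Disjoint D))
    (hm : ∀ i, MeasurableSet (D i)) (hφ : ContDiff ℝ ∞ φ) (hc : HasCompactSupport φ) (k : Fin 4) :
    IntegrableOn (bulkPairing (patch S₁ S₂ S₃ D) φ k) {p | 0 < p.1} ∧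
    ∫ p in {p : ℝ × ℝ × ℝ | 0 < p.1}, bulkPairing (patch S₁ S₂ S₃ D) φ k p =
      S₁.cons k * (∫ p in {p : ℝ × ℝ × ℝ | 0 < p.1 ∧ p.1⁻¹ • p.2 ∈ D 1},
        fderiv ℝ φ p (1, S₁.vel.1, S₁.vel.2)) +
      S₂.cons k * (∫ p in {p : ℝ × ℝ × ℝ | 0 < p.1 ∧ p.1⁻¹ • p.2 ∈ D 2},
        fderiv ℝ φ p (1, S₂.vel.1, S₂.vel.2)) +
      S₃.cons k * ∫ p in {p : ℝ × ℝ × ℝ | 0 < p.1 ∧ p.1⁻¹ • p.2 ∈ D 3},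
        fderiv ℝ φ p (1, S₃.vel.1, S₃.vel.2) := by
  have hM : MeasurableSet {p : ℝ × ℝ × ℝ | 0 < p.1} := measurableSet_lt measurable_const
    measurable_fst
  have hint : ∀ (S : State) (i : Fin 4), Integrable fun p => S.cons k *
      {p : ℝ × ℝ × ℝ | 0 < p.1 ∧ p.1⁻¹ • p.2 ∈ D i}.indicator
        (fun p => fderiv ℝ φ p (1, S.vel.1, S.vel.2)) p := fun S i =>
    ((integrable_fderiv_apply hφ hc _).indicator (measurableSet_cone (hm i))).const_mul _
  have hval : ∀ (S : State) (i : Fin 4), ∫ p in {p : ℝ × ℝ × ℝ | 0 < p.1}, S.cons k *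
      {p : ℝ × ℝ × ℝ | 0 < p.1 ∧ p.1⁻¹ • p.2 ∈ D i}.indicator
        (fun p => fderiv ℝ φ p (1, S.vel.1, S.vel.2)) p = S.cons k *
      ∫ p in {p : ℝ × ℝ × ℝ | 0 < p.1 ∧ p.1⁻¹ • p.2 ∈ D i},
        fderiv ℝ φ p (1, S.vel.1, S.vel.2) := fun S i => by
    rw [integral_const_mul, setIntegral_indicator (measurableSet_cone (hm i))]
    congr 3
    ext p
    simp only [mem_inter_iff, mem_ofPred_eq]
    tauto
  have hsum := (((hint S₁ 1).add (hint S₂ 2)).add (hint S₃ 3)).integrableOn (s := {p | 0 < p.1})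
  have hcongr : EqOn (bulkPairing (patch S₁ S₂ S₃ D) φ k) _ {p | 0 < p.1} := fun p hp =>
    bulkPairing_patch hD k hp
  refine ⟨(integrableOn_congr_fun hcongr hM).2 hsum, ?_⟩
  rw [setIntegral_congr_fun hM hcongr,
    integral_add_add (hint _ _).integrableOn (hint _ _).integrableOn (hint _ _).integrableOn,
    hval, hval, hval]

theorem integral_riemannData (hφ : ContDiff ℝ ∞ φ) (hc : HasCompactSupport φ) (k : Fin 4) :
    Integrable (fun q => (riemannData S₁ S₂ S₃ q).cons k * φ (0, q)) ∧
    ∫ q : ℝ × ℝ, (riemannData S₁ S₂ S₃ q).cons k * φ (0, q) =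
      S₁.cons k * (∫ q in {q : ℝ × ℝ | 0 ≤ q.1 ∧ 0 ≤ q.2}, φ (0, q)) +
      S₂.cons k * (∫ q in {q : ℝ × ℝ | q.1 < 0 ∧ 0 ≤ q.2}, φ (0, q)) +
      S₃.cons k * ∫ q in {q : ℝ × ℝ | q.2 < 0}, φ (0, q) := by
  have hQint : Integrable fun x : ℝ × ℝ => φ (0, x) := by
    have hcont : Continuous fun x : ℝ × ℝ => φ (0, x) := hφ.continuous.comp (by fun_prop)
    refine hcont.integrable_of_hasCompactSupport ?_
    exact hc.comp_isClosedEmbedding (Isometry.isClosedEmbedding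
      (f := fun x : ℝ × ℝ => ((0 : ℝ), x)) (Isometry.of_dist_eq fun x y => by simp [Prod.dist_eq]))
  have m1 : MeasurableSet {q : ℝ × ℝ | 0 ≤ q.1 ∧ 0 ≤ q.2} :=
    (measurableSet_le measurable_const measurable_fst).inter
      (measurableSet_le measurable_const measurable_snd)
  have m2 : MeasurableSet {q : ℝ × ℝ | q.1 < 0 ∧ 0 ≤ q.2} :=
    (measurableSet_lt measurable_fst measurable_const).inter
      (measurableSet_le measurable_const measurable_snd)
  have m3 : MeasurableSet {q : ℝ × ℝ | q.2 < 0} := measurableSet_lt measurable_snd measurable_const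
  have he : (fun q : ℝ × ℝ => (riemannData S₁ S₂ S₃ q).cons k * φ (0, q)) = fun q =>
      S₁.cons k * {q : ℝ × ℝ | 0 ≤ q.1 ∧ 0 ≤ q.2}.indicator (fun q => φ (0, q)) q +
      S₂.cons k * {q : ℝ × ℝ | q.1 < 0 ∧ 0 ≤ q.2}.indicator (fun q => φ (0, q)) q +
      S₃.cons k * {q : ℝ × ℝ | q.2 < 0}.indicator (fun q => φ (0, q)) q := by
    ext q
    classical
    simp only [riemannData, indicator_apply, mem_ofPred_eq]
    by_cases h2 : q.2 < 0
    · simp [h2, not_le.2 h2]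
    · by_cases h1 : q.1 < 0
      · simp [h2, h1, not_lt.1 h2, not_le.2 h1]
      · simp [h2, h1, not_lt.1 h2, not_lt.1 h1]
  have i1 := (hQint.indicator m1).const_mul (S₁.cons k)
  have i2 := (hQint.indicator m2).const_mul (S₂.cons k)
  have i3 := (hQint.indicator m3).const_mul (S₃.cons k)
  rw [he]
  refine ⟨(i1.add i2).add i3, ?_⟩
  rw [integral_add_add i1 i2 i3, integral_const_mul, integral_const_mul,
    integral_const_mul, integral_indicator m1, integral_indicator m2, integral_indicator m3]

end

/-! ### Vacuum shocks as arcs of conics -/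

/-- The barycentric coordinate of `X` belonging to the vertex `P` of the triangle `P U V`. -/
noncomputable def coordA (V P U X : ℝ × ℝ) : ℝ := br V U X / br V U P

/-- The barycentric coordinate of `X` belonging to the vertex `U` of the triangle `P U V`. -/
noncomputable def coordC (V P U X : ℝ × ℝ) : ℝ := br V X P / br V U P

/-- The defining function of the conic on which a vacuum shock lies. -/
noncomputable def conic (κ : ℝ) (V P U X : ℝ × ℝ) : ℝ :=
  coordC V P U X ^ 2 - 2 * κ * coordA V P U X * (1 - coordA V P U X - coordC V P U X)

section
variable {κ : ℝ} {V P U X Y : ℝ × ℝ}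

@[fun_prop] theorem continuous_coordA : Continuous (coordA V P U) := by
  unfold coordA; simp only [br_eq]; fun_prop

@[fun_prop] theorem continuous_coordC : Continuous (coordC V P U) := by
  unfold coordC; simp only [br_eq]; fun_prop

@[fun_prop] theorem continuous_conic : Continuous (conic κ V P U) := by
  unfold conic; fun_prop

/-- `coordA` and `coordC` are affine and vanish at `V`, so they are homogeneous along rays from `V`,
which are the particle paths. -/
theorem coordA_ray (r : ℝ) : coordA V P U (V + r • Y) = r * coordA V P U (V + Y) := by
  simp only [coordA, br_eq, Prod.fst_add, Prod.snd_add, Prod.smul_fst, Prod.smul_snd, smul_eq_mul]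
  ring

theorem coordC_ray (r : ℝ) : coordC V P U (V + r • Y) = r * coordC V P U (V + Y) := by
  simp only [coordC, br_eq, Prod.fst_add, Prod.snd_add, Prod.smul_fst, Prod.smul_snd, smul_eq_mul]
  ring

theorem coordA_combo {a b : ℝ} (h : a + b = 1) :
    coordA V P U (a • X + b • Y) = a * coordA V P U X + b * coordA V P U Y := by
  obtain rfl : b = 1 - a := by linarith
  simp only [coordA, br_eq, Prod.fst_add, Prod.snd_add, Prod.smul_fst, Prod.smul_snd, smul_eq_mul]
  ring

theorem coordC_combo {a b : ℝ} (h : a + b = 1) :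
    coordC V P U (a • X + b • Y) = a * coordC V P U X + b * coordC V P U Y := by
  obtain rfl : b = 1 - a := by linarith
  simp only [coordC, br_eq, Prod.fst_add, Prod.snd_add, Prod.smul_fst, Prod.smul_snd, smul_eq_mul]
  ring

theorem eq_of_coords (h : br V U P ≠ 0) :
    X = V + (coordA V P U X • (P - V) + coordC V P U X • (U - V)) := by
  have e1 : coordA V P U X * br V U P = br V U X := div_mul_cancel₀ _ h
  have e2 : coordC V P U X * br V U P = br V X P := div_mul_cancel₀ _ h
  generalize coordA V P U X = a at *
  generalize coordC V P U X = c at *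
  simp only [br_eq] at *
  refine Prod.ext ?_ ?_ <;>
    simp only [Prod.fst_add, Prod.snd_add, Prod.smul_fst, Prod.smul_snd, Prod.fst_sub,
      Prod.snd_sub, smul_eq_mul]
  · refine mul_right_cancel₀ h ?_
    linear_combination (-(P.1 - V.1)) * e1 - (U.1 - V.1) * e2
  · refine mul_right_cancel₀ h ?_
    linear_combination (-(P.2 - V.2)) * e1 - (U.2 - V.2) * e2

theorem fst_eq_of_coords (h : br V U P ≠ 0) (X : ℝ × ℝ) : X.1 = V.1 +
    (coordA V P U X * (P.1 - V.1) + coordC V P U X * (U.1 - V.1)) := by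
  conv_lhs => rw [eq_of_coords (X := X) h]
  simp

theorem snd_eq_of_coords (h : br V U P ≠ 0) (X : ℝ × ℝ) : X.2 = V.2 +
    (coordA V P U X * (P.2 - V.2) + coordC V P U X * (U.2 - V.2)) := by
  conv_lhs => rw [eq_of_coords (X := X) h]
  simp

theorem ext_coords (h : br V U P ≠ 0) (hA : coordA V P U X = coordA V P U Y)
    (hC : coordC V P U X = coordC V P U Y) : X = Y := by
  rw [eq_of_coords (X := X) h, eq_of_coords (X := Y) h, hA, hC]

theorem coordA_combination (h : br V U P ≠ 0) (a c : ℝ) :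
    coordA V P U (V + (a • (P - V) + c • (U - V))) = a := by
  rw [coordA, div_eq_iff h]
  simp only [br_eq, Prod.fst_add, Prod.snd_add, Prod.smul_fst, Prod.smul_snd, Prod.fst_sub,
    Prod.snd_sub, smul_eq_mul]
  ring

theorem coordC_combination (h : br V U P ≠ 0) (a c : ℝ) :
    coordC V P U (V + (a • (P - V) + c • (U - V))) = c := by
  rw [coordC, div_eq_iff h]
  simp only [br_eq, Prod.fst_add, Prod.snd_add, Prod.smul_fst, Prod.smul_snd, Prod.fst_sub,
    Prod.snd_sub, smul_eq_mul]
  ring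

theorem conic_ray (r : ℝ) : conic κ V P U (V + r • Y) =
    r * (r * (coordC V P U (V + Y) ^ 2 + 2 * κ * coordA V P U (V + Y) *
      (coordA V P U (V + Y) + coordC V P U (V + Y))) - 2 * κ * coordA V P U (V + Y)) := by
  rw [conic, coordA_ray, coordC_ray]; ring

/-- The conic passes through `V`, so on a ray from `V` its function is `r` times an affine function
of `r`. The only further zero is at `X` itself, and there the sign changes. -/
theorem conic_ray_pos_iff (hκ : 0 < κ) (hA : 0 < coordA V P U X) (h0 : conic κ V P U X = 0)
    {r : ℝ} (hr : 0 < r) : 0 < conic κ V P U (V + r • (X - V)) ↔ 1 < r := by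
  rw [conic_ray, add_sub_cancel]
  rw [conic] at h0
  have e : r * (r * (coordC V P U X ^ 2 + 2 * κ * coordA V P U X *
      (coordA V P U X + coordC V P U X)) - 2 * κ * coordA V P U X) =
      (r - 1) * (r * (2 * κ * coordA V P U X)) := by
    linear_combination (r * r) * h0
  rw [e]
  have hp : 0 < r * (2 * κ * coordA V P U X) := by positivity
  rw [mul_pos_iff_of_pos_right hp, sub_pos]

theorem exists_conic_ray (hκ : 0 < κ) (hA : 0 < coordA V P U (V + Y))
    (hC : 0 < coordC V P U (V + Y)) : ∃ r : ℝ, 0 < r ∧ conic κ V P U (V + r • Y) = 0 := by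
  have h1 : 0 < coordC V P U (V + Y) ^ 2 + 2 * κ * coordA V P U (V + Y) *
      (coordA V P U (V + Y) + coordC V P U (V + Y)) := by positivity
  refine ⟨2 * κ * coordA V P U (V + Y) / (coordC V P U (V + Y) ^ 2 + 2 * κ * coordA V P U (V + Y) *
      (coordA V P U (V + Y) + coordC V P U (V + Y))), by positivity, ?_⟩
  rw [conic_ray, div_mul_cancel₀ _ h1.ne', sub_self, mul_zero]

theorem conic_pos_of_nonpos (hκ : 0 < κ) (hC : 0 < coordC V P U X) (hA : coordA V P U X ≤ 0)
    (hB : 0 ≤ 1 - coordA V P U X - coordC V P U X) : 0 < conic κ V P U X := by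
  rw [conic]
  have : 2 * κ * coordA V P U X * (1 - coordA V P U X - coordC V P U X) ≤ 0 :=
    mul_nonpos_of_nonpos_of_nonneg (mul_nonpos_of_nonneg_of_nonpos (by positivity) hA) hB
  have := pow_pos hC 2
  linarith

/-- A region bounded by two lines and a conic that touches them is convex, in coordinates. -/
theorem conic_inner_combo {κ α₁ β₁ γ₁ α₂ β₂ γ₂ a b : ℝ} (hκ : 0 < κ) (hα₁ : 0 < α₁) (hβ₁ : 0 < β₁)
    (hα₂ : 0 < α₂) (hβ₂ : 0 < β₂) (h₁ : γ₁ ≤ 0 ∨ γ₁ ^ 2 < 2 * κ * α₁ * β₁)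
    (h₂ : γ₂ ≤ 0 ∨ γ₂ ^ 2 < 2 * κ * α₂ * β₂) (ha : 0 ≤ a) (hb : 0 ≤ b) (hab : a + b = 1) :
    a * γ₁ + b * γ₂ ≤ 0 ∨
      (a * γ₁ + b * γ₂) ^ 2 < 2 * κ * (a * α₁ + b * α₂) * (a * β₁ + b * β₂) := by
  rcases le_or_gt (a * γ₁ + b * γ₂) 0 with h | h
  · exact Or.inl h
  right
  have hp1 : 0 < 2 * κ * α₁ * β₁ := by positivity
  have hp2 : 0 < 2 * κ * α₂ * β₂ := by positivity
  -- A nonpositive `γ` only helps, so both are replaced by their positive parts, which satisfy the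
  -- quadratic inequality in either case.
  have k1 : max γ₁ 0 ^ 2 < 2 * κ * α₁ * β₁ := by
    rcases h₁ with h₁ | h₁
    · rw [max_eq_right h₁]; simpa using hp1
    · rcases le_total γ₁ 0 with h' | h'
      · rw [max_eq_right h']; simpa using hp1
      · rwa [max_eq_left h']
  have k2 : max γ₂ 0 ^ 2 < 2 * κ * α₂ * β₂ := by
    rcases h₂ with h₂ | h₂
    · rw [max_eq_right h₂]; simpa using hp2
    · rcases le_total γ₂ 0 with h' | h'
      · rw [max_eq_right h']; simpa using hp2
      · rwa [max_eq_left h']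
  have n1 : 0 ≤ max γ₁ 0 := le_max_right _ _
  have n2 : 0 ≤ max γ₂ 0 := le_max_right _ _
  have l1 : γ₁ ≤ max γ₁ 0 := le_max_left _ _
  have l2 : γ₂ ≤ max γ₂ 0 := le_max_left _ _
  generalize max γ₁ 0 = g₁ at *
  generalize max γ₂ 0 = g₂ at *
  have hle : (a * γ₁ + b * γ₂) ^ 2 ≤ (a * g₁ + b * g₂) ^ 2 := by
    refine pow_le_pow_left₀ h.le ?_ 2
    gcongr
  refine hle.trans_lt ?_
  -- The mixed term, by the arithmetic-geometric mean inequality for `α₁ β₂` and `α₂ β₁`.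
  have hprod : g₁ * g₂ ≤ κ * (α₁ * β₂ + α₂ * β₁) := by
    have hq : (g₁ * g₂) ^ 2 ≤ (κ * (α₁ * β₂ + α₂ * β₁)) ^ 2 := by
      calc (g₁ * g₂) ^ 2 = g₁ ^ 2 * g₂ ^ 2 := by ring
        _ ≤ (2 * κ * α₁ * β₁) * (2 * κ * α₂ * β₂) :=
            mul_le_mul k1.le k2.le (sq_nonneg _) hp1.le
        _ ≤ (κ * (α₁ * β₂ + α₂ * β₁)) ^ 2 := by
            have := mul_nonneg (sq_nonneg κ) (sq_nonneg (α₁ * β₂ - α₂ * β₁))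
            linarith
    exact le_of_sq_le_sq hq (by positivity)
  have hab' : 0 < a ∨ 0 < b := by
    by_contra hcon
    rw [not_or, not_lt, not_lt] at hcon
    linarith
  have m3 : a * b * (g₁ * g₂) ≤ a * b * (κ * (α₁ * β₂ + α₂ * β₁)) :=
    mul_le_mul_of_nonneg_left hprod (by positivity)
  rcases hab' with h' | h'
  · have m1 : a ^ 2 * g₁ ^ 2 < a ^ 2 * (2 * κ * α₁ * β₁) := mul_lt_mul_of_pos_left k1
      (by positivity)
    have m2 : b ^ 2 * g₂ ^ 2 ≤ b ^ 2 * (2 * κ * α₂ * β₂) :=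
      mul_le_mul_of_nonneg_left k2.le (by positivity)
    linarith
  · have m1 : a ^ 2 * g₁ ^ 2 ≤ a ^ 2 * (2 * κ * α₁ * β₁) :=
      mul_le_mul_of_nonneg_left k1.le (by positivity)
    have m2 : b ^ 2 * g₂ ^ 2 < b ^ 2 * (2 * κ * α₂ * β₂) := mul_lt_mul_of_pos_left k2
      (by positivity)
    linarith

/-- The convex region enclosed by the conic and by the sides of the triangle through `V`. -/
def conicRegion (κ : ℝ) (V P U : ℝ × ℝ) : Set (ℝ × ℝ) :=
  {X | 0 < coordA V P U X ∧ 0 < 1 - coordA V P U X - coordC V P U X ∧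
    (coordC V P U X ≤ 0 ∨ conic κ V P U X < 0)}

theorem convex_conicRegion (hκ : 0 < κ) : Convex ℝ (conicRegion κ V P U) := by
  rintro X ⟨hX1, hX2, hX3⟩ Y ⟨hY1, hY2, hY3⟩ a b ha hb hab
  have h := conic_inner_combo hκ hX1 hX2 hY1 hY2
    (hX3.imp_right fun h => by rw [conic] at h; linarith)
    (hY3.imp_right fun h => by rw [conic] at h; linarith) ha hb hab
  have hpos : 0 < a ∨ 0 < b := by
    by_contra hcon
    rw [not_or, not_lt, not_lt] at hcon
    linarith
  have hcombo : ∀ x y : ℝ, 0 < x → 0 < y → 0 < a * x + b * y := fun x y hx hy => by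
    rcases hpos with h' | h'
    · have := mul_pos h' hx
      have := mul_nonneg hb hy.le
      linarith
    · have := mul_pos h' hy
      have := mul_nonneg ha hx.le
      linarith
  have e : 1 - (a * coordA V P U X + b * coordA V P U Y) -
      (a * coordC V P U X + b * coordC V P U Y) =
      a * (1 - coordA V P U X - coordC V P U X) + b * (1 - coordA V P U Y - coordC V P U Y) := by
    linear_combination -hab
  refine ⟨?_, ?_, ?_⟩
  · rw [coordA_combo hab]; exact hcombo _ _ hX1 hY1
  · rw [coordA_combo hab, coordC_combo hab, e]; exact hcombo _ _ hX2 hY2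
  · rw [conic, coordA_combo hab, coordC_combo hab, e]
    exact h.imp_right fun h => by linarith

theorem convex_halfPlane_coordC : Convex ℝ {X | coordC V P U X ≤ 0} ∧
    Convex ℝ {X | 0 ≤ coordC V P U X} := by
  constructor <;> intro X hX Y hY a b ha hb hab <;>
    simp only [mem_ofPred_eq, coordC_combo hab] at *
  · exact add_nonpos (mul_nonpos_of_nonneg_of_nonpos ha hX) (mul_nonpos_of_nonneg_of_nonpos hb hY)
  · positivity

end

section
variable {R : State} {P U₀ : ℝ × ℝ} {m₀ n₀ : ℝ} {s : ℝ}

theorem coordA_vacuumShock (hb : br R.vel U₀ P < 0) :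
    coordA R.vel P U₀ ((vacuumShock R P U₀ m₀ n₀).Ξ s) = Real.exp s := by
  simp only [vacuumShock]
  rw [smul_add, smul_smul, coordA_combination hb.ne]

theorem coordC_vacuumShock (hb : br R.vel U₀ P < 0) :
    coordC R.vel P U₀ ((vacuumShock R P U₀ m₀ n₀).Ξ s) =
      Real.exp s * (shockShape R P U₀ m₀ * (shockRatio (shockShape R P U₀ m₀) s - 1)) := by
  simp only [vacuumShock]
  rw [smul_add, smul_smul, coordC_combination hb.ne]

theorem coordB_vacuumShock (hρ : 0 < R.ρ) (hm : 0 < m₀) (hb : br R.vel U₀ P < 0) (hs : s ≤ 0) :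
    1 - coordA R.vel P U₀ ((vacuumShock R P U₀ m₀ n₀).Ξ s) -
      coordC R.vel P U₀ ((vacuumShock R P U₀ m₀ n₀).Ξ s) =
      Real.exp s * (shockShape R P U₀ m₀ * (shockRatio (shockShape R P U₀ m₀) s - 1) ^ 2 / 2) := by
  rw [coordA_vacuumShock hb, coordC_vacuumShock hb]
  linear_combination -(exp_mul_shockRatio (shockShape_pos hρ hm hb) hs)

/-- The coordinates are `exp s` times `1`, `κ (r - 1)` and `κ (r - 1) ^ 2 / 2`, hence `γ ^ 2 = 2 κ α
β`. -/
theorem conic_vacuumShock (hρ : 0 < R.ρ) (hm : 0 < m₀) (hb : br R.vel U₀ P < 0) (hs : s ≤ 0) :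
    conic (shockShape R P U₀ m₀) R.vel P U₀ ((vacuumShock R P U₀ m₀ n₀).Ξ s) = 0 := by
  rw [conic, coordB_vacuumShock hρ hm hb hs, coordA_vacuumShock hb, coordC_vacuumShock hb]
  ring

theorem coordC_vacuumShock_pos (hρ : 0 < R.ρ) (hm : 0 < m₀) (hb : br R.vel U₀ P < 0) (hs : s < 0) :
    0 < coordC R.vel P U₀ ((vacuumShock R P U₀ m₀ n₀).Ξ s) := by
  have hκ := shockShape_pos hρ hm hb
  have := sub_pos.2 (one_lt_shockRatio hκ hs)
  rw [coordC_vacuumShock hb]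
  positivity

theorem coordA_vacuumShock_pos (hb : br R.vel U₀ P < 0) :
    0 < coordA R.vel P U₀ ((vacuumShock R P U₀ m₀ n₀).Ξ s) := by
  rw [coordA_vacuumShock hb]; positivity

/-- The coordinate `α` determines the parameter as its logarithm. The equation of the conic forces
`β ≥ 0`, hence `α ≤ 1`, and then fixes `γ`, whose sign selects the branch of the square root. -/
theorem exists_vacuumShock_of_conic (hρ : 0 < R.ρ) (hm : 0 < m₀) (hb : br R.vel U₀ P < 0)
    {X : ℝ × ℝ} (hA : 0 < coordA R.vel P U₀ X) (hC : 0 ≤ coordC R.vel P U₀ X)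
    (h0 : conic (shockShape R P U₀ m₀) R.vel P U₀ X = 0) :
    ∃ s ≤ 0, (vacuumShock R P U₀ m₀ n₀).Ξ s = X := by
  have hκ := shockShape_pos hρ hm hb
  set κ := shockShape R P U₀ m₀ with hκd
  set α := coordA R.vel P U₀ X with hα
  set γ := coordC R.vel P U₀ X with hγ
  have h0' : γ ^ 2 = 2 * κ * α * (1 - α - γ) := by rw [conic] at h0; linarith
  have hB : 0 ≤ 1 - α - γ := by
    by_contra hneg
    have h1 : 2 * κ * α * (1 - α - γ) < 0 := mul_neg_of_pos_of_neg (by positivity) (not_le.1 hneg)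
    have h2 := sq_nonneg γ
    linarith
  have hα1 : α ≤ 1 := by linarith
  have hs : Real.log α ≤ 0 := Real.log_nonpos hA.le hα1
  have hr : shockRatio κ (Real.log α) = 1 + γ / α / κ := by
    have h1 := shockRatio_sq hκ hs
    rw [Real.exp_neg, Real.exp_log hA] at h1
    have h2 := one_le_shockRatio hκ hs
    have h3 : 0 ≤ 1 + γ / α / κ := by positivity
    have h4 : (1 + γ / α / κ) ^ 2 = 1 + 2 / κ * (α⁻¹ - 1) := by
      field_simp
      linear_combination h0'
    rw [← h4] at h1
    exact (pow_left_inj₀ (by linarith) h3 two_ne_zero).1 h1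
  refine ⟨Real.log α, hs, ext_coords hb.ne ?_ ?_⟩
  · rw [coordA_vacuumShock hb, Real.exp_log hA]
  · rw [coordC_vacuumShock hb, Real.exp_log hA, ← hκd, hr]
    field_simp
    ring_nf
    rfl

theorem vacuumShock_Ξ_injective (hb : br R.vel U₀ P < 0) :
    Function.Injective (vacuumShock R P U₀ m₀ n₀).Ξ := fun s t h => by
  have := congrArg (coordA R.vel P U₀) h
  rw [coordA_vacuumShock hb, coordA_vacuumShock hb] at this
  exact Real.exp_injective this

theorem image_vacuumShock (hρ : 0 < R.ρ) (hm : 0 < m₀) (hb : br R.vel U₀ P < 0) :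
    (vacuumShock R P U₀ m₀ n₀).Ξ '' Iic 0 = {X | 0 < coordA R.vel P U₀ X ∧
      0 ≤ coordC R.vel P U₀ X ∧ conic (shockShape R P U₀ m₀) R.vel P U₀ X = 0} := by
  ext X
  constructor
  · rintro ⟨s, hs, rfl⟩
    refine ⟨coordA_vacuumShock_pos hb, ?_, conic_vacuumShock hρ hm hb hs⟩
    rcases eq_or_lt_of_le (mem_Iic.1 hs) with h | h
    · rw [h, coordC_vacuumShock hb, shockRatio_zero]; simp
    · exact (coordC_vacuumShock_pos hρ hm hb h).le
  · rintro ⟨h1, h2, h3⟩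
    obtain ⟨s, hs, rfl⟩ := exists_vacuumShock_of_conic (n₀ := n₀) hρ hm hb h1 h2 h3
    exact ⟨s, hs, rfl⟩

/-- The conic function changes sign across the shock: it is negative to the left. -/
theorem vacuumShock_separates (hρ : 0 < R.ρ) (hm : 0 < m₀) (hb : br R.vel U₀ P < 0) (hs : s ≤ 0) :
    ∀ᶠ ε in 𝓝[>] (0 : ℝ),
      conic (shockShape R P U₀ m₀) R.vel P U₀ ((vacuumShock R P U₀ m₀ n₀).Ξ s + ε •
        rot ((vacuumShock R P U₀ m₀ n₀).U s - (vacuumShock R P U₀ m₀ n₀).Ξ s)) < 0 ∧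
      0 < conic (shockShape R P U₀ m₀) R.vel P U₀ ((vacuumShock R P U₀ m₀ n₀).Ξ s - ε •
        rot ((vacuumShock R P U₀ m₀ n₀).U s - (vacuumShock R P U₀ m₀ n₀).Ξ s)) := by
  have hκ := shockShape_pos hρ hm hb
  have hneg := br_vacuumShock_neg (n₀ := n₀) hρ hm hb hs
  have h0 := conic_vacuumShock (n₀ := n₀) hρ hm hb hs
  have hA := coordA_vacuumShock (m₀ := m₀) (n₀ := n₀) (s := s) hb
  have hC := coordC_vacuumShock (m₀ := m₀) (n₀ := n₀) (s := s) hb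
  have hexp := exp_mul_shockRatio hκ hs
  have hr := one_le_shockRatio hκ hs
  have he := Real.exp_pos s
  set κ := shockShape R P U₀ m₀ with hκd
  set r := shockRatio κ s
  set e := Real.exp s
  have hAU : coordA R.vel P U₀ ((vacuumShock R P U₀ m₀ n₀).U s) = 0 := by
    have := coordA_combination hb.ne 0 r⁻¹
    rwa [zero_smul, zero_add] at this
  have hCU : coordC R.vel P U₀ ((vacuumShock R P U₀ m₀ n₀).U s) = r⁻¹ := by
    have := coordC_combination hb.ne 0 r⁻¹
    rwa [zero_smul, zero_add] at this
  generalize hX : (vacuumShock R P U₀ m₀ n₀).Ξ s = X at *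
  generalize (vacuumShock R P U₀ m₀ n₀).U s = U at *
  set V := R.vel
  set b := br V U₀ P with hbd
  set α := coordA V P U₀ X with hαd
  set γ := coordC V P U₀ X with hγd
  -- `(p, q)` is the gradient of the conic function at `X`.
  set p := (-(U₀.2 - V.2) / b) * (2 * κ * (α - (1 - α - γ))) + (P.2 - V.2) / b * (2 * γ + 2 * κ * α)
    with hp
  set q := ((U₀.1 - V.1) / b) * (2 * κ * (α - (1 - α - γ))) - (P.1 - V.1) / b * (2 * γ + 2 * κ * α)
    with hq
  have lA : ∀ w : ℝ × ℝ, ∀ t : ℝ, coordA V P U₀ (X + t • w) =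
      α + t * (-(U₀.2 - V.2) / b * w.1 + (U₀.1 - V.1) / b * w.2) := by
    intro w t
    simp only [hαd, coordA, ← hbd, br_eq, Prod.fst_add, Prod.snd_add, Prod.smul_fst, Prod.smul_snd,
      smul_eq_mul]
    ring
  have lC : ∀ w : ℝ × ℝ, ∀ t : ℝ, coordC V P U₀ (X + t • w) =
      γ + t * ((P.2 - V.2) / b * w.1 - (P.1 - V.1) / b * w.2) := by
    intro w t
    simp only [hγd, coordC, ← hbd, br_eq, Prod.fst_add, Prod.snd_add, Prod.smul_fst, Prod.smul_snd,
      smul_eq_mul]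
    ring
  -- `X` is on the conic, so along any line through `X` the conic function has no constant term.
  have hD : ∀ w : ℝ × ℝ, ∃ E : ℝ, ∀ t : ℝ, conic κ V P U₀ (X + t • w) =
      t * (p * w.1 + q * w.2 + t * E) := by
    intro w
    refine ⟨((P.2 - V.2) / b * w.1 - (P.1 - V.1) / b * w.2) ^ 2 + 2 * κ *
      (-(U₀.2 - V.2) / b * w.1 + (U₀.1 - V.1) / b * w.2) *
      ((-(U₀.2 - V.2) / b * w.1 + (U₀.1 - V.1) / b * w.2) +
        ((P.2 - V.2) / b * w.1 - (P.1 - V.1) / b * w.2)), fun t => ?_⟩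
    rw [conic, lA, lC, hp, hq]
    rw [conic, ← hαd, ← hγd] at h0
    linear_combination h0
  -- The velocity direction `U - X` is tangent to the conic.
  have hz : p * (U - X).1 + q * (U - X).2 = 0 := by
    have a1 := lA (U - X) 1
    have c1 := lC (U - X) 1
    rw [one_smul, add_sub_cancel, hAU, one_mul] at a1
    rw [one_smul, add_sub_cancel, hCU, one_mul] at c1
    have h1 : p * (U - X).1 + q * (U - X).2 = (0 - α) * (2 * κ * (α - (1 - α - γ))) +
      (r⁻¹ - γ) * (2 * γ + 2 * κ * α) := by
      rw [hp, hq]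
      linear_combination (-(2 * κ * (α - (1 - α - γ)))) * a1 - (2 * γ + 2 * κ * α) * c1
    rw [h1, hA, hC]
    have hr0 : r ≠ 0 := by linarith
    field_simp
    linear_combination (-4 * κ * e * r) * hexp
  -- The conic also passes through `V`; this gives the sign of the gradient in the direction of `V`.
  have hy : p * (V - X).1 + q * (V - X).2 = -(2 * κ * e) := by
    have a1 := lA (V - X) 1
    have c1 := lC (V - X) 1
    have a0 : coordA V P U₀ V = 0 := by simp [coordA, br_eq]
    have c0 : coordC V P U₀ V = 0 := by simp [coordC, br_eq]
    rw [one_smul, add_sub_cancel, a0, one_mul] at a1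
    rw [one_smul, add_sub_cancel, c0, one_mul] at c1
    rw [conic, ← hαd, ← hγd] at h0
    rw [← hA, hp, hq]
    linear_combination (-(2 * κ * (α - (1 - α - γ)))) * a1 - (2 * γ + 2 * κ * α) * c1 - 2 * h0
  -- Decompose `V - X` along `U - X` and `rot (U - X)`. The first component does not see the
  -- gradient, and the second one is `-br V U X` up to the squared length of `U - X`.
  have hw : (p * (rot (U - X)).1 + q * (rot (U - X)).2) * -br V U X =
      -(2 * κ * e) * ((U - X).1 ^ 2 + (U - X).2 ^ 2) := by
    simp only [rot, br_eq, Prod.fst_sub, Prod.snd_sub] at *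
    linear_combination ((U.1 - X.1) ^ 2 + (U.2 - X.2) ^ 2) * hy -
      ((U.1 - X.1) * (V.1 - X.1) + (U.2 - X.2) * (V.2 - X.2)) * hz
  have hpos : 0 < (U - X).1 ^ 2 + (U - X).2 ^ 2 := by
    have hne : U - X ≠ 0 := fun h => by
      rw [sub_eq_zero.1 h, br_eq] at hneg
      linarith
    by_cases h1 : (U - X).1 = 0
    · have h2 : (U - X).2 ≠ 0 := fun h2 => hne (Prod.ext h1 h2)
      rw [h1]
      positivity
    · positivity
  have hDneg : p * (rot (U - X)).1 + q * (rot (U - X)).2 < 0 := by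
    have h1 : (p * (rot (U - X)).1 + q * (rot (U - X)).2) * -br V U X < 0 := by
      rw [hw]
      exact mul_neg_of_neg_of_pos (neg_lt_zero.2 (by positivity)) hpos
    exact neg_of_mul_neg_left h1 (by linarith)
  obtain ⟨E, hE⟩ := hD (rot (U - X))
  generalize p * (rot (U - X)).1 + q * (rot (U - X)).2 = D at *
  have hlim : ∀ c : ℝ, ∀ᶠ ε in 𝓝[>] (0 : ℝ), D + ε * c < 0 := by
    intro c
    have h1 : Tendsto (fun ε : ℝ => D + ε * c) (𝓝 0) (𝓝 (D + 0 * c)) :=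
      (tendsto_id.mul_const c).const_add D
    rw [zero_mul, add_zero] at h1
    exact (h1.eventually_lt_const hDneg).filter_mono nhdsWithin_le_nhds
  filter_upwards [hlim E, hlim (-E), self_mem_nhdsWithin] with ε h1 h2 hε
  have hε' : 0 < ε := hε
  refine ⟨by rw [hE]; exact mul_neg_of_pos_of_neg hε' h1, ?_⟩
  rw [sub_eq_add_neg, ← neg_smul, hE]
  have : -ε * (D + -ε * E) = ε * -(D + ε * -E) := by ring
  rw [this]
  exact mul_pos hε' (by linarith)

end

/-! ### Geometry of the shock that rises from `A` -/

/-- The position of the points `A` (start of the shock), `U` (its initial velocity) and `V` (the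
singular point at which it ends) when the shock starts horizontally and rises. -/
structure LowerConfig (κ : ℝ) (V A U : ℝ × ℝ) : Prop where
  pos : 0 < κ
  snd_eq : U.2 = A.2
  fst_lt : A.1 < U.1
  fst_lt' : A.1 < V.1
  fst_lt'' : U.1 < V.1
  snd_lt : A.2 < V.2

/-- The points above and to the left of the shock and below its singular point. -/
def lowerInner (κ : ℝ) (V A U : ℝ × ℝ) : Set (ℝ × ℝ) :=
  {X | A.2 < X.2 ∧ X.2 < V.2 ∧ (coordC V A U X < 0 ∨ conic κ V A U X < 0)}

/-- The points below and to the right of the shock. -/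
def lowerOuter (κ : ℝ) (V A U : ℝ × ℝ) : Set (ℝ × ℝ) :=
  {X | X.2 < A.2 ∨ (0 < coordC V A U X ∧ 0 < conic κ V A U X)}

theorem isOpen_lowerInner {κ : ℝ} {V A U : ℝ × ℝ} : IsOpen (lowerInner κ V A U) := by
  refine (isOpen_lt continuous_const continuous_snd).inter
    ((isOpen_lt continuous_snd continuous_const).inter ?_)
  exact (isOpen_lt continuous_coordC continuous_const).union
    (isOpen_lt continuous_conic continuous_const)

theorem isOpen_lowerOuter {κ : ℝ} {V A U : ℝ × ℝ} : IsOpen (lowerOuter κ V A U) :=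
  (isOpen_lt continuous_snd continuous_const).union
    ((isOpen_lt continuous_const continuous_coordC).inter
      (isOpen_lt continuous_const continuous_conic))

theorem notMem_outer_of_inner {κ : ℝ} {V A U X : ℝ × ℝ} (hX : X ∈ lowerInner κ V A U) : X ∉
    lowerOuter κ V A U := by
  rintro (h1 | ⟨h1, h2⟩)
  · linarith [hX.1]
  · rcases hX.2.2 with h3 | h3 <;> linarith

theorem notMem_outer_of_coordC_nonpos {κ : ℝ} {V A U X : ℝ × ℝ} (h1 : A.2 ≤ X.2)
    (h2 : coordC V A U X ≤ 0) :
    X ∉ lowerOuter κ V A U := by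
  rintro (h3 | ⟨h3, _⟩) <;> linarith

namespace LowerConfig
variable {κ : ℝ} {V A U X Y : ℝ × ℝ} (h : LowerConfig κ V A U)
include h

theorem br_neg : br V U A < 0 := by
  have e : br V U A = -((V.2 - A.2) * (U.1 - A.1)) := by
    rw [br_eq, h.snd_eq]; ring
  have := mul_pos (sub_pos.2 h.snd_lt) (sub_pos.2 h.fst_lt)
  linarith

/-- As `A` and `U` are at the same height, the third barycentric coordinate is the normalized height
above them. -/
theorem coordB (X : ℝ × ℝ) :
    1 - coordA V A U X - coordC V A U X = (X.2 - A.2) / (V.2 - A.2) := by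
  have e := snd_eq_of_coords h.br_neg.ne X
  have h1 : V.2 - A.2 ≠ 0 := (sub_pos.2 h.snd_lt).ne'
  rw [eq_div_iff h1, e, h.snd_eq]
  ring

theorem coordC_mul (X : ℝ × ℝ) : coordC V A U X * ((U.1 - A.1) * (V.2 - A.2)) =
    (X.1 - A.1) * (V.2 - A.2) - (X.2 - A.2) * (V.1 - A.1) := by
  have h1 : V.2 - A.2 ≠ 0 := (sub_pos.2 h.snd_lt).ne'
  have h2 : U.1 - A.1 ≠ 0 := (sub_pos.2 h.fst_lt).ne'
  have e : br V U A = -((V.2 - A.2) * (U.1 - A.1)) := by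
    rw [br_eq, h.snd_eq]; ring
  rw [coordC, e, br_eq]
  field_simp
  ring

theorem scale_pos : 0 < (U.1 - A.1) * (V.2 - A.2) :=
  mul_pos (sub_pos.2 h.fst_lt) (sub_pos.2 h.snd_lt)

theorem coordC_neg_iff : coordC V A U X < 0 ↔
    (X.1 - A.1) * (V.2 - A.2) < (X.2 - A.2) * (V.1 - A.1) := by
  have := h.coordC_mul X
  have hs := h.scale_pos
  rw [← sub_neg (b := (X.2 - A.2) * (V.1 - A.1)), ← this]
  exact ⟨fun h1 => mul_neg_of_neg_of_pos h1 hs, fun h1 => by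
    by_contra h2; linarith [mul_nonneg (not_lt.1 h2) hs.le]⟩

theorem coordC_neg_of_fst_le (h1 : X.1 ≤ A.1) (h2 : A.2 < X.2) : coordC V A U X < 0 := by
  rw [h.coordC_neg_iff]
  have a1 := mul_nonneg (sub_nonneg.2 h1) (sub_pos.2 h.snd_lt).le
  have a2 := mul_pos (sub_pos.2 h2) (sub_pos.2 h.fst_lt')
  linarith

theorem coordC_neg_of_fst_lt (h1 : X.1 < A.1) (h2 : A.2 ≤ X.2) : coordC V A U X < 0 := by
  rw [h.coordC_neg_iff]
  have a1 := mul_pos (sub_pos.2 h1) (sub_pos.2 h.snd_lt)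
  have a2 := mul_nonneg (sub_nonneg.2 h2) (sub_pos.2 h.fst_lt').le
  linarith

theorem coordC_sub (hXY : X.2 = Y.2) :
    coordC V A U Y = coordC V A U X + (Y.1 - X.1) / (U.1 - A.1) := by
  have h1 := h.coordC_mul X
  have h2 := h.coordC_mul Y
  have a1 : V.2 - A.2 ≠ 0 := (sub_pos.2 h.snd_lt).ne'
  have a2 : U.1 - A.1 ≠ 0 := (sub_pos.2 h.fst_lt).ne'
  have : (coordC V A U Y - coordC V A U X) * (U.1 - A.1) = Y.1 - X.1 := by
    refine mul_right_cancel₀ a1 ?_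
    rw [hXY] at h1
    linear_combination h2 - h1
  rw [← this]
  field_simp
  ring

theorem coordC_le (hXY : X.2 = Y.2) (hle : X.1 ≤ Y.1) : coordC V A U X ≤ coordC V A U Y := by
  rw [h.coordC_sub hXY]
  have := div_nonneg (sub_nonneg.2 hle) (sub_pos.2 h.fst_lt).le
  linarith

theorem coordC_lt (hXY : X.2 = Y.2) (hlt : X.1 < Y.1) : coordC V A U X < coordC V A U Y := by
  rw [h.coordC_sub hXY]
  have := div_pos (sub_pos.2 hlt) (sub_pos.2 h.fst_lt)
  linarith

theorem conic_eq (X : ℝ × ℝ) : conic κ V A U X = coordC V A U X ^ 2 -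
    2 * κ * (1 - (X.2 - A.2) / (V.2 - A.2) - coordC V A U X) * ((X.2 - A.2) / (V.2 - A.2)) := by
  have e := h.coordB X
  rw [conic, ← e]; ring

theorem coordB_nonneg (hX : A.2 ≤ X.2) : 0 ≤ (X.2 - A.2) / (V.2 - A.2) :=
  div_nonneg (sub_nonneg.2 hX) (sub_pos.2 h.snd_lt).le

theorem coordB_pos (hX : A.2 < X.2) : 0 < (X.2 - A.2) / (V.2 - A.2) :=
  div_pos (sub_pos.2 hX) (sub_pos.2 h.snd_lt)

theorem coordB_lt_one (hX : X.2 < V.2) : (X.2 - A.2) / (V.2 - A.2) < 1 := by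
  rw [div_lt_one (sub_pos.2 h.snd_lt)]; linarith

/-- On a horizontal line `β` is constant and the conic function is a quadratic polynomial in `γ`,
increasing for `γ ≥ 0`, while `γ` increases to the right. This is why the shock is a graph over the
height, with the vacuum to its left. -/
theorem conic_sub (hXY : X.2 = Y.2) : conic κ V A U Y - conic κ V A U X =
    (coordC V A U Y - coordC V A U X) * (coordC V A U Y + coordC V A U X +
      2 * κ * ((X.2 - A.2) / (V.2 - A.2))) := by
  rw [h.conic_eq, h.conic_eq, hXY]; ring

theorem conic_le (hXY : X.2 = Y.2) (hX : A.2 ≤ X.2) (hC : 0 ≤ coordC V A U X) (hle : X.1 ≤ Y.1) :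
    conic κ V A U X ≤ conic κ V A U Y := by
  have h1 := h.conic_sub hXY
  have h2 := h.coordC_le hXY hle
  have h3 := h.coordB_nonneg hX
  have h4 := h.pos
  have : 0 ≤ (coordC V A U Y - coordC V A U X) * (coordC V A U Y + coordC V A U X +
      2 * κ * ((X.2 - A.2) / (V.2 - A.2))) := by
    refine mul_nonneg (by linarith) (add_nonneg (by linarith) (by positivity))
  linarith

theorem conic_lt (hXY : X.2 = Y.2) (hX : A.2 ≤ X.2) (hC : 0 ≤ coordC V A U X) (hlt : X.1 < Y.1) :
    conic κ V A U X < conic κ V A U Y := by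
  have h1 := h.conic_sub hXY
  have h2 := h.coordC_lt hXY hlt
  have h3 := h.coordB_nonneg hX
  have h4 := h.pos
  have : 0 < (coordC V A U Y - coordC V A U X) * (coordC V A U Y + coordC V A U X +
      2 * κ * ((X.2 - A.2) / (V.2 - A.2))) := by
    refine mul_pos (by linarith) (add_pos_of_pos_of_nonneg (by linarith) (by positivity))
  linarith

theorem conic_neg_of_coordC_eq_zero (h1 : A.2 < X.2) (h2 : X.2 < V.2) (h0 : coordC V A U X = 0) :
    conic κ V A U X < 0 := by
  rw [h.conic_eq, h0]
  have b1 := h.coordB_pos h1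
  have b2 := sub_pos.2 (h.coordB_lt_one h2)
  have hκ := h.pos
  generalize (X.2 - A.2) / (V.2 - A.2) = b at *
  have : 0 < 2 * κ * (1 - b) * b := by positivity
  linarith

theorem inner_of_le (hX : X ∈ lowerInner κ V A U) (hXY : Y.2 = X.2) (hle : Y.1 ≤ X.1) :
    Y ∈ lowerInner κ V A U := by
  refine ⟨hXY ▸ hX.1, hXY ▸ hX.2.1, ?_⟩
  rcases lt_or_ge (coordC V A U Y) 0 with hC | hC
  · exact Or.inl hC
  · right
    have h1 := h.coordC_le hXY hle
    exact (h.conic_le hXY (by rw [hXY]; exact hX.1.le) hC hle).trans_lt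
      (hX.2.2.resolve_left (not_lt.2 (hC.trans h1)))

theorem coordA_pos_of_inner (hX : X ∈ lowerInner κ V A U) : 0 < coordA V A U X := by
  have e := h.coordB X
  have b1 := h.coordB_pos hX.1
  have b2 := h.coordB_lt_one hX.2.1
  rw [← e] at b1 b2
  rcases lt_or_ge 0 (coordC V A U X) with hC | hC
  · by_contra hA
    have h1 := conic_pos_of_nonpos h.pos hC (not_lt.1 hA) b1.le
    rcases hX.2.2 with h2 | h2 <;> linarith
  · linarith

theorem inner_eq : lowerInner κ V A U = conicRegion κ V A U ∩ {X | X.2 < V.2} := by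
  ext X
  constructor
  · intro hX
    refine ⟨⟨h.coordA_pos_of_inner hX, ?_, hX.2.2.imp_left le_of_lt⟩, hX.2.1⟩
    rw [h.coordB]; exact h.coordB_pos hX.1
  · rintro ⟨⟨hA, hB, hC⟩, hV⟩
    have hX : A.2 < X.2 := by
      rw [h.coordB] at hB
      by_contra hcon
      exact absurd hB (not_lt.2 (div_nonpos_of_nonpos_of_nonneg (by linarith)
        (sub_pos.2 h.snd_lt).le))
    refine ⟨hX, hV, ?_⟩
    rcases hC with hC | hC
    · rcases eq_or_lt_of_le hC with hC | hC
      · exact Or.inr (h.conic_neg_of_coordC_eq_zero hX hV hC)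
      · exact Or.inl hC
    · exact Or.inr hC

theorem convex_inner : Convex ℝ (lowerInner κ V A U) := by
  rw [h.inner_eq]
  refine (convex_conicRegion h.pos).inter ?_
  exact convex_halfSpace_lt (f := fun X : ℝ × ℝ => X.2) (LinearMap.snd ℝ ℝ ℝ).isLinear V.2

theorem fst_lt_of_inner (hX : X ∈ lowerInner κ V A U) : X.1 < V.1 := by
  rcases lt_or_ge (coordC V A U X) 0 with hC | hC
  · rw [h.coordC_neg_iff] at hC
    have h1 : (X.2 - A.2) * (V.1 - A.1) < (V.2 - A.2) * (V.1 - A.1) :=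
      mul_lt_mul_of_pos_right (by linarith [hX.2.1]) (sub_pos.2 h.fst_lt')
    have h2 : (X.1 - A.1) * (V.2 - A.2) < (V.1 - A.1) * (V.2 - A.2) := by linarith
    have := lt_of_mul_lt_mul_right h2 (sub_pos.2 h.snd_lt).le
    linarith
  · have hA := h.coordA_pos_of_inner hX
    rw [fst_eq_of_coords h.br_neg.ne X]
    have h1 : coordA V A U X * (A.1 - V.1) < 0 :=
      mul_neg_of_pos_of_neg hA (sub_neg.2 h.fst_lt')
    have h2 : coordC V A U X * (U.1 - V.1) ≤ 0 :=
      mul_nonpos_of_nonneg_of_nonpos hC (sub_neg.2 h.fst_lt'').le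
    linarith

/-- On the line `γ = 0` between the two heights the conic function is negative, so behind the shock
the two conditions `γ < 0` and `conic < 0` overlap without a gap. -/
theorem inner_or_conic_or_outer (h1 : A.2 < X.2) (h2 : X.2 < V.2) : X ∈ lowerInner κ V A U ∨
    (0 < coordA V A U X ∧ 0 < coordC V A U X ∧ conic κ V A U X = 0) ∨ X ∈ lowerOuter κ V A U := by
  have b := h.coordB_pos h1
  rcases lt_trichotomy (coordC V A U X) 0 with hC | hC | hC
  · exact Or.inl ⟨h1, h2, Or.inl hC⟩
  · exact Or.inl ⟨h1, h2, Or.inr (h.conic_neg_of_coordC_eq_zero h1 h2 hC)⟩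
  · rcases lt_trichotomy (conic κ V A U X) 0 with hF | hF | hF
    · exact Or.inl ⟨h1, h2, Or.inr hF⟩
    · refine Or.inr (Or.inl ⟨?_, hC, hF⟩)
      by_contra hA
      have := conic_pos_of_nonpos h.pos hC (not_lt.1 hA) (by rw [h.coordB]; exact b.le)
      linarith
    · exact Or.inr (Or.inr (Or.inr ⟨hC, hF⟩))

theorem outer_of_snd_le (h1 : X.2 ≤ A.2) (h2 : A.1 < X.1) : X ∈ lowerOuter κ V A U := by
  rcases eq_or_lt_of_le h1 with he | hlt
  · have hC : 0 < coordC V A U X := by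
      have e := h.coordC_mul X
      have a1 := mul_pos (sub_pos.2 h2) (sub_pos.2 h.snd_lt)
      rw [he, sub_self, zero_mul, sub_zero] at e
      exact pos_of_mul_pos_left (by rw [e]; exact a1) h.scale_pos.le
    refine Or.inr ⟨hC, ?_⟩
    rw [h.conic_eq, he, sub_self, zero_div, mul_zero, sub_zero]
    positivity
  · exact Or.inl hlt

theorem snd_ge_of_conic (hA : 0 < coordA V A U X) (h0 : conic κ V A U X = 0) : A.2 ≤ X.2 := by
  by_contra hcon
  have hB : 1 - coordA V A U X - coordC V A U X < 0 := by
    rw [h.coordB]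
    exact div_neg_of_neg_of_pos (by linarith) (sub_pos.2 h.snd_lt)
  have hκ := h.pos
  rw [conic] at h0
  have := mul_neg_of_pos_of_neg (show 0 < 2 * κ * coordA V A U X by positivity) hB
  linarith [sq_nonneg (coordC V A U X)]

theorem snd_lt_of_coords (hA : 0 < coordA V A U X) (hC : 0 ≤ coordC V A U X) : X.2 < V.2 := by
  rw [snd_eq_of_coords h.br_neg.ne X, h.snd_eq]
  have := mul_pos (add_pos_of_pos_of_nonneg hA hC) (sub_pos.2 h.snd_lt)
  linarith

theorem snd_gt_of_conic (hA : 0 < coordA V A U X) (hC : 0 < coordC V A U X)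
    (h0 : conic κ V A U X = 0) : A.2 < X.2 := by
  refine lt_of_le_of_ne (h.snd_ge_of_conic hA h0) fun he => ?_
  rw [h.conic_eq, ← he, sub_self, zero_div, mul_zero, sub_zero] at h0
  have := pow_pos hC 2
  linarith

theorem fst_gt_of_coordC (hC : 0 < coordC V A U X) (h2 : A.2 ≤ X.2) : A.1 < X.1 := by
  by_contra hcon
  rcases eq_or_lt_of_le h2 with he | hlt
  · rcases eq_or_lt_of_le (not_lt.1 hcon) with he' | hlt'
    · have : X = A := Prod.ext he' he.symm
      rw [this, coordC, br_eq] at hC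
      have e : (A.1 - V.1) * (A.2 - V.2) - (A.2 - V.2) * (A.1 - V.1) = 0 := by ring
      rw [e, zero_div] at hC
      exact lt_irrefl _ hC
    · exact absurd (h.coordC_neg_of_fst_lt hlt' h2) (not_lt.2 hC.le)
  · exact absurd (h.coordC_neg_of_fst_le (not_lt.1 hcon) hlt) (not_lt.2 hC.le)

variable {H r : ℝ}

/-- Rays from `V` meet the height of `A` once. Beyond it they are below `A`; before it they have `γ
< 0`, which excludes the other part of the outer region. -/
theorem exit_left (hH : A.2 < H) (hX : X.2 = A.2) (hX1 : X.1 < A.1) (hr : 0 < r) :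
    V + r • (X - V) ∈ {X | X.2 < H} ∩ lowerOuter κ V A U ↔ 1 < r := by
  have hC : coordC V A U (V + r • (X - V)) < 0 := by
    rw [coordC_ray, add_sub_cancel]
    exact mul_neg_of_pos_of_neg hr (h.coordC_neg_of_fst_lt hX1 hX.ge)
  have e : (V + r • (X - V)).2 = A.2 - (r - 1) * (V.2 - A.2) := by
    simp only [Prod.snd_add, Prod.smul_snd, Prod.snd_sub, smul_eq_mul, hX]; ring
  have hd := sub_pos.2 h.snd_lt
  constructor
  · rintro ⟨_, h2 | h2⟩
    · rw [e] at h2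
      have : 0 < (r - 1) * (V.2 - A.2) := by linarith
      have := pos_of_mul_pos_left this hd.le
      linarith
    · linarith [h2.1]
  · intro h1
    have := mul_pos (sub_pos.2 h1) hd
    refine ⟨?_, Or.inl ?_⟩
    · simp only [mem_ofPred_eq]; rw [e]; linarith
    · rw [e]; linarith

theorem exit_conic (hA : 0 < coordA V A U X) (hC : 0 < coordC V A U X) (h0 : conic κ V A U X = 0)
    (hH : X.2 < H) (hr : 0 < r) :
    V + r • (X - V) ∈ {X | X.2 < H} ∩ lowerOuter κ V A U ↔ 1 < r := by
  have hF := conic_ray_pos_iff h.pos hA h0 hr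
  have hC' : 0 < coordC V A U (V + r • (X - V)) := by
    rw [coordC_ray, add_sub_cancel]; positivity
  have e : (V + r • (X - V)).2 = X.2 - (r - 1) * (V.2 - X.2) := by
    simp only [Prod.snd_add, Prod.smul_snd, Prod.snd_sub, smul_eq_mul]; ring
  have hd := sub_pos.2 (h.snd_lt_of_coords hA hC.le)
  constructor
  · rintro ⟨_, h2 | h2⟩
    · by_contra hcon
      rw [e] at h2
      have := mul_nonneg (sub_nonneg.2 (not_lt.1 hcon)) hd.le
      linarith [h.snd_ge_of_conic hA h0]
    · exact hF.1 h2.2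
  · intro h1
    refine ⟨?_, Or.inr ⟨hC', hF.2 h1⟩⟩
    have := mul_pos (sub_pos.2 h1) hd
    simp only [mem_ofPred_eq]; rw [e]; linarith

/-- Moving away from `V` never leads back behind the shock: for `α > 0` the affine factor of the
conic function on the ray increases, and for `α ≤ 0` the conic function is positive at or above the
height of `A`. -/
theorem outer_ray (hC : 0 < coordC V A U X)
    (hX : 0 < conic κ V A U X) (hr : 1 < r) : V + r • (X - V) ∈ lowerOuter κ V A U := by
  have hr0 : 0 < r := by linarith
  rcases lt_or_ge (V + r • (X - V)).2 A.2 with h1 | h1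
  · exact Or.inl h1
  have hC' : 0 < coordC V A U (V + r • (X - V)) := by
    rw [coordC_ray, add_sub_cancel]; positivity
  refine Or.inr ⟨hC', ?_⟩
  rcases lt_or_ge 0 (coordA V A U X) with hA | hA
  · rw [conic_ray, add_sub_cancel]
    rw [conic] at hX
    have hκ := h.pos
    have hK : 2 * κ * coordA V A U X < coordC V A U X ^ 2 + 2 * κ * coordA V A U X *
      (coordA V A U X + coordC V A U X) := by linarith
    have hp : 0 < 2 * κ * coordA V A U X := by positivity
    refine mul_pos hr0 (sub_pos.2 (hK.trans ?_))
    exact lt_mul_of_one_lt_left (hp.trans hK) hr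
  · refine conic_pos_of_nonpos h.pos hC' ?_ ?_
    · rw [coordA_ray, add_sub_cancel]
      exact mul_nonpos_of_nonneg_of_nonpos hr0.le hA
    · rw [h.coordB]; exact h.coordB_nonneg h1

theorem exit_right (hH : X.2 = H) (hHV : H < V.2) (hC : 0 < coordC V A U X)
    (hX : 0 < conic κ V A U X) :
    V + r • (X - V) ∈ {X | X.2 < H} ∩ lowerOuter κ V A U ↔ 1 < r := by
  have e : (V + r • (X - V)).2 = H - (r - 1) * (V.2 - H) := by
    simp only [Prod.snd_add, Prod.smul_snd, Prod.snd_sub, smul_eq_mul, hH]; ring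
  constructor
  · rintro ⟨h1, _⟩
    simp only [mem_ofPred_eq] at h1
    rw [e] at h1
    have : 0 < (r - 1) * (V.2 - H) := by linarith
    have := pos_of_mul_pos_left this (sub_pos.2 hHV).le
    linarith
  · intro h1
    refine ⟨?_, h.outer_ray hC hX h1⟩
    have := mul_pos (sub_pos.2 h1) (sub_pos.2 hHV)
    simp only [mem_ofPred_eq]; rw [e]; linarith

/-- Such rays lie on the far side of the tangent `V U` of the conic at `V`; the particles on them
never reach the shock. -/
theorem outer_ray_of_coordA_nonpos (hA : coordA V A U (V + Y) ≤ 0) (hC : 0 < coordC V A U (V + Y))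
    (hr : 0 < r) : V + r • Y ∈ lowerOuter κ V A U := by
  rcases lt_or_ge (V + r • Y).2 A.2 with h1 | h1
  · exact Or.inl h1
  have hC' : 0 < coordC V A U (V + r • Y) := by
    rw [coordC_ray]; positivity
  refine Or.inr ⟨hC', conic_pos_of_nonpos h.pos hC' ?_ ?_⟩
  · rw [coordA_ray]
    exact mul_nonpos_of_nonneg_of_nonpos hr.le hA
  · rw [h.coordB]; exact h.coordB_nonneg h1

end LowerConfig

/-! ### Null lines, disjointness, and straight shocks along horizontals -/

theorem ae_linear_ne_zero {a b : ℝ} (h : a ≠ 0 ∨ b ≠ 0) :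
    ∀ᵐ x : ℝ × ℝ, a * x.1 + b * x.2 ≠ 0 := by
  let f : ℝ × ℝ →ₗ[ℝ] ℝ := a • LinearMap.fst ℝ ℝ ℝ + b • LinearMap.snd ℝ ℝ ℝ
  have hf : ∀ x : ℝ × ℝ, f x = a * x.1 + b * x.2 := fun x => rfl
  have h0 : (volume : Measure (ℝ × ℝ)) (LinearMap.ker f) = 0 := by
    refine Measure.addHaar_submodule _ _ fun htop => ?_
    have h1 : ∀ x, f x = 0 := fun x => by
      have : x ∈ LinearMap.ker f := htop ▸ Submodule.mem_top
      exact this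
    have h2 := h1 (1, 0)
    have h3 := h1 (0, 1)
    simp only [hf, mul_one, mul_zero, add_zero, zero_add] at h2 h3
    rcases h with h | h <;> contradiction
  rw [ae_iff]
  convert h0 using 2
  ext x
  simp [hf]

theorem ae_fst_ne_zero : ∀ᵐ x : ℝ × ℝ, x.1 ≠ 0 := by
  filter_upwards [ae_linear_ne_zero (a := 1) (b := 0) (Or.inl one_ne_zero)] with x hx
  simpa using hx

theorem ae_snd_ne_zero : ∀ᵐ x : ℝ × ℝ, x.2 ≠ 0 := by
  filter_upwards [ae_linear_ne_zero (a := 0) (b := 1) (Or.inr one_ne_zero)] with x hx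
  simpa using hx

theorem pairwise_disjoint_fin_four {D : Fin 4 → Set (ℝ × ℝ)}
    (h01 : ∀ X ∈ D 0, X ∉ D 1) (h02 : ∀ X ∈ D 0, X ∉ D 2) (h03 : ∀ X ∈ D 0, X ∉ D 3)
    (h12 : ∀ X ∈ D 1, X ∉ D 2) (h13 : ∀ X ∈ D 1, X ∉ D 3) (h23 : ∀ X ∈ D 2, X ∉ D 3) :
    Pairwise (Function.onFun Disjoint D) := by
  have key : ∀ i j, i < j → Disjoint (D i) (D j) := by
    intro i j hij
    rw [disjoint_left]
    fin_cases i <;> fin_cases j <;> first | assumption | exact absurd hij (by decide)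
  intro i j hij
  rcases lt_or_gt_of_ne hij with h | h
  · exact key i j h
  · exact (key j i h).symm

section straight
variable {L R : State} {P X : ℝ × ℝ}

theorem deltaVel_comm (L R : State) : deltaVel L R = deltaVel R L := by
  rw [deltaVel, deltaVel, add_comm, add_comm (√L.ρ • L.vel)]

theorem deltaVel_fst (L R : State) : (deltaVel L R).1 = (√L.ρ * L.u + √R.ρ * R.u) /
    (√L.ρ + √R.ρ) := by
  simp [deltaVel, State.vel, div_eq_inv_mul]

theorem deltaVel_snd (L R : State) : (deltaVel L R).2 = (√L.ρ * L.v + √R.ρ * R.v) /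
    (√L.ρ + √R.ρ) := by
  simp [deltaVel, State.vel, div_eq_inv_mul]

theorem deltaVel_fst_mem (hL : 0 < L.ρ) (hR : 0 < R.ρ) (h : L.u < R.u) :
    L.u < (deltaVel L R).1 ∧ (deltaVel L R).1 < R.u := by
  have h1 := Real.sqrt_pos.2 hL
  have h2 := Real.sqrt_pos.2 hR
  rw [deltaVel_fst, lt_div_iff₀ (by positivity), div_lt_iff₀ (by positivity)]
  constructor
  · linarith [mul_lt_mul_of_pos_left h h2]
  · linarith [mul_lt_mul_of_pos_left h h1]

theorem deltaVel_snd_mem (hL : 0 < L.ρ) (hR : 0 < R.ρ) (h : L.v < R.v) :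
    L.v < (deltaVel L R).2 ∧ (deltaVel L R).2 < R.v := by
  have h1 := Real.sqrt_pos.2 hL
  have h2 := Real.sqrt_pos.2 hR
  rw [deltaVel_snd, lt_div_iff₀ (by positivity), div_lt_iff₀ (by positivity)]
  constructor
  · linarith [mul_lt_mul_of_pos_left h h2]
  · linarith [mul_lt_mul_of_pos_left h h1]

theorem straightDelta_Ξ_fst (s : ℝ) : ((straightDelta L R P).Ξ s).1 =
    (deltaVel L R).1 + Real.exp s * (P.1 - (deltaVel L R).1) := rfl

theorem straightDelta_Ξ_snd (h : (deltaVel L R).2 = P.2) (s : ℝ) :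
    ((straightDelta L R P).Ξ s).2 = P.2 := by
  simp [straightDelta, h]

theorem straightDelta_Ξ_injective (hne : P.1 ≠ (deltaVel L R).1) :
    Function.Injective (straightDelta L R P).Ξ := fun s t h => by
  have := congrArg Prod.fst h
  rw [straightDelta_Ξ_fst, straightDelta_Ξ_fst] at this
  exact Real.exp_injective (mul_right_cancel₀ (sub_ne_zero.2 hne) (add_left_cancel this))

theorem exists_straightDelta_Ξ (h : (deltaVel L R).2 = P.2) (hX : X.2 = P.2)
    (hpos : 0 < (X.1 - (deltaVel L R).1) / (P.1 - (deltaVel L R).1)) :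
    (straightDelta L R P).Ξ (Real.log ((X.1 - (deltaVel L R).1) / (P.1 - (deltaVel L R).1))) =
      X := by
  refine Prod.ext ?_ ?_
  · have : P.1 - (deltaVel L R).1 ≠ 0 := by
      rintro h0; rw [h0, div_zero] at hpos; exact lt_irrefl _ hpos
    rw [straightDelta_Ξ_fst, Real.exp_log hpos, div_mul_cancel₀ _ this]; ring
  · rw [straightDelta_Ξ_snd h, hX]

theorem straightDelta_Ξ_fst_lt (hP : P.1 < (deltaVel L R).1) {s : ℝ} (hs : 0 < s) :
    ((straightDelta L R P).Ξ s).1 < P.1 := by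
  rw [straightDelta_Ξ_fst]
  have := Real.one_lt_exp_iff.2 hs
  nlinarith

theorem straightDelta_Ξ_fst_gt (hP : (deltaVel L R).1 < P.1) {s : ℝ} (hs : 0 < s) :
    P.1 < ((straightDelta L R P).Ξ s).1 := by
  rw [straightDelta_Ξ_fst]
  have := Real.one_lt_exp_iff.2 hs
  nlinarith

theorem exists_straightDelta_of_fst_lt (h : (deltaVel L R).2 = P.2) (hP : P.1 < (deltaVel L R).1)
    (hX : X.2 = P.2) (hX1 : X.1 < P.1) : ∃ s > 0, (straightDelta L R P).Ξ s = X := by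
  have h1 : 1 < (X.1 - (deltaVel L R).1) / (P.1 - (deltaVel L R).1) := by
    rw [one_lt_div_of_neg (by linarith)]; linarith
  exact ⟨_, Real.log_pos h1, exists_straightDelta_Ξ h hX (by linarith)⟩

theorem exists_straightDelta_of_fst_gt (h : (deltaVel L R).2 = P.2) (hP : (deltaVel L R).1 < P.1)
    (hX : X.2 = P.2) (hX1 : P.1 < X.1) : ∃ s > 0, (straightDelta L R P).Ξ s = X := by
  have h1 : 1 < (X.1 - (deltaVel L R).1) / (P.1 - (deltaVel L R).1) := by
    rw [one_lt_div (by linarith)]; linarith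
  exact ⟨_, Real.log_pos h1, exists_straightDelta_Ξ h hX (by linarith)⟩

theorem image_straightDelta_left (h : (deltaVel L R).2 = P.2) (hP : P.1 < (deltaVel L R).1) :
    (straightDelta L R P).Ξ '' Ici 0 = {X | X.2 = P.2 ∧ X.1 ≤ P.1} := by
  ext X
  constructor
  · rintro ⟨s, hs, rfl⟩
    refine ⟨straightDelta_Ξ_snd h s, ?_⟩
    rcases eq_or_lt_of_le (mem_Ici.1 hs) with rfl | hs
    · simp
    · exact (straightDelta_Ξ_fst_lt hP hs).le
  · rintro ⟨h2, h1⟩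
    rcases eq_or_lt_of_le h1 with he | hlt
    · exact ⟨0, mem_Ici.2 le_rfl, by rw [straightDelta_Ξ_zero]; exact Prod.ext he.symm h2.symm⟩
    · obtain ⟨s, hs, rfl⟩ := exists_straightDelta_of_fst_lt h hP h2 hlt
      exact ⟨s, le_of_lt hs, rfl⟩

theorem image_straightDelta_right (h : (deltaVel L R).2 = P.2) (hP : (deltaVel L R).1 < P.1) :
    (straightDelta L R P).Ξ '' Ici 0 = {X | X.2 = P.2 ∧ P.1 ≤ X.1} := by
  ext X
  constructor
  · rintro ⟨s, hs, rfl⟩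
    refine ⟨straightDelta_Ξ_snd h s, ?_⟩
    rcases eq_or_lt_of_le (mem_Ici.1 hs) with rfl | hs
    · simp
    · exact (straightDelta_Ξ_fst_gt hP hs).le
  · rintro ⟨h2, h1⟩
    rcases eq_or_lt_of_le h1 with he | hlt
    · exact ⟨0, mem_Ici.2 le_rfl, by rw [straightDelta_Ξ_zero]; exact Prod.ext he h2.symm⟩
    · obtain ⟨s, hs, rfl⟩ := exists_straightDelta_of_fst_gt h hP h2 hlt
      exact ⟨s, le_of_lt hs, rfl⟩

theorem rot_straightDelta (h : (deltaVel L R).2 = P.2) (s : ℝ) :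
    rot ((straightDelta L R P).U s - (straightDelta L R P).Ξ s) =
      (0, Real.exp s * ((deltaVel L R).1 - P.1)) := by
  refine Prod.ext ?_ ?_
  · simp [rot, straightDelta, h]
  · simp only [rot, straightDelta, Prod.fst_sub, Prod.fst_add, Prod.smul_fst, smul_eq_mul]
    ring

end straight

/-! ### The configuration at `A` common to both cases -/

/-- The hypotheses that the two configurations have in common. -/
structure Admissible (S₁ S₂ S₃ : State) : Prop where
  ρ₁ : 0 < S₁.ρ
  ρ₂ : 0 < S₂.ρ
  ρ₃ : 0 < S₃.ρ
  H₁ : 0 < S₁.H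
  H₂ : 0 < S₂.H
  H₃ : 0 < S₃.H
  u_eq : S₁.u = S₂.u
  u_lt : S₂.u < S₃.u
  v_lt : S₂.v < S₃.v
  corner_lt : (deltaVel S₂ S₃).2 < S₁.v

/-- The point where the delta shock between `S₂` and `S₃` meets the contact line. -/
noncomputable def corner (S₁ S₂ S₃ : State) : ℝ × ℝ := (S₁.u, (deltaVel S₂ S₃).2)

/-- The delta shock from `corner` to infinity. -/
noncomputable def leftShock (S₁ S₂ S₃ : State) : DeltaCurve :=
  straightDelta S₂ S₃ (corner S₁ S₂ S₃)

/-- The delta shock between vacuum and `S₃` that emerges at `corner`. -/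
noncomputable def lowerShock (S₁ S₂ S₃ : State) : DeltaCurve :=
  vacuumShock S₃ (corner S₁ S₂ S₃) (deltaVel S₂ S₃) ((leftShock S₁ S₂ S₃).m 0)
    ((leftShock S₁ S₂ S₃).n 0)

/-- The shape parameter of `lowerShock`. -/
noncomputable def lowerShape (S₁ S₂ S₃ : State) : ℝ :=
  shockShape S₃ (corner S₁ S₂ S₃) (deltaVel S₂ S₃) ((leftShock S₁ S₂ S₃).m 0)

/-- The region of the state `S₂`. -/
def leftRegion (S₁ S₂ S₃ : State) : Set (ℝ × ℝ) :=
  {X | X.1 < S₁.u ∧ (corner S₁ S₂ S₃).2 < X.2}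

theorem isOpen_leftRegion {S₁ S₂ S₃ : State} : IsOpen (leftRegion S₁ S₂ S₃) :=
  (isOpen_lt continuous_fst continuous_const).inter (isOpen_lt continuous_const continuous_snd)

theorem leftShock_Ξ_snd {S₁ S₂ S₃ : State} (s : ℝ) : ((leftShock S₁ S₂ S₃).Ξ s).2 =
    (corner S₁ S₂ S₃).2 :=
  straightDelta_Ξ_snd rfl s

namespace Admissible
variable {S₁ S₂ S₃ : State} (h : Admissible S₁ S₂ S₃)
include h

theorem br_corner : 0 < br S₂.vel S₃.vel (corner S₁ S₂ S₃) := by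
  have e : br S₂.vel S₃.vel (corner S₁ S₂ S₃) =
      (S₃.u - S₂.u) * ((deltaVel S₂ S₃).2 - S₂.v) := by
    rw [br_eq]; simp [State.vel, corner, h.u_eq]
  rw [e]
  exact mul_pos (sub_pos.2 h.u_lt) (sub_pos.2 (deltaVel_snd_mem h.ρ₂ h.ρ₃ h.v_lt).1)

theorem corner_fst_lt : (corner S₁ S₂ S₃).1 < (deltaVel S₂ S₃).1 := by
  have := (deltaVel_fst_mem h.ρ₂ h.ρ₃ h.u_lt).1
  simpa [corner, h.u_eq] using this

theorem lt_corner_snd : S₂.v < (corner S₁ S₂ S₃).2 := (deltaVel_snd_mem h.ρ₂ h.ρ₃ h.v_lt).1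

theorem leftShock_pos : 0 < (leftShock S₁ S₂ S₃).m 0 ∧ 0 < (leftShock S₁ S₂ S₃).n 0 :=
  straightDelta_pos h.ρ₂ h.ρ₃ h.H₂ h.H₃ h.br_corner 0

theorem br_lower : br S₃.vel (deltaVel S₂ S₃) (corner S₁ S₂ S₃) < 0 := by
  have h1 := (deltaVel_snd_mem h.ρ₂ h.ρ₃ h.v_lt).2
  have h2 := h.corner_fst_lt
  have e : br S₃.vel (deltaVel S₂ S₃) (corner S₁ S₂ S₃) =
      (S₃.v - (deltaVel S₂ S₃).2) * ((corner S₁ S₂ S₃).1 - (deltaVel S₂ S₃).1) := by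
    rw [br_eq]; simp only [State.vel, corner]; ring
  rw [e]
  exact mul_neg_of_pos_of_neg (sub_pos.2 h1) (sub_neg.2 h2)

theorem lowerConfig :
    LowerConfig (lowerShape S₁ S₂ S₃) S₃.vel (corner S₁ S₂ S₃) (deltaVel S₂ S₃) where
  pos := shockShape_pos h.ρ₃ h.leftShock_pos.1 h.br_lower
  snd_eq := rfl
  fst_lt := h.corner_fst_lt
  fst_lt' := h.u_eq.trans_lt h.u_lt
  fst_lt'' := (deltaVel_fst_mem h.ρ₂ h.ρ₃ h.u_lt).2
  snd_lt := (deltaVel_snd_mem h.ρ₂ h.ρ₃ h.v_lt).2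

theorem image_leftShock : (leftShock S₁ S₂ S₃).Ξ '' Ici 0 =
    {X | X.2 = (corner S₁ S₂ S₃).2 ∧ X.1 ≤ S₁.u} :=
  image_straightDelta_left rfl h.corner_fst_lt

theorem leftShock_Ξ_fst {s : ℝ} (hs : 0 < s) : ((leftShock S₁ S₂ S₃).Ξ s).1 < S₁.u :=
  straightDelta_Ξ_fst_lt h.corner_fst_lt hs

theorem exists_leftShock {X : ℝ × ℝ} (h2 : X.2 = (corner S₁ S₂ S₃).2) (h1 : X.1 < S₁.u) :
    ∃ s > 0, (leftShock S₁ S₂ S₃).Ξ s = X :=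
  exists_straightDelta_of_fst_lt rfl h.corner_fst_lt h2 h1

theorem isDeltaShock_leftShock : IsDeltaShock S₂ S₃ (leftShock S₁ S₂ S₃) (Ici 0) :=
  isDeltaShock_straightDelta h.ρ₂ h.ρ₃ h.H₂ h.H₃ h.br_corner _

theorem emergesAt_lowerShock : EmergesAt (corner S₁ S₂ S₃) S₂ S₃ (lowerShock S₁ S₂ S₃) := by
  refine ⟨vacuumShock_Ξ_zero, fun k => ?_,
    isDeltaShock_vacuumShock h.ρ₃ h.H₃ h.leftShock_pos.1 h.leftShock_pos.2 h.br_lower,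
    vacuumShockBehaviour h.ρ₃ h.leftShock_pos.1 h.br_lower⟩
  simp only [DeltaCurve.cons, lowerShock, vacuumShock_m_zero, vacuumShock_U_zero,
    vacuumShock_n_zero]
  rfl

/-- State 2 moves along the contact line, so no particle crosses it. Relative to `S₂.vel` the
particles start at positive height, and almost every one of them falls onto the straight shock,
which lies above the singular point of state 2. -/
theorem isSweptBy_leftRegion : IsSweptBy S₂.vel (leftRegion S₁ S₂ S₃)
    {q | q.1 < 0 ∧ 0 ≤ q.2} (fun _ : Fin 1 => leftShock S₁ S₂ S₃) fun _ => Ioi 0 where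
  tame _ := tame_straightDelta h.ρ₂ h.ρ₃ h.br_corner
  bounded_flux _ := bounded_flux_left h.ρ₂ h.ρ₃ h.br_corner _
  measurableSet_region := isOpen_leftRegion.measurableSet
  measurableSet_source := by measurability
  injective j k s s' _ _ he :=
    ⟨Subsingleton.elim _ _, straightDelta_Ξ_injective h.corner_fst_lt.ne he⟩
  source j s hs r hr := by
    have h1 := h.leftShock_Ξ_fst hs
    have h2 := leftShock_Ξ_snd (S₁ := S₁) (S₂ := S₂) (S₃ := S₃) s
    have h3 := h.lt_corner_snd
    have h4 := h.u_eq
    constructor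
    · simp only [Prod.smul_fst, Prod.fst_sub, State.vel, smul_eq_mul]
      exact mul_neg_of_pos_of_neg hr (by linarith)
    · simp only [Prod.smul_snd, Prod.snd_sub, State.vel, smul_eq_mul]
      exact mul_nonneg hr.le (by linarith)
  exit j s hs r hr := by
    have h1 := h.leftShock_Ξ_fst hs
    have h2 := leftShock_Ξ_snd (S₁ := S₁) (S₂ := S₂) (S₃ := S₃) s
    have h3 := sub_pos.2 h.lt_corner_snd
    have h4 := h.u_eq
    simp only [leftRegion, mem_ofPred_eq, Prod.fst_add, Prod.snd_add, Prod.smul_fst, Prod.smul_snd,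
      Prod.fst_sub, Prod.snd_sub, State.vel, smul_eq_mul, h2]
    constructor
    · rintro ⟨-, h5⟩
      have : 0 < (r - 1) * ((corner S₁ S₂ S₃).2 - S₂.v) := by linarith
      linarith [pos_of_mul_pos_left this h3.le]
    · intro h5
      have h6 := mul_pos (sub_pos.2 h5) h3
      have h7 := mul_neg_of_pos_of_neg hr (show ((leftShock S₁ S₂ S₃).Ξ s).1 - S₂.u < 0 by linarith)
      constructor <;> linarith
  hit_or_stay := by
    filter_upwards [ae_snd_ne_zero] with x hx hQ
    left
    have hx2 : 0 < x.2 := lt_of_le_of_ne hQ.2 hx.symm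
    have h3 := sub_pos.2 h.lt_corner_snd
    -- The factor brings the point of the ray to the height of the shock; its first coordinate is
    -- negative relative to the contact line.
    obtain ⟨s, hs, he⟩ := h.exists_leftShock
      (X := S₂.vel + (((corner S₁ S₂ S₃).2 - S₂.v) / x.2) • x)
      (by simp [State.vel]; field_simp; ring) (by
        simp only [Prod.fst_add, Prod.smul_fst, State.vel, smul_eq_mul, h.u_eq]
        linarith [mul_neg_of_pos_of_neg (div_pos h3 hx2) hQ.1])
    refine ⟨0, s, hs, x.2 / ((corner S₁ S₂ S₃).2 - S₂.v), div_pos hx2 h3, ?_⟩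
    rw [he, add_sub_cancel_left, smul_smul, div_mul_div_cancel₀ h3.ne', div_self hx, one_smul]
  not_mem := by
    refine Eventually.of_forall fun x hx r hr hD => hx ?_
    have h3 := h.lt_corner_snd
    have h4 := h.u_eq
    simp only [leftRegion, mem_ofPred_eq, Prod.fst_add, Prod.snd_add, Prod.smul_fst, Prod.smul_snd,
      State.vel, smul_eq_mul] at hD
    refine ⟨?_, ?_⟩
    · by_contra hc
      have := mul_nonneg hr.le (not_lt.1 hc)
      linarith
    · by_contra hc
      have := mul_neg_of_pos_of_neg hr (not_le.1 hc)
      linarith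

theorem separates_leftShock {D : Set (ℝ × ℝ)} (hD : {X | X.2 < (corner S₁ S₂ S₃).2} ⊆ D) :
    (leftShock S₁ S₂ S₃).Separates (Ioi 0) (leftRegion S₁ S₂ S₃) D := by
  intro s hs
  have h1 := h.leftShock_Ξ_fst hs
  have h2 := leftShock_Ξ_snd (S₁ := S₁) (S₂ := S₂) (S₃ := S₃) s
  have h3 := sub_pos.2 h.corner_fst_lt
  have e : rot ((leftShock S₁ S₂ S₃).U s - (leftShock S₁ S₂ S₃).Ξ s) = _ :=
    rot_straightDelta (P := corner S₁ S₂ S₃) rfl s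
  rw [e]
  filter_upwards [self_mem_nhdsWithin] with ε hε
  have h4 := mul_pos (mem_Ioi.1 hε) (mul_pos (Real.exp_pos s) h3)
  refine ⟨⟨?_, ?_⟩, hD ?_⟩
  · simpa using h1
  · simp only [Prod.snd_add, Prod.smul_snd, smul_eq_mul, h2]; linarith
  · simp only [mem_ofPred_eq, Prod.snd_sub, Prod.smul_snd, smul_eq_mul, h2]; linarith

theorem lowerShock_coords {s : ℝ} (hs : s < 0) :
    0 < coordA S₃.vel (corner S₁ S₂ S₃) (deltaVel S₂ S₃) ((lowerShock S₁ S₂ S₃).Ξ s) ∧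
    0 < coordC S₃.vel (corner S₁ S₂ S₃) (deltaVel S₂ S₃) ((lowerShock S₁ S₂ S₃).Ξ s) ∧
    conic (lowerShape S₁ S₂ S₃) S₃.vel (corner S₁ S₂ S₃) (deltaVel S₂ S₃)
      ((lowerShock S₁ S₂ S₃).Ξ s) = 0 :=
  ⟨coordA_vacuumShock_pos h.br_lower,
    coordC_vacuumShock_pos h.ρ₃ h.leftShock_pos.1 h.br_lower hs,
    conic_vacuumShock h.ρ₃ h.leftShock_pos.1 h.br_lower hs.le⟩

theorem exists_lowerShock {X : ℝ × ℝ}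
    (hA : 0 < coordA S₃.vel (corner S₁ S₂ S₃) (deltaVel S₂ S₃) X)
    (hC : 0 < coordC S₃.vel (corner S₁ S₂ S₃) (deltaVel S₂ S₃) X)
    (h0 : conic (lowerShape S₁ S₂ S₃) S₃.vel (corner S₁ S₂ S₃) (deltaVel S₂ S₃) X = 0) :
    ∃ s < 0, (lowerShock S₁ S₂ S₃).Ξ s = X := by
  obtain ⟨s, hs, rfl⟩ := exists_vacuumShock_of_conic (n₀ := (leftShock S₁ S₂ S₃).n 0) h.ρ₃
    h.leftShock_pos.1 h.br_lower hA hC.le h0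
  refine ⟨s, lt_of_le_of_ne hs ?_, rfl⟩
  rintro rfl
  rw [coordC_vacuumShock h.br_lower, shockRatio_zero, sub_self, mul_zero, mul_zero] at hC
  exact lt_irrefl _ hC

/-- The sign change of the conic function only decides the side locally. The open sets `N` and `M`
record further conditions that hold on the curve and hence near it, so one statement serves both
cases. -/
theorem separates_lowerShock {I : Set ℝ} (hI : I ⊆ Iio 0) {N M : Set (ℝ × ℝ)} (hN : IsOpen N)
    (hM : IsOpen M) (hIN : ∀ s ∈ I, (lowerShock S₁ S₂ S₃).Ξ s ∈ N)
    (hIM : ∀ s ∈ I, (lowerShock S₁ S₂ S₃).Ξ s ∈ M) :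
    (lowerShock S₁ S₂ S₃).Separates I
      (N ∩ lowerInner (lowerShape S₁ S₂ S₃) S₃.vel (corner S₁ S₂ S₃) (deltaVel S₂ S₃))
      (M ∩ lowerOuter (lowerShape S₁ S₂ S₃) S₃.vel (corner S₁ S₂ S₃) (deltaVel S₂ S₃)) := by
  intro s hs
  have hs0 : s < 0 := hI hs
  obtain ⟨hA, hC, h0⟩ := h.lowerShock_coords hs0
  have hsep := vacuumShock_separates (n₀ := (leftShock S₁ S₂ S₃).n 0) h.ρ₃ h.leftShock_pos.1
    h.br_lower hs0.le
  have hcont : ∀ v : ℝ × ℝ, Tendsto (fun ε : ℝ => (lowerShock S₁ S₂ S₃).Ξ s + ε • v) (𝓝[>] 0)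
      (𝓝 ((lowerShock S₁ S₂ S₃).Ξ s)) := fun v => by
    have : Continuous fun ε : ℝ => (lowerShock S₁ S₂ S₃).Ξ s + ε • v := by fun_prop
    refine (this.tendsto' 0 _ (by simp)).mono_left nhdsWithin_le_nhds
  have hN' := hN.inter ((isOpen_lt continuous_const continuous_snd).inter
    (isOpen_lt continuous_snd continuous_const)) |>.mem_nhds
      (show (lowerShock S₁ S₂ S₃).Ξ s ∈ N ∩ ({X | (corner S₁ S₂ S₃).2 < X.2} ∩
        {X | X.2 < S₃.vel.2}) from ⟨hIN s hs, h.lowerConfig.snd_gt_of_conic hA hC h0,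
          h.lowerConfig.snd_lt_of_coords hA hC.le⟩)
  have hM' := hM.inter (isOpen_lt continuous_const continuous_coordC) |>.mem_nhds
      (show (lowerShock S₁ S₂ S₃).Ξ s ∈ M ∩ {X | 0 < coordC S₃.vel (corner S₁ S₂ S₃)
        (deltaVel S₂ S₃) X} from ⟨hIM s hs, hC⟩)
  filter_upwards [hsep, (hcont (rot ((lowerShock S₁ S₂ S₃).U s - (lowerShock S₁ S₂ S₃).Ξ s))) hN',
    (hcont (-rot ((lowerShock S₁ S₂ S₃).U s - (lowerShock S₁ S₂ S₃).Ξ s))) hM'] with ε h1 h2 h3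
  rw [mem_preimage, smul_neg, ← sub_eq_add_neg] at h3
  exact ⟨⟨h2.1, h2.2.1, h2.2.2, Or.inr h1.1⟩, h3.1, Or.inr ⟨h3.2, h1.2⟩⟩

end Admissible

/-! ### Rays, contact discontinuities and values of the piecewise constant field -/

theorem eq_smul_sub_of_eq_add_smul {V Z x : ℝ × ℝ} {r : ℝ} (hr : 0 < r) (h : Z = V + r • x) :
    x = r⁻¹ • (Z - V) := by
  rw [h, add_sub_cancel_left, smul_smul, inv_mul_cancel₀ hr.ne', one_smul]

theorem iUnion_fin_four (D : Fin 4 → Set (ℝ × ℝ)) : ⋃ i, D i = D 0 ∪ D 1 ∪ D 2 ∪ D 3 := by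
  ext X
  simp [Fin.exists_fin_succ, or_assoc]

theorem eventually_lt_mul {x : ℝ} (hx : 0 < x) (c : ℝ) : ∀ᶠ r : ℝ in atTop, c < r * x :=
  (tendsto_id.atTop_mul_const hx).eventually_gt_atTop c

theorem eventually_mul_lt {x : ℝ} (hx : x < 0) (c : ℝ) : ∀ᶠ r : ℝ in atTop, r * x < c :=
  (tendsto_id.atTop_mul_const_of_neg hx).eventually_lt_atBot c

theorem tendsto_add_smul_nhdsGT (X v : ℝ × ℝ) :
    Tendsto (fun ε : ℝ => X + ε • v) (𝓝[>] 0) (𝓝 X) := by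
  have : Continuous fun ε : ℝ => X + ε • v := by fun_prop
  exact (this.tendsto' 0 _ (by simp)).mono_left nhdsWithin_le_nhds

theorem tendsto_sub_smul_nhdsGT (X v : ℝ × ℝ) :
    Tendsto (fun ε : ℝ => X - ε • v) (𝓝[>] 0) (𝓝 X) := by
  have : Continuous fun ε : ℝ => X - ε • v := by fun_prop
  exact (this.tendsto' 0 _ (by simp)).mono_left nhdsWithin_le_nhds

theorem isContactAt_vertical {x y : ℝ} {L R : State} {DL DR : Set (ℝ × ℝ)}
    (hL : L.u = x ∨ L = vacuum) (hR : R.u = x)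
    (h : ∀ᶠ ε in 𝓝[>] (0 : ℝ), (x, y) + ε • (1, 0) ∈ DL ∧ (x, y) - ε • (1, 0) ∈ DR) :
    IsContactAt (x, y) (0, -1) L R DL DR := by
  have e : rot (0, -1) = (1, 0) := by simp [rot]
  have b : ∀ S : State, S.u = x → br (x, y) ((x, y) + (0, -1)) S.vel = 0 := fun S hS => by
    rw [br_eq]; simp [State.vel, hS]
  refine ⟨fun k => ?_, ?_, by rw [e]; exact h⟩
  · rw [b R hR, mul_zero]
    rcases hL with hL | rfl
    · rw [b L hL, mul_zero]
    · rw [vacuum_cons, zero_mul]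
  · rcases hL with hL | rfl
    · rw [b L hL, mul_zero]
    · exact zero_mul _

theorem isContactAt_horizontal {x y : ℝ} {L R : State} {DL DR : Set (ℝ × ℝ)}
    (hL : L.v = y ∨ L = vacuum) (hR : R.v = y)
    (h : ∀ᶠ ε in 𝓝[>] (0 : ℝ), (x, y) + ε • (0, -1) ∈ DL ∧ (x, y) - ε • (0, -1) ∈ DR) :
    IsContactAt (x, y) (-1, 0) L R DL DR := by
  have e : rot (-1, 0) = (0, -1) := by simp [rot]
  have b : ∀ S : State, S.v = y → br (x, y) ((x, y) + (-1, 0)) S.vel = 0 := fun S hS => by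
    rw [br_eq]; simp [State.vel, hS]
  refine ⟨fun k => ?_, ?_, by rw [e]; exact h⟩
  · rw [b R hR, mul_zero]
    rcases hL with hL | rfl
    · rw [b L hL, mul_zero]
    · rw [vacuum_cons, zero_mul]
  · rcases hL with hL | rfl
    · rw [b L hL, mul_zero]
    · exact zero_mul _

theorem patch_values (S₁ S₂ S₃ : State) {D : Fin 4 → Set (ℝ × ℝ)}
    (hD : Pairwise (Function.onFun Disjoint D)) :
    (∀ X ∈ D 0, (patch S₁ S₂ S₃ D X).ρ = 0 ∧ (patch S₁ S₂ S₃ D X).H = 0) ∧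
    (∀ X ∈ D 1, patch S₁ S₂ S₃ D X = S₁) ∧ (∀ X ∈ D 2, patch S₁ S₂ S₃ D X = S₂) ∧
    (∀ X ∈ D 3, patch S₁ S₂ S₃ D X = S₃) := by
  have key : ∀ i j, i ≠ j → ∀ X ∈ D i, X ∉ D j := fun i j hij X hi hj =>
    disjoint_left.1 (hD hij) hi hj
  refine ⟨fun X hX => ?_, fun X hX => ?_, fun X hX => ?_, fun X hX => ?_⟩
  · rw [patch, if_neg (key 0 1 (by decide) X hX), if_neg (key 0 2 (by decide) X hX),
      if_neg (key 0 3 (by decide) X hX)]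
    exact ⟨rfl, rfl⟩
  · rw [patch, if_pos hX]
  · rw [patch, if_neg (key 2 1 (by decide) X hX), if_pos hX]
  · rw [patch, if_neg (key 3 1 (by decide) X hX), if_neg (key 3 2 (by decide) X hX), if_pos hX]

namespace LowerConfig
variable {κ : ℝ} {V A U X : ℝ × ℝ} (h : LowerConfig κ V A U)
include h

theorem isBounded_inner {a : ℝ} :
    Bornology.IsBounded ({X : ℝ × ℝ | a < X.1} ∩ lowerInner κ V A U) := by
  refine (Metric.isBounded_Icc (a, A.2) V).subset fun X hX => ?_
  exact ⟨⟨hX.1.le, hX.2.1.le⟩, ⟨(h.fst_lt_of_inner hX.2).le, hX.2.2.1.le⟩⟩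

theorem isConnected_inner : IsConnected ({X : ℝ × ℝ | A.1 < X.1} ∩ lowerInner κ V A U) := by
  have hc : Convex ℝ ({X : ℝ × ℝ | A.1 < X.1} ∩ lowerInner κ V A U) :=
    (convex_halfSpace_gt (f := fun X : ℝ × ℝ => X.1) (LinearMap.fst ℝ ℝ ℝ).isLinear A.1).inter
      h.convex_inner
  have h1 := h.snd_lt
  have h2 := h.fst_lt'
  -- A point a quarter of the way from `A` to `V` horizontally and half of it vertically, hence to
  -- the left of the line `A V`.
  refine ⟨⟨(A.1 + (V.1 - A.1) / 4, A.2 + (V.2 - A.2) / 2), ?_, ?_, ?_, Or.inl ?_⟩,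
    hc.isPreconnected⟩
  · simp only [mem_ofPred_eq]; linarith
  · simp only; linarith
  · simp only; linarith
  · rw [h.coordC_neg_iff]
    nlinarith [mul_pos (sub_pos.2 h1) (sub_pos.2 h2)]

theorem ae_coordC_ne_zero : ∀ᵐ x : ℝ × ℝ, coordC V A U (V + x) ≠ 0 := by
  have h1 := sub_neg.2 h.snd_lt
  filter_upwards [ae_linear_ne_zero (a := A.2 - V.2) (b := V.1 - A.1) (Or.inl h1.ne)] with x hx
  rw [coordC, br_eq]
  refine div_ne_zero ?_ h.br_neg.ne
  convert hx using 1
  simp; ring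

end LowerConfig

/-! ### Particle paths of state 3 when the rising shock is not cut off -/

/-- The region of the state `S₃` below the height `H`. -/
def lowerRegion (S₁ S₂ S₃ : State) (H : ℝ) : Set (ℝ × ℝ) :=
  {X | X.2 < H} ∩ lowerOuter (lowerShape S₁ S₂ S₃) S₃.vel (corner S₁ S₂ S₃) (deltaVel S₂ S₃)

/-- The region above `lowerShock` and to the right of the contact line. -/
def upperRegion (S₁ S₂ S₃ : State) : Set (ℝ × ℝ) :=
  {X | S₁.u < X.1} ∩
    lowerInner (lowerShape S₁ S₂ S₃) S₃.vel (corner S₁ S₂ S₃) (deltaVel S₂ S₃)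

theorem isOpen_lowerRegion {S₁ S₂ S₃ : State} {H : ℝ} : IsOpen (lowerRegion S₁ S₂ S₃ H) :=
  (isOpen_lt continuous_snd continuous_const).inter isOpen_lowerOuter

theorem isOpen_upperRegion {S₁ S₂ S₃ : State} : IsOpen (upperRegion S₁ S₂ S₃) :=
  (isOpen_lt continuous_const continuous_fst).inter isOpen_lowerInner

theorem subset_lowerRegion {S₁ S₂ S₃ : State} {H : ℝ} (hH : (corner S₁ S₂ S₃).2 < H) :
    {X | X.2 < (corner S₁ S₂ S₃).2} ⊆ lowerRegion S₁ S₂ S₃ H := fun X hX =>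
  ⟨show X.2 < H from lt_trans hX hH, Or.inl hX⟩

namespace Admissible
variable {S₁ S₂ S₃ : State} (h : Admissible S₁ S₂ S₃)
include h

theorem lowerShock_snd_gt {s : ℝ} (hs : s < 0) :
    (corner S₁ S₂ S₃).2 < ((lowerShock S₁ S₂ S₃).Ξ s).2 := by
  obtain ⟨hA, hC, h0⟩ := h.lowerShock_coords hs
  exact h.lowerConfig.snd_gt_of_conic hA hC h0

theorem lowerShock_snd_lt {s : ℝ} (hs : s < 0) : ((lowerShock S₁ S₂ S₃).Ξ s).2 < S₃.v := by
  obtain ⟨hA, hC, h0⟩ := h.lowerShock_coords hs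
  exact h.lowerConfig.snd_lt_of_coords hA hC.le

theorem lowerShock_fst_gt {s : ℝ} (hs : s < 0) : S₁.u < ((lowerShock S₁ S₂ S₃).Ξ s).1 :=
  h.lowerConfig.fst_gt_of_coordC (h.lowerShock_coords hs).2.1 (h.lowerShock_snd_gt hs).le

theorem lowerShock_injective : Function.Injective (lowerShock S₁ S₂ S₃).Ξ :=
  vacuumShock_Ξ_injective h.br_lower

theorem tame_lowerShock : (lowerShock S₁ S₂ S₃).Tame (Iio 0) :=
  tame_vacuumShock h.ρ₃ h.leftShock_pos.1 h.br_lower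

theorem bounded_flux_lowerShock {I : Set ℝ} (hI : I ⊆ Iic 0) : ∃ C, ∀ s ∈ I, Real.exp (-s) *
    |br S₃.vel ((lowerShock S₁ S₂ S₃).U s) ((lowerShock S₁ S₂ S₃).Ξ s)| ≤ C :=
  bounded_flux_vacuum h.ρ₃ h.leftShock_pos.1 h.br_lower hI

/-- A descending ray from `S₃.vel` with `γ < 0` stays to the left of the line through `A`, so it
crosses the height of `A` to the left of `A`. -/
theorem exists_leftShock_ray {x : ℝ × ℝ} (hx : x.2 < 0)
    (hC : coordC S₃.vel (corner S₁ S₂ S₃) (deltaVel S₂ S₃) (S₃.vel + x) < 0) :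
    ∃ s ∈ Ioi (0 : ℝ), ∃ r : ℝ, 0 < r ∧ x = r • ((leftShock S₁ S₂ S₃).Ξ s - S₃.vel) := by
  have hd := sub_pos.2 h.lowerConfig.snd_lt
  set r := (S₃.vel.2 - (corner S₁ S₂ S₃).2) / -x.2 with hr
  have hr0 : 0 < r := div_pos hd (by linarith)
  have hx0 : x.2 ≠ 0 := hx.ne
  have h2 : (S₃.vel + r • x).2 = (corner S₁ S₂ S₃).2 := by
    simp only [Prod.snd_add, Prod.smul_snd, smul_eq_mul, hr]
    field_simp
    ring
  have hC' : coordC S₃.vel (corner S₁ S₂ S₃) (deltaVel S₂ S₃) (S₃.vel + r • x) < 0 := by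
    rw [coordC_ray]; exact mul_neg_of_pos_of_neg hr0 hC
  have h1 : (S₃.vel + r • x).1 < S₁.u := by
    by_contra hcon
    rw [h.lowerConfig.coordC_neg_iff, h2, sub_self, zero_mul] at hC'
    have := mul_nonneg (show 0 ≤ (S₃.vel + r • x).1 - (corner S₁ S₂ S₃).1 from
      sub_nonneg.2 (not_lt.1 hcon)) hd.le
    linarith
  obtain ⟨s, hs, he⟩ := h.exists_leftShock h2 h1
  exact ⟨s, hs, r⁻¹, inv_pos.2 hr0, eq_smul_sub_of_eq_add_smul hr0 he⟩

theorem exists_lowerShock_ray {x : ℝ × ℝ}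
    (hA : 0 < coordA S₃.vel (corner S₁ S₂ S₃) (deltaVel S₂ S₃) (S₃.vel + x))
    (hC : 0 < coordC S₃.vel (corner S₁ S₂ S₃) (deltaVel S₂ S₃) (S₃.vel + x)) :
    ∃ s < 0, ∃ r : ℝ, 0 < r ∧ (lowerShock S₁ S₂ S₃).Ξ s = S₃.vel + r • x := by
  obtain ⟨r, hr, h0⟩ := exists_conic_ray h.lowerConfig.pos hA hC
  obtain ⟨s, hs, he⟩ := h.exists_lowerShock (by rw [coordA_ray]; exact mul_pos hr hA)
    (by rw [coordC_ray]; exact mul_pos hr hC) h0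
  exact ⟨s, hs, r, hr, he⟩

/-- The fate of a particle is read off from the coordinates of its ray: for `γ < 0` it hits the
straight shock, for `γ > 0 < α` the curved one, and for `γ > 0 ≥ α` it moves towards `S₃.vel` for
ever without being hit. Rays with `γ = 0` are negligible. -/
theorem isSweptBy_lowerRegion : IsSweptBy S₃.vel (lowerRegion S₁ S₂ S₃ S₃.v) {q | q.2 < 0}
    ![leftShock S₁ S₂ S₃, lowerShock S₁ S₂ S₃] ![Ioi 0, Iio 0] where
  tame := Fin.forall_fin_two.2 ⟨tame_straightDelta h.ρ₂ h.ρ₃ h.br_corner, h.tame_lowerShock⟩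
  bounded_flux := Fin.forall_fin_two.2 ⟨bounded_flux_right h.ρ₂ h.ρ₃ h.br_corner _,
    h.bounded_flux_lowerShock Iio_subset_Iic_self⟩
  measurableSet_region := isOpen_lowerRegion.measurableSet
  measurableSet_source := by measurability
  injective := by
    have hne : ∀ s s' : ℝ, s' < 0 →
        (leftShock S₁ S₂ S₃).Ξ s ≠ (lowerShock S₁ S₂ S₃).Ξ s' := fun s s' hs' he =>
      (h.lowerShock_snd_gt hs').ne (by rw [← he, leftShock_Ξ_snd])
    refine Fin.forall_fin_two.2 ⟨Fin.forall_fin_two.2 ⟨?_, ?_⟩, Fin.forall_fin_two.2 ⟨?_, ?_⟩⟩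
    · exact fun s s' _ _ he => ⟨rfl, straightDelta_Ξ_injective h.corner_fst_lt.ne he⟩
    · exact fun s s' _ hs' he => absurd he (hne s s' hs')
    · exact fun s s' hs _ he => absurd he.symm (hne s' s hs)
    · exact fun s s' _ _ he => ⟨rfl, h.lowerShock_injective he⟩
  source := by
    refine Fin.forall_fin_two.2 ⟨fun s hs r hr => ?_, fun s hs r hr => ?_⟩
    · refine mul_neg_of_pos_of_neg hr (sub_neg.2 ?_)
      exact (leftShock_Ξ_snd (S₁ := S₁) s).trans_lt h.lowerConfig.snd_lt
    · exact mul_neg_of_pos_of_neg hr (sub_neg.2 (h.lowerShock_snd_lt hs))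
  exit := by
    refine Fin.forall_fin_two.2 ⟨fun s hs r hr => ?_, fun s hs r hr => ?_⟩
    · exact h.lowerConfig.exit_left h.lowerConfig.snd_lt (leftShock_Ξ_snd s)
        (h.leftShock_Ξ_fst hs) hr
    · obtain ⟨hA, hC, h0⟩ := h.lowerShock_coords hs
      exact h.lowerConfig.exit_conic hA hC h0 (h.lowerShock_snd_lt hs) hr
  hit_or_stay := by
    filter_upwards [h.lowerConfig.ae_coordC_ne_zero] with x hx hQ
    rcases lt_or_gt_of_ne hx with hC | hC
    · obtain ⟨s, hs, hr⟩ := h.exists_leftShock_ray hQ hC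
      exact Or.inl ⟨0, s, hs, hr⟩
    · rcases lt_or_ge 0 (coordA S₃.vel (corner S₁ S₂ S₃) (deltaVel S₂ S₃) (S₃.vel + x)) with hA | hA
      · obtain ⟨s, hs, r, hr, he⟩ := h.exists_lowerShock_ray hA hC
        exact Or.inl ⟨1, s, hs, r⁻¹, inv_pos.2 hr, eq_smul_sub_of_eq_add_smul hr he⟩
      · refine Or.inr fun r hr => ⟨?_, h.lowerConfig.outer_ray_of_coordA_nonpos hA hC hr⟩
        have := mul_neg_of_pos_of_neg hr hQ
        simp only [mem_ofPred_eq, Prod.snd_add, Prod.smul_snd, smul_eq_mul, State.vel]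
        linarith
  not_mem := by
    refine Eventually.of_forall fun x hx r hr hD => hx ?_
    have h1 : (S₃.vel + r • x).2 < S₃.v := hD.1
    simp only [Prod.snd_add, Prod.smul_snd, smul_eq_mul, State.vel] at h1
    by_contra hc
    linarith [mul_nonneg hr.le (not_lt.1 hc)]

end Admissible

/-- In Case 9 state 1 is bounded by two contact lines only: no shock absorbs it, and its particles
just translate the quadrant. -/
theorem isSweptBy_quadrant {V : ℝ × ℝ} :
    IsSweptBy V {X | V.1 < X.1 ∧ V.2 < X.2} {q | 0 ≤ q.1 ∧ 0 ≤ q.2}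
      (fun j : Fin 0 => j.elim0) fun j => j.elim0 where
  tame j := j.elim0
  bounded_flux j := j.elim0
  measurableSet_region := by measurability
  measurableSet_source := by measurability
  injective j := j.elim0
  source j := j.elim0
  exit j := j.elim0
  hit_or_stay := by
    filter_upwards [ae_fst_ne_zero, ae_snd_ne_zero] with x h1 h2 hQ
    refine Or.inr fun r hr => ⟨?_, ?_⟩
    · have := mul_pos hr (lt_of_le_of_ne hQ.1 h1.symm)
      simpa using this
    · have := mul_pos hr (lt_of_le_of_ne hQ.2 h2.symm)
      simpa using this
  not_mem := by
    refine Eventually.of_forall fun x hx r hr hD => hx ?_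
    simp only [mem_ofPred_eq, Prod.fst_add, Prod.smul_fst, Prod.snd_add, Prod.smul_snd, smul_eq_mul,
      lt_add_iff_pos_right] at hD
    exact ⟨(pos_of_mul_pos_right hD.1 hr.le).le, (pos_of_mul_pos_right hD.2 hr.le).le⟩

theorem sum_flux_eq {n : ℕ} (φ : ℝ × ℝ × ℝ → ℝ) (V : ℝ × ℝ) (c : Fin n → DeltaCurve)
    (I : Fin n → Set ℝ) :
    (∑ j, ∫ q in paramSet (I j), (Real.exp (-(Real.log (q.2 / q.1))) *
      |br V ((c j).U (Real.log (q.2 / q.1))) ((c j).Ξ (Real.log (q.2 / q.1)))|) *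
        φ (q.1, q.1 • (c j).Ξ (Real.log (q.2 / q.1)))) = ∑ j, fluxPairing φ V (c j) (I j) := rfl

theorem mem_iUnion_fin_four {D : Fin 4 → Set (ℝ × ℝ)} {X : ℝ × ℝ} :
    X ∈ ⋃ i, D i ↔ X ∈ D 0 ∨ X ∈ D 1 ∨ X ∈ D 2 ∨ X ∈ D 3 := by
  rw [iUnion_fin_four]
  simp only [mem_union, or_assoc]

/-! ### Case 9: one exterior delta shock -/

/-- The regions when `S₁.v = S₃.v`. -/
def alignedRegions (S₁ S₂ S₃ : State) : Fin 4 → Set (ℝ × ℝ) :=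
  ![upperRegion S₁ S₂ S₃, {X | S₁.u < X.1 ∧ S₁.v < X.2}, leftRegion S₁ S₂ S₃,
    lowerRegion S₁ S₂ S₃ S₃.v]

theorem isOpen_alignedRegions {S₁ S₂ S₃ : State} (i : Fin 4) : IsOpen
    (alignedRegions S₁ S₂ S₃ i) := by
  revert i
  refine forall_fin_four isOpen_upperRegion ?_ isOpen_leftRegion isOpen_lowerRegion
  exact (isOpen_lt continuous_const continuous_fst).inter
    (isOpen_lt continuous_const continuous_snd)

theorem image_lowerShock_Icc_subset {S₁ S₂ S₃ : State} {X : ℝ × ℝ} {s₀ : ℝ}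
    (hX : X ∈ (lowerShock S₁ S₂ S₃).Ξ '' Icc s₀ 0) : X = corner S₁ S₂ S₃ ∨
      ∃ s, s₀ ≤ s ∧ s < 0 ∧ (lowerShock S₁ S₂ S₃).Ξ s = X := by
  obtain ⟨s, hs, rfl⟩ := hX
  rcases eq_or_lt_of_le hs.2 with rfl | h0
  · exact Or.inl vacuumShock_Ξ_zero
  · exact Or.inr ⟨s, hs.1, h0, rfl⟩

namespace Admissible
variable {S₁ S₂ S₃ : State} (h : Admissible S₁ S₂ S₃)
include h

theorem notMem_lowerRegion_of_leftRegion {X : ℝ × ℝ} {H : ℝ} (hX : X ∈ leftRegion S₁ S₂ S₃) :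
    X ∉ lowerRegion S₁ S₂ S₃ H := fun hX' =>
  notMem_outer_of_coordC_nonpos (le_of_lt hX.2)
    (h.lowerConfig.coordC_neg_of_fst_le (le_of_lt hX.1) hX.2).le hX'.2

theorem fst_gt_of_lowerRegion {X : ℝ × ℝ} {H : ℝ} (hX : X ∈ lowerRegion S₁ S₂ S₃ H)
    (h2 : (corner S₁ S₂ S₃).2 ≤ X.2) : S₁.u < X.1 := by
  rcases hX.2 with h3 | ⟨h3, -⟩
  · exact absurd h2 (not_le.2 h3)
  · exact h.lowerConfig.fst_gt_of_coordC h3 h2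

theorem lowerShock_notMem_inner {s : ℝ} (hs : s < 0) : (lowerShock S₁ S₂ S₃).Ξ s ∉
    lowerInner (lowerShape S₁ S₂ S₃) S₃.vel (corner S₁ S₂ S₃) (deltaVel S₂ S₃) := fun hX => by
  obtain ⟨-, hC, h0⟩ := h.lowerShock_coords hs
  rcases hX.2.2 with h1 | h1 <;> linarith

theorem lowerShock_notMem_outer {s : ℝ} (hs : s < 0) : (lowerShock S₁ S₂ S₃).Ξ s ∉
    lowerOuter (lowerShape S₁ S₂ S₃) S₃.vel (corner S₁ S₂ S₃) (deltaVel S₂ S₃) := fun hX => by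
  obtain ⟨-, hC, h0⟩ := h.lowerShock_coords hs
  rcases hX with h1 | h1
  · exact absurd (h.lowerShock_snd_gt hs) (not_lt.2 h1.le)
  · linarith [h1.2]

theorem separates_lowerShock_aligned : (lowerShock S₁ S₂ S₃).Separates (Iio 0)
    (upperRegion S₁ S₂ S₃)
    (lowerRegion S₁ S₂ S₃ S₃.v) :=
  h.separates_lowerShock Subset.rfl (isOpen_lt continuous_const continuous_fst)
    (isOpen_lt continuous_snd continuous_const) (fun _ hs => h.lowerShock_fst_gt hs)
    (fun _ hs => h.lowerShock_snd_lt hs)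

theorem disjoint_alignedRegions (hv : S₁.v = S₃.v) :
    Pairwise (Function.onFun Disjoint (alignedRegions S₁ S₂ S₃)) := by
  refine pairwise_disjoint_fin_four ?_ ?_ ?_ ?_ ?_ ?_
  · intro X hX hX'
    have h1 : X.2 < S₃.v := hX.2.2.1
    have h2 : S₁.v < X.2 := hX'.2
    linarith
  · intro X hX hX'
    exact lt_asymm (show S₁.u < X.1 from hX.1) hX'.1
  · intro X hX hX'
    exact notMem_outer_of_inner hX.2 hX'.2
  · intro X hX hX'
    exact lt_asymm (show S₁.u < X.1 from hX.1) hX'.1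
  · intro X hX hX'
    have h1 : X.2 < S₃.v := hX'.1
    have h2 : S₁.v < X.2 := hX.2
    linarith
  · intro X hX
    exact h.notMem_lowerRegion_of_leftRegion hX

theorem iUnion_alignedRegions (hv : S₁.v = S₃.v) : ⋃ i, alignedRegions S₁ S₂ S₃ i =
    ((leftShock S₁ S₂ S₃).Ξ '' Ici 0 ∪ (lowerShock S₁ S₂ S₃).Ξ '' Iic 0 ∪
      {X | X.1 = S₁.u ∧ (corner S₁ S₂ S₃).2 ≤ X.2} ∪ {X | X.2 = S₁.v ∧ S₁.u ≤ X.1})ᶜ := by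
  have hc := h.lowerConfig
  have hA : (corner S₁ S₂ S₃).2 < S₃.v := hc.snd_lt
  rw [h.image_leftShock]
  ext X
  rw [mem_iUnion_fin_four, mem_compl_iff]
  constructor
  · rintro hX (((⟨h2, h1⟩ | ⟨s, hs, rfl⟩) | ⟨h1, h2⟩) | ⟨h2, h1⟩)
    · rcases hX with hX | hX | hX | hX
      · exact absurd hX.1 (not_lt.2 h1)
      · exact absurd hX.1 (not_lt.2 h1)
      · exact hX.2.ne' h2
      · exact absurd (h.fst_gt_of_lowerRegion hX h2.ge) (not_lt.2 h1)
    · rcases eq_or_lt_of_le (mem_Iic.1 hs) with rfl | hs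
      · rw [show (lowerShock S₁ S₂ S₃).Ξ 0 = corner S₁ S₂ S₃ from vacuumShock_Ξ_zero] at hX
        rcases hX with hX | hX | hX | hX
        · exact lt_irrefl _ (show S₁.u < S₁.u from hX.1)
        · exact lt_irrefl _ (show S₁.u < S₁.u from hX.1)
        · exact lt_irrefl _ (show S₁.u < S₁.u from hX.1)
        · exact lt_irrefl _ (h.fst_gt_of_lowerRegion hX le_rfl)
      · rcases hX with hX | hX | hX | hX
        · exact h.lowerShock_notMem_inner hs hX.2
        · exact absurd (hv ▸ hX.2) (not_lt.2 (h.lowerShock_snd_lt hs).le)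
        · exact absurd hX.1 (not_lt.2 (h.lowerShock_fst_gt hs).le)
        · exact h.lowerShock_notMem_outer hs hX.2
    · rcases hX with hX | hX | hX | hX
      · exact hX.1.ne' h1
      · exact hX.1.ne' h1
      · exact hX.1.ne h1
      · exact (h.fst_gt_of_lowerRegion hX h2).ne' h1
    · rcases hX with hX | hX | hX | hX
      · exact hX.2.2.1.ne (h2.trans hv)
      · exact hX.2.ne' h2
      · exact absurd hX.1 (not_lt.2 h1)
      · exact (show X.2 < S₃.v from hX.1).ne (h2.trans hv)
  · intro hW
    simp only [mem_union, not_or, mem_ofPred_eq, not_and, not_le] at hW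
    obtain ⟨⟨⟨w1, w2⟩, w3⟩, w4⟩ := hW
    rcases lt_trichotomy X.2 (corner S₁ S₂ S₃).2 with h2 | h2 | h2
    · exact Or.inr (Or.inr (Or.inr (subset_lowerRegion hA h2)))
    · exact Or.inr (Or.inr (Or.inr ⟨h2.trans_lt hA, hc.outer_of_snd_le h2.le (w1 h2)⟩))
    · rcases lt_trichotomy X.1 S₁.u with h1 | h1 | h1
      · exact Or.inr (Or.inr (Or.inl ⟨h1, h2⟩))
      · exact absurd (w3 h1) (not_lt.2 h2.le)
      · rcases lt_trichotomy X.2 S₃.v with h3 | h3 | h3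
        · rcases hc.inner_or_conic_or_outer h2 h3 with h4 | ⟨h4, h5, h6⟩ | h4
          · exact Or.inl ⟨h1, h4⟩
          · obtain ⟨s, hs, he⟩ := h.exists_lowerShock h4 h5 h6
            exact absurd ⟨s, hs.le, he⟩ w2
          · exact Or.inr (Or.inr (Or.inr ⟨h3, h4⟩))
        · exact absurd (w4 (h3.trans hv.symm)) (not_lt.2 h1.le)
        · exact Or.inr (Or.inl ⟨h1, by rw [hv]; exact h3⟩)

theorem isWavePattern_aligned (hv : S₁.v = S₃.v) :
    IsWavePattern S₁ S₂ S₃ (patch S₁ S₂ S₃ (alignedRegions S₁ S₂ S₃)) (alignedRegions S₁ S₂ S₃)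
      ((leftShock S₁ S₂ S₃).Ξ '' Ici 0 ∪ (lowerShock S₁ S₂ S₃).Ξ '' Iic 0 ∪
        {X | X.1 = S₁.u ∧ (corner S₁ S₂ S₃).2 ≤ X.2} ∪ {X | X.2 = S₁.v ∧ S₁.u ≤ X.1}) := by
  refine ⟨isOpen_alignedRegions, h.disjoint_alignedRegions hv, h.iUnion_alignedRegions hv,
    h.lowerConfig.isConnected_inner, h.lowerConfig.isBounded_inner, fun X h1 h2 => ?_,
    fun X h1 h2 => ?_, fun X h2 => ?_, patch_values S₁ S₂ S₃ (h.disjoint_alignedRegions hv)⟩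
  · filter_upwards [eventually_lt_mul h1 S₁.u, eventually_lt_mul h2 S₁.v] with r e1 e2
    exact ⟨e1, e2⟩
  · filter_upwards [eventually_mul_lt h1 S₁.u, eventually_lt_mul h2 (corner S₁ S₂ S₃).2]
      with r e1 e2
    exact ⟨e1, e2⟩
  · filter_upwards [eventually_mul_lt h2 (corner S₁ S₂ S₃).2] with r e2
    exact subset_lowerRegion h.lowerConfig.snd_lt e2

theorem contact_left {D : Set (ℝ × ℝ)} {y : ℝ} (hD : IsOpen D) (hy : (corner S₁ S₂ S₃).2 < y)
    (hyD : (S₁.u, y) ∈ D) :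
    IsContactAt (S₁.u, y) (0, -1) S₁ S₂ ({X | S₁.u < X.1} ∩ D) (leftRegion S₁ S₂ S₃) ∧
    IsContactAt (S₁.u, y) (0, -1) vacuum S₂ ({X | S₁.u < X.1} ∩ D) (leftRegion S₁ S₂ S₃) := by
  have key : ∀ᶠ ε in 𝓝[>] (0 : ℝ), (S₁.u, y) + ε • ((1 : ℝ), (0 : ℝ)) ∈ {X | S₁.u < X.1} ∩ D ∧
      (S₁.u, y) - ε • ((1 : ℝ), (0 : ℝ)) ∈ leftRegion S₁ S₂ S₃ := by
    filter_upwards [self_mem_nhdsWithin,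
      (tendsto_add_smul_nhdsGT (S₁.u, y) (1, 0)) (hD.mem_nhds hyD)] with ε hε h1
    have hε' : 0 < ε := hε
    refine ⟨⟨?_, h1⟩, ?_, ?_⟩ <;> simp [hε', hy]
  exact ⟨isContactAt_vertical (Or.inl rfl) h.u_eq.symm key,
    isContactAt_vertical (Or.inr rfl) h.u_eq.symm key⟩

theorem contact_lower_upper {x : ℝ} (hv : S₁.v = S₃.v) (hx : S₃.u < x) :
    IsContactAt (x, S₁.v) (-1, 0) S₃ S₁ (lowerRegion S₁ S₂ S₃ S₃.v)
      {X | S₁.u < X.1 ∧ S₁.v < X.2} := by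
  have hc := h.lowerConfig
  have hd := sub_pos.2 hc.snd_lt
  have hx1 : S₁.u < x := h.u_eq.trans_lt (h.u_lt.trans hx)
  have hC : 0 < coordC S₃.vel (corner S₁ S₂ S₃) (deltaVel S₂ S₃) (x, S₁.v) := by
    have e := hc.coordC_mul (x, S₁.v)
    have e2 : (x - (corner S₁ S₂ S₃).1) * (S₃.vel.2 - (corner S₁ S₂ S₃).2) -
        (S₁.v - (corner S₁ S₂ S₃).2) * (S₃.vel.1 - (corner S₁ S₂ S₃).1) =
        (x - S₃.u) * (S₃.vel.2 - (corner S₁ S₂ S₃).2) := by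
      simp only [State.vel, hv]; ring
    simp only [e2] at e
    exact pos_of_mul_pos_left (by rw [e]; exact mul_pos (sub_pos.2 hx) hd) hc.scale_pos.le
  have hF : 0 < conic (lowerShape S₁ S₂ S₃) S₃.vel (corner S₁ S₂ S₃) (deltaVel S₂ S₃)
      (x, S₁.v) := by
    have e : ((x, S₁.v) : ℝ × ℝ).2 - (corner S₁ S₂ S₃).2 = S₃.vel.2 - (corner S₁ S₂ S₃).2 := by
      simp [State.vel, hv]
    -- At the height of `S₃.vel` one has `β = 1`, so the conic function reduces to `γ ^ 2 + 2 κ γ`.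
    rw [hc.conic_eq, e, div_self hd.ne']
    have := mul_pos hc.pos hC
    have := pow_pos hC 2
    linarith
  have hO : ((x, S₁.v) : ℝ × ℝ) ∈ lowerOuter (lowerShape S₁ S₂ S₃) S₃.vel (corner S₁ S₂ S₃)
      (deltaVel S₂ S₃) := Or.inr ⟨hC, hF⟩
  refine isContactAt_horizontal (Or.inl hv.symm) rfl ?_
  filter_upwards [self_mem_nhdsWithin,
    (tendsto_add_smul_nhdsGT (x, S₁.v) (0, -1)) (isOpen_lowerOuter.mem_nhds hO)] with ε hε h1
  have hε' : 0 < ε := hε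
  refine ⟨⟨?_, h1⟩, ?_, ?_⟩ <;> simp [hε', hv, hx1]

theorem contact_vacuum_upper {x : ℝ} (hv : S₁.v = S₃.v) (hx : S₁.u < x) (hx' : x < S₃.u) :
    IsContactAt (x, S₁.v) (-1, 0) vacuum S₁ (upperRegion S₁ S₂ S₃)
      {X | S₁.u < X.1 ∧ S₁.v < X.2} := by
  have hc := h.lowerConfig
  have hd := sub_pos.2 hc.snd_lt
  have hC : coordC S₃.vel (corner S₁ S₂ S₃) (deltaVel S₂ S₃) (x, S₁.v) < 0 := by
    rw [hc.coordC_neg_iff]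
    have := mul_lt_mul_of_pos_right (sub_lt_sub_right hx' (corner S₁ S₂ S₃).1) hd
    simp only [State.vel, hv] at this ⊢
    linarith
  have ho : IsOpen ({X : ℝ × ℝ | (corner S₁ S₂ S₃).2 < X.2} ∩
      {X | coordC S₃.vel (corner S₁ S₂ S₃) (deltaVel S₂ S₃) X < 0}) :=
    (isOpen_lt continuous_const continuous_snd).inter (isOpen_lt continuous_coordC continuous_const)
  refine isContactAt_horizontal (Or.inr rfl) rfl ?_
  filter_upwards [self_mem_nhdsWithin, (tendsto_add_smul_nhdsGT (x, S₁.v) (0, -1))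
    (ho.mem_nhds ⟨h.corner_lt, hC⟩)] with ε hε h1
  have hε' : 0 < ε := hε
  refine ⟨⟨?_, h1.1, ?_, Or.inl h1.2⟩, ?_, ?_⟩ <;> simp [hε', hv, hx, State.vel]

/-- State 2 feeds the straight shock, state 3 feeds both shocks, state 1 feeds none. The fluxes
cancel in pairs, the cone terms over `A` cancel because the curved shock starts with the quantities
of the straight one, and the initial values cancel the data. -/
theorem isDistributionalSolution_aligned (hv : S₁.v = S₃.v) :
    IsDistributionalSolution (patch S₁ S₂ S₃ (alignedRegions S₁ S₂ S₃))
      ![leftShock S₁ S₂ S₃, lowerShock S₁ S₂ S₃] ![Ici 0, Iic 0] (riemannData S₁ S₂ S₃) := by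
  intro φ hφ hc k
  obtain ⟨b1, b2⟩ := integral_bulkPairing_patch (S₁ := S₁) (S₂ := S₂) (S₃ := S₃)
    (h.disjoint_alignedRegions hv)
    (fun i => (isOpen_alignedRegions i).measurableSet) hφ hc k
  obtain ⟨i1, i2⟩ := integral_riemannData (S₁ := S₁) (S₂ := S₂) (S₃ := S₃) hφ hc k
  obtain ⟨l1, l2⟩ := integral_pairing_straightDelta h.ρ₂ h.ρ₃ h.br_corner hφ hc k
  obtain ⟨d1, d2⟩ := integral_pairing_vacuumShock_Iic (n₀ := (leftShock S₁ S₂ S₃).n 0) h.ρ₃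
    h.leftShock_pos.1 h.br_lower hφ hc k
  have s1 := (isSweptBy_quadrant (V := S₁.vel)).integral_region hφ hc
  have s2 := h.isSweptBy_leftRegion.integral_region hφ hc
  have s3 := h.isSweptBy_lowerRegion.integral_region hφ hc
  rw [sum_flux_eq] at s1 s2 s3
  rw [Fin.sum_univ_zero] at s1
  rw [Fin.sum_univ_one] at s2
  rw [Fin.sum_univ_two] at s3
  refine ⟨b1, Fin.forall_fin_two.2 ⟨l1, d1⟩, i1, ?_⟩
  rw [Fin.sum_univ_two, b2, i2]
  have t1 : ∫ p in {p : ℝ × ℝ × ℝ | 0 < p.1 ∧ p.1⁻¹ • p.2 ∈ alignedRegions S₁ S₂ S₃ 1},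
      fderiv ℝ φ p (1, S₁.vel.1, S₁.vel.2) = _ := s1
  have t2 : ∫ p in {p : ℝ × ℝ × ℝ | 0 < p.1 ∧ p.1⁻¹ • p.2 ∈ alignedRegions S₁ S₂ S₃ 2},
      fderiv ℝ φ p (1, S₂.vel.1, S₂.vel.2) = _ := s2
  have t3 : ∫ p in {p : ℝ × ℝ × ℝ | 0 < p.1 ∧ p.1⁻¹ • p.2 ∈ alignedRegions S₁ S₂ S₃ 3},
      fderiv ℝ φ p (1, S₃.vel.1, S₃.vel.2) =
        (fluxPairing φ S₃.vel (leftShock S₁ S₂ S₃) (Ioi 0) +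
          fluxPairing φ S₃.vel (lowerShock S₁ S₂ S₃) (Iio 0)) - _ := s3
  have tl : ∫ q in paramSet (![Ici 0, Iic 0] 0),
      (![leftShock S₁ S₂ S₃, lowerShock S₁ S₂ S₃] 0).pairing φ k q =
        (leftShock S₁ S₂ S₃).cons 0 k * conePairing φ (corner S₁ S₂ S₃) -
        (S₂.cons k * fluxPairing φ S₂.vel (leftShock S₁ S₂ S₃) (Ioi 0) +
          S₃.cons k * fluxPairing φ S₃.vel (leftShock S₁ S₂ S₃) (Ioi 0)) := l2
  have td : ∫ q in paramSet (![Ici 0, Iic 0] 1),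
      (![leftShock S₁ S₂ S₃, lowerShock S₁ S₂ S₃] 1).pairing φ k q =
        -((leftShock S₁ S₂ S₃).cons 0 k * conePairing φ (corner S₁ S₂ S₃)) -
          S₃.cons k * fluxPairing φ S₃.vel (lowerShock S₁ S₂ S₃) (Iio 0) := by
    have e : (lowerShock S₁ S₂ S₃).cons 0 k = (leftShock S₁ S₂ S₃).cons 0 k :=
      h.emergesAt_lowerShock.2.1 k
    rw [← e]
    exact d2
  rw [t1, t2, t3, tl, td]
  ring

theorem hasCaseNineSolution (hv : S₁.v = S₃.v) : HasCaseNineSolution S₁ S₂ S₃ := by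
  refine ⟨lowerShock S₁ S₂ S₃, alignedRegions S₁ S₂ S₃, patch S₁ S₂ S₃ (alignedRegions S₁ S₂ S₃),
    h.isDeltaShock_leftShock, h.emergesAt_lowerShock, h.isWavePattern_aligned hv,
    h.separates_leftShock (subset_lowerRegion h.lowerConfig.snd_lt), h.separates_lowerShock_aligned,
    fun y hy => ?_, fun y hy hy' => ?_, fun x hx => h.contact_lower_upper hv hx,
    fun x hx hx' => h.contact_vacuum_upper hv hx hx', h.isDistributionalSolution_aligned hv⟩
  · exact (h.contact_left (isOpen_lt continuous_const continuous_snd)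
      (h.corner_lt.trans hy) (show (S₁.u, y) ∈ {X : ℝ × ℝ | S₁.v < X.2} from hy)).1
  · exact (h.contact_left isOpen_lowerInner hy ⟨hy, hy'.trans_eq hv,
      Or.inl (h.lowerConfig.coordC_neg_of_fst_le le_rfl hy)⟩).2

end Admissible

/-! ### Geometry of the vacuum behind two shocks that meet at `B` -/

/-- The position of the point `B` of the first shock (from `A` to `V`) at which the second shock
(from `B` to `W`, with initial velocity `U'`) emerges. -/
structure MergeConfig (κ κ' : ℝ) (V A U W B U' : ℝ × ℝ) : Prop extends LowerConfig κ V A U where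
  pos' : 0 < κ'
  fst_eq : W.1 = A.1
  corner_lt : A.2 < W.2
  lt_meeting : W.2 < B.2
  coordA_pos : 0 < coordA V A U B
  coordC_pos : 0 < coordC V A U B
  conic_zero : conic κ V A U B = 0
  br_neg' : br W U' B < 0
  fst_lt_vel : W.1 < U'.1
  snd_lt_vel : B.2 < U'.2

/-- The part of the vacuum region behind the first shock, below the height of `B`. -/
def mergeInner (κ : ℝ) (V A U B : ℝ × ℝ) : Set (ℝ × ℝ) :=
  {X | A.1 < X.1} ∩ {X | X.2 < B.2} ∩ lowerInner κ V A U

/-- The interior of the branch of the conic that carries a shock. -/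
def conicInterior (κ' : ℝ) (W B U' : ℝ × ℝ) : Set (ℝ × ℝ) :=
  {X | 0 < coordA W B U' X} ∩ {X | conic κ' W B U' X < 0}

/-- The vacuum region behind two shocks, divided by the line through `W` and `B`. -/
def mergedVacuum (κ κ' : ℝ) (V A U W B U' : ℝ × ℝ) : Set (ℝ × ℝ) :=
  mergeInner κ V A U B ∩ {X | coordC W B U' X < 0} ∪
    mergeInner κ V A U B ∩ conicInterior κ' W B U' ∪
    conicInterior κ' W B U' ∩ {X | 0 < coordC W B U' X}

/-- The region ahead of the second shock and above the height of `B`. -/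
def mergedOuter (κ' : ℝ) (A W B U' : ℝ × ℝ) : Set (ℝ × ℝ) :=
  {X | A.1 < X.1} ∩ ({X | coordC W B U' X ≤ 0 ∧ X.2 ≤ B.2} ∪
    {X | 0 ≤ coordC W B U' X ∧ 0 ≤ coordA W B U' X ∧ conic κ' W B U' X ≤ 0})ᶜ

theorem isOpen_mergeInner {κ : ℝ} {V A U B : ℝ × ℝ} : IsOpen (mergeInner κ V A U B) :=
  ((isOpen_lt continuous_const continuous_fst).inter
    (isOpen_lt continuous_snd continuous_const)).inter isOpen_lowerInner

theorem isOpen_conicInterior {κ' : ℝ} {W B U' : ℝ × ℝ} : IsOpen (conicInterior κ' W B U') :=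
  (isOpen_lt continuous_const continuous_coordA).inter (isOpen_lt continuous_conic continuous_const)

theorem isOpen_mergedVacuum {κ κ' : ℝ} {V A U W B U' : ℝ × ℝ} :
    IsOpen (mergedVacuum κ κ' V A U W B U') :=
  ((isOpen_mergeInner.inter (isOpen_lt continuous_coordC continuous_const)).union
    (isOpen_mergeInner.inter isOpen_conicInterior)).union
    (isOpen_conicInterior.inter (isOpen_lt continuous_const continuous_coordC))

theorem isClosed_mergedOuter_compl {κ' : ℝ} {W B U' : ℝ × ℝ} :
    IsClosed ({X | coordC W B U' X ≤ 0 ∧ X.2 ≤ B.2} ∪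
    {X | 0 ≤ coordC W B U' X ∧ 0 ≤ coordA W B U' X ∧ conic κ' W B U' X ≤ 0}) :=
  ((isClosed_le continuous_coordC continuous_const).inter
    (isClosed_le continuous_snd continuous_const)).union
    ((isClosed_le continuous_const continuous_coordC).inter
      ((isClosed_le continuous_const continuous_coordA).inter
        (isClosed_le continuous_conic continuous_const)))

theorem isOpen_mergedOuter {κ' : ℝ} {A W B U' : ℝ × ℝ} : IsOpen (mergedOuter κ' A W B U') :=
  (isOpen_lt continuous_const continuous_fst).inter isClosed_mergedOuter_compl.isOpen_compl

theorem coordC_base {W B U' : ℝ × ℝ} : coordC W B U' B = 0 := by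
  rw [coordC, br_eq, mul_comm, sub_self, zero_div]

/-- To the right of the line `W B` the region ahead is bounded by the horizontal shock through `B`;
to its left (`mergedOuter_of_side_pos`) by the conic. On each side of the line only one of the two
descriptions matters. -/
theorem mergedOuter_of_side_neg {κ' : ℝ} {A W B U' X : ℝ × ℝ} (h1 : A.1 < X.1)
    (hC : coordC W B U' X < 0) :
    X ∈ mergedOuter κ' A W B U' ↔ B.2 < X.2 := by
  constructor
  · intro hX
    by_contra hcon
    exact hX.2 (Or.inl ⟨hC.le, not_lt.1 hcon⟩)
  · rintro h2
    refine ⟨h1, ?_⟩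
    rintro (⟨-, h3⟩ | ⟨h3, -⟩) <;> linarith

theorem mergedOuter_of_side_pos {κ' : ℝ} {A W B U' X : ℝ × ℝ} (h1 : A.1 < X.1)
    (hC : 0 < coordC W B U' X) :
    X ∈ mergedOuter κ' A W B U' ↔ 0 < coordA W B U' X → 0 < conic κ' W B U' X := by
  constructor
  · intro hX hA
    by_contra hcon
    exact hX.2 (Or.inr ⟨hC.le, hA.le, not_lt.1 hcon⟩)
  · rintro h2
    refine ⟨h1, ?_⟩
    rintro (⟨h3, -⟩ | ⟨-, h3, h4⟩)
    · linarith
    · rcases eq_or_lt_of_le h3 with h3 | h3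
      · rw [conic, ← h3] at h4
        have := pow_pos hC 2
        linarith
      · linarith [h2 h3]

namespace MergeConfig
variable {κ κ' : ℝ} {V A U W B U' X Y : ℝ × ℝ} (h : MergeConfig κ κ' V A U W B U')
include h

theorem meeting_snd_lt : B.2 < V.2 := h.snd_lt_of_coords h.coordA_pos h.coordC_pos.le

theorem corner_snd_lt : A.2 < B.2 := h.corner_lt.trans h.lt_meeting

theorem fst_lt_meeting : W.1 < B.1 :=
  h.fst_eq.trans_lt (h.fst_gt_of_coordC h.coordC_pos h.corner_snd_lt.le)

theorem side_mul (X : ℝ × ℝ) : coordC W B U' X * -br W U' B =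
    (X.2 - W.2) * (B.1 - W.1) - (X.1 - W.1) * (B.2 - W.2) := by
  rw [coordC, mul_neg, div_mul_cancel₀ _ h.br_neg'.ne, br_eq]; ring

theorem side_neg_iff : coordC W B U' X < 0 ↔
    (X.2 - W.2) * (B.1 - W.1) < (X.1 - W.1) * (B.2 - W.2) := by
  have hs : 0 < -br W U' B := neg_pos.2 h.br_neg'
  rw [← sub_neg (b := (X.1 - W.1) * (B.2 - W.2)), ← h.side_mul X]
  exact ⟨fun h1 => mul_neg_of_neg_of_pos h1 hs, fun h1 => by
    by_contra h2; linarith [mul_nonneg (not_lt.1 h2) hs.le]⟩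

theorem side_nonneg_iff : 0 ≤ coordC W B U' X ↔
    (X.1 - W.1) * (B.2 - W.2) ≤ (X.2 - W.2) * (B.1 - W.1) := by
  rw [← not_lt, ← not_lt, h.side_neg_iff]

theorem side_pos_iff : 0 < coordC W B U' X ↔
    (X.1 - W.1) * (B.2 - W.2) < (X.2 - W.2) * (B.1 - W.1) := by
  have hs : 0 < -br W U' B := neg_pos.2 h.br_neg'
  rw [← sub_pos (a := (X.2 - W.2) * (B.1 - W.1)), ← h.side_mul X]
  exact ⟨fun h1 => mul_pos h1 hs, fun h1 => pos_of_mul_pos_left h1 hs.le⟩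

theorem snd_gt_of_side (h1 : A.1 < X.1) (hC : 0 ≤ coordC W B U' X) : W.2 < X.2 := by
  rw [h.side_nonneg_iff] at hC
  rw [← h.fst_eq] at h1
  have := mul_pos (sub_pos.2 h1) (sub_pos.2 h.lt_meeting)
  have := pos_of_mul_pos_left (this.trans_le hC) (sub_pos.2 h.fst_lt_meeting).le
  linarith

theorem fst_gt_of_coords (hA : 0 < coordA W B U' X) (hC : 0 ≤ coordC W B U' X) : A.1 < X.1 := by
  rw [fst_eq_of_coords h.br_neg'.ne X, ← h.fst_eq]
  have h1 := mul_pos hA (sub_pos.2 h.fst_lt_meeting)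
  have h2 := mul_nonneg hC (sub_pos.2 h.fst_lt_vel).le
  linarith

theorem snd_gt_of_coords (hA : 0 < coordA W B U' X) (hC : 0 ≤ coordC W B U' X) : W.2 < X.2 :=
  h.snd_gt_of_side (h.fst_gt_of_coords hA hC) hC

/-- The segment from `W` to `B` stays behind the first shock up to its end on the shock. The end `W`
has `γ < 0` and `α, β > 0`, so mixing it in lowers `γ` and does not lower `α` or `β` in comparison
with `t` times the coordinates of `B`, for which the equation of the conic is homogeneous. -/
theorem chord_mem_inner {t : ℝ} (h0 : 0 ≤ t) (h1 : t < 1) :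
    (1 - t) • W + t • B ∈ lowerInner κ V A U := by
  have hW := h.coordC_neg_of_fst_le h.fst_eq.le h.corner_lt
  have hd := h.lt_meeting
  have hV := h.meeting_snd_lt
  have e2 : ((1 - t) • W + t • B).2 = W.2 + t * (B.2 - W.2) := by
    simp only [Prod.snd_add, Prod.smul_snd, smul_eq_mul]; ring
  have p1 := mul_nonneg h0 (sub_pos.2 hd).le
  have p2 := mul_le_mul_of_nonneg_right h1.le (sub_pos.2 hd).le
  have hA := h.corner_lt
  refine ⟨by rw [e2]; linarith, by rw [e2]; linarith, ?_⟩
  have eA := coordA_combo (V := V) (P := A) (U := U) (X := W) (Y := B) (sub_add_cancel 1 t)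
  have eC := coordC_combo (V := V) (P := A) (U := U) (X := W) (Y := B) (sub_add_cancel 1 t)
  rcases lt_or_ge (coordC V A U ((1 - t) • W + t • B)) 0 with hC | hC
  · exact Or.inl hC
  · right
    have b1 := h.coordB W
    have b2 := h.coordB_pos h.corner_lt
    have b3 := h.coordB_lt_one (hd.trans hV)
    have b4 := h.coordB B
    have b5 := h.coordB_pos h.corner_snd_lt
    have hB := h.conic_zero
    have hαB := h.coordA_pos
    have hγB := h.coordC_pos
    have hκ := h.pos
    have ht : 0 < 1 - t := sub_pos.2 h1
    rw [conic] at hB ⊢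
    rw [eC] at hC
    rw [eA, eC]
    rw [← b1] at b2 b3
    rw [← b4] at b5
    generalize coordA V A U W = α₁ at *
    generalize coordA V A U B = α₂ at *
    generalize coordC V A U W = γ₁ at *
    generalize coordC V A U B = γ₂ at *
    have q1 : (1 - t) * γ₁ + t * γ₂ < t * γ₂ := by linarith [mul_neg_of_pos_of_neg ht hW]
    have q2 : ((1 - t) * γ₁ + t * γ₂) ^ 2 < (t * γ₂) ^ 2 := pow_lt_pow_left₀ q1 hC two_ne_zero
    have q3 : t * α₂ ≤ (1 - t) * α₁ + t * α₂ := by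
      linarith [mul_nonneg ht.le (show 0 ≤ α₁ by linarith)]
    have q4 : t * (1 - α₂ - γ₂) ≤
        1 - ((1 - t) * α₁ + t * α₂) - ((1 - t) * γ₁ + t * γ₂) := by
      linarith [mul_nonneg ht.le b2.le]
    have q5 := mul_le_mul q3 q4 (mul_nonneg h0 b5.le)
      ((mul_nonneg h0 hαB.le).trans q3)
    have q6 := mul_le_mul_of_nonneg_left q5 (show 0 ≤ 2 * κ by positivity)
    have q7 : (t * γ₂) ^ 2 = 2 * κ * (t * α₂ * (t * (1 - α₂ - γ₂))) := by
      linear_combination t ^ 2 * hB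
    linarith

/-- The point is at most as far right as the point of the chord at its height, and the region behind
the first shock is closed under moving left. -/
theorem inner_of_side (h1 : A.1 < X.1) (hC : 0 ≤ coordC W B U' X) (h2 : X.2 < B.2) :
    X ∈ lowerInner κ V A U := by
  have hX := sub_pos.2 (h.snd_gt_of_side h1 hC)
  have hd := sub_pos.2 h.lt_meeting
  have e : (X.2 - W.2) / (B.2 - W.2) < 1 := by rw [div_lt_one hd]; linarith
  have hY := h.chord_mem_inner (div_nonneg hX.le hd.le) e
  refine h.inner_of_le hY ?_ ?_
  · simp only [Prod.snd_add, Prod.smul_snd, smul_eq_mul]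
    field_simp
    ring
  · rw [h.side_nonneg_iff, ← le_div_iff₀ hd] at hC
    simp only [Prod.fst_add, Prod.smul_fst, smul_eq_mul]
    have e3 : (X.2 - W.2) * (B.1 - W.1) / (B.2 - W.2) =
      (X.2 - W.2) / (B.2 - W.2) * (B.1 - W.1) := by ring
    rw [e3] at hC
    linarith

theorem eq_chord (h0 : coordC W B U' X = 0) :
    X = (1 - coordA W B U' X) • W + coordA W B U' X • B := by
  have e := eq_of_coords (X := X) h.br_neg'.ne
  rw [h0, zero_smul, add_zero] at e
  rw [sub_smul, one_smul, sub_add, ← smul_sub, sub_eq_add_neg, ← smul_neg, neg_sub]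
  exact e

theorem fst_chord (h0 : coordC W B U' X = 0) :
    X.1 - A.1 = coordA W B U' X * (B.1 - W.1) := by
  have e := fst_eq_of_coords h.br_neg'.ne X
  rw [h0, h.fst_eq] at e
  rw [h.fst_eq]
  linarith

theorem snd_chord (h0 : coordC W B U' X = 0) :
    B.2 - X.2 = (1 - coordA W B U' X) * (B.2 - W.2) := by
  have e := snd_eq_of_coords h.br_neg'.ne X
  rw [h0] at e
  linarith

theorem conicInterior_chord (h0 : coordC W B U' X = 0) :
    X ∈ conicInterior κ' W B U' ↔ 0 < coordA W B U' X ∧ coordA W B U' X < 1 := by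
  have hκ := h.pos'
  have e : conic κ' W B U' X = -(2 * κ' * coordA W B U' X * (1 - coordA W B U' X)) := by
    rw [conic, h0]; ring
  constructor
  · rintro ⟨h1, h2⟩
    simp only [mem_ofPred_eq] at h1 h2
    refine ⟨h1, ?_⟩
    rw [e, neg_lt_zero] at h2
    have := pos_of_mul_pos_right h2 (by positivity)
    linarith
  · rintro ⟨h1, h2⟩
    refine ⟨h1, ?_⟩
    have := sub_pos.2 h2
    simp only [mem_ofPred_eq]
    rw [e, neg_lt_zero]
    positivity

/-- On the line `W B` both descriptions of the vacuum give the open segment from `W` to `B`, so the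
two pieces fit together. -/
theorem mergeInner_chord (h0 : coordC W B U' X = 0) :
    X ∈ mergeInner κ V A U B ↔ X ∈ conicInterior κ' W B U' := by
  rw [h.conicInterior_chord h0]
  have e1 := h.fst_chord h0
  have e2 := h.snd_chord h0
  have d1 := sub_pos.2 h.fst_lt_meeting
  have d2 := sub_pos.2 h.lt_meeting
  constructor
  · rintro ⟨⟨h1, h2⟩, -⟩
    simp only [mem_ofPred_eq] at h1 h2
    rw [← sub_pos, e1] at h1
    rw [← sub_pos, e2] at h2
    exact ⟨pos_of_mul_pos_left h1 d1.le, sub_pos.1 (pos_of_mul_pos_left h2 d2.le)⟩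
  · rintro ⟨h1, h2⟩
    refine ⟨⟨?_, ?_⟩, ?_⟩
    · exact sub_pos.1 (e1 ▸ mul_pos h1 d1)
    · exact sub_pos.1 (e2 ▸ mul_pos (sub_pos.2 h2) d2)
    · rw [h.eq_chord h0]
      exact h.chord_mem_inner h1.le h2

/-- The definition is a union of open sets; this form with closed half-planes is a union of two
convex sets that share the open segment `W B`. The first form serves openness, the second
connectedness. -/
theorem mergedVacuum_eq : mergedVacuum κ κ' V A U W B U' =
    mergeInner κ V A U B ∩ {X | coordC W B U' X ≤ 0} ∪
      conicInterior κ' W B U' ∩ {X | 0 ≤ coordC W B U' X} := by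
  ext X
  rcases lt_trichotomy (coordC W B U' X) 0 with hC | hC | hC
  · simp only [mergedVacuum, mem_union, mem_inter_iff, mem_ofPred_eq, hC, hC.le, not_lt.2 hC.le,
      not_le.2 hC, and_true, and_false, or_false]
    tauto
  · have := h.mergeInner_chord hC
    simp only [mergedVacuum, mem_union, mem_inter_iff, mem_ofPred_eq, hC, le_refl, lt_irrefl,
      and_true, and_false, or_false, false_or]
    tauto
  · simp only [mergedVacuum, mem_union, mem_inter_iff, mem_ofPred_eq, hC, hC.le, not_lt.2 hC.le,
      not_le.2 hC, and_true, and_false, false_or]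
    tauto

theorem convex_mergeInner : Convex ℝ (mergeInner κ V A U B) :=
  ((convex_halfSpace_gt (f := fun X : ℝ × ℝ => X.1) (LinearMap.fst ℝ ℝ ℝ).isLinear A.1).inter
    (convex_halfSpace_lt (f := fun X : ℝ × ℝ => X.2) (LinearMap.snd ℝ ℝ ℝ).isLinear B.2)).inter
      h.convex_inner

theorem coordB_pos_of_conicInterior (hX : X ∈ conicInterior κ' W B U') :
    0 < 1 - coordA W B U' X - coordC W B U' X := by
  have h1 : 0 < coordA W B U' X := hX.1
  have h2 : conic κ' W B U' X < 0 := hX.2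
  have hκ := h.pos'
  rw [conic] at h2
  have h3 : 0 < 2 * κ' * coordA W B U' X * (1 - coordA W B U' X - coordC W B U' X) := by
    linarith [sq_nonneg (coordC W B U' X)]
  exact pos_of_mul_pos_right h3 (by positivity)

theorem conicInterior_inter_eq : conicInterior κ' W B U' ∩ {X | 0 ≤ coordC W B U' X} =
    conicRegion κ' W B U' ∩ {X | 0 ≤ coordC W B U' X} := by
  ext X
  constructor
  · rintro ⟨hX, hC⟩
    exact ⟨⟨hX.1, h.coordB_pos_of_conicInterior hX, Or.inr hX.2⟩, hC⟩
  · rintro ⟨⟨hA, hB, hX⟩, hC⟩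
    refine ⟨?_, hC⟩
    rcases hX with hX | hX
    · have h0 := le_antisymm hX hC
      rw [h.conicInterior_chord h0]
      rw [h0] at hB
      exact ⟨hA, by linarith⟩
    · exact ⟨hA, hX⟩

theorem isConnected_mergedVacuum : IsConnected (mergedVacuum κ κ' V A U W B U') := by
  rw [h.mergedVacuum_eq, h.conicInterior_inter_eq]
  have c1 := (h.convex_mergeInner.inter (convex_halfPlane_coordC (V := W) (P := B)
    (U := U')).1).isPreconnected
  have c2 := ((convex_conicRegion (V := W) (P := B) (U := U') h.pos').inter
    (convex_halfPlane_coordC (V := W) (P := B) (U := U')).2).isPreconnected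
  -- The midpoint of `W B` lies in both convex pieces.
  have hC : coordC W B U' (W + ((1 / 2 : ℝ) • (B - W) + (0 : ℝ) • (U' - W))) = 0 :=
    coordC_combination h.br_neg'.ne _ _
  have hA : coordA W B U' (W + ((1 / 2 : ℝ) • (B - W) + (0 : ℝ) • (U' - W))) = 1 / 2 :=
    coordA_combination h.br_neg'.ne _ _
  have hM : W + ((1 / 2 : ℝ) • (B - W) + (0 : ℝ) • (U' - W)) ∈ conicInterior κ' W B U' := by
    rw [h.conicInterior_chord hC, hA]; norm_num
  have hN := (h.mergeInner_chord hC).2 hM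
  have hR := h.conicInterior_inter_eq.subset ⟨hM, show 0 ≤ coordC W B U' _ from hC.ge⟩
  exact ⟨⟨_, Or.inl ⟨hN, hC.le⟩⟩, c1.union _ ⟨hN, hC.le⟩ hR c2⟩

theorem isBounded_mergedVacuum : Bornology.IsBounded (mergedVacuum κ κ' V A U W B U') := by
  rw [h.mergedVacuum_eq]
  refine Bornology.IsBounded.union ?_ ?_
  · exact (h.isBounded_inner (a := A.1)).subset fun X hX => ⟨hX.1.1.1, hX.1.2⟩
  -- In the upper piece all barycentric coordinates lie between 0 and 1, and both `B - W` and `U' -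
  -- W` have positive components, which gives the corner `B + U' - W` of the box.
  · refine (Metric.isBounded_Icc W (B + U' - W)).subset ?_
    rintro X ⟨hX, hC⟩
    have hA : 0 < coordA W B U' X := hX.1
    have hC : 0 ≤ coordC W B U' X := hC
    have hB := h.coordB_pos_of_conicInterior hX
    have d1 := sub_pos.2 h.fst_lt_meeting
    have d2 := sub_pos.2 h.lt_meeting
    have d3 := sub_pos.2 h.fst_lt_vel
    have d4 := sub_pos.2 (h.lt_meeting.trans h.snd_lt_vel)
    have e1 := fst_eq_of_coords h.br_neg'.ne X
    have e2 := snd_eq_of_coords h.br_neg'.ne X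
    have m1 := mul_le_mul_of_nonneg_right (show coordA W B U' X ≤ 1 by linarith) d1.le
    have m2 := mul_le_mul_of_nonneg_right (show coordA W B U' X ≤ 1 by linarith) d2.le
    have m3 := mul_le_mul_of_nonneg_right (show coordC W B U' X ≤ 1 by linarith) d3.le
    have m4 := mul_le_mul_of_nonneg_right (show coordC W B U' X ≤ 1 by linarith) d4.le
    refine ⟨⟨h.fst_eq ▸ (h.fst_gt_of_coords hA hC).le, (h.snd_gt_of_coords hA hC).le⟩, ?_, ?_⟩
    · simp only [Prod.fst_add, Prod.fst_sub]; linarith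
    · simp only [Prod.snd_add, Prod.snd_sub]; linarith

theorem coordA_meeting : coordA W B U' B = 1 := by
  rw [coordA, div_self h.br_neg'.ne]

theorem meeting_notMem_conicInterior : B ∉ conicInterior κ' W B U' := fun hB => by
  have := ((h.conicInterior_chord coordC_base).1 hB).2
  rw [h.coordA_meeting] at this
  exact lt_irrefl _ this

theorem fst_gt_of_mergedVacuum (hX : X ∈ mergedVacuum κ κ' V A U W B U') : A.1 < X.1 := by
  rw [h.mergedVacuum_eq] at hX
  rcases hX with ⟨hX, -⟩ | ⟨hX, hC⟩
  · exact hX.1.1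
  · exact h.fst_gt_of_coords hX.1 hC

theorem mergedVacuum_notMem_mergedOuter (hX : X ∈ mergedVacuum κ κ' V A U W B U') :
    X ∉ mergedOuter κ' A W B U' := fun hX' => hX'.2 (by
  rw [h.mergedVacuum_eq] at hX
  rcases hX with ⟨hX, hC⟩ | ⟨hX, hC⟩
  · exact Or.inl ⟨hC, le_of_lt hX.1.2⟩
  · exact Or.inr ⟨hC, le_of_lt hX.1, le_of_lt hX.2⟩)

theorem mergedVacuum_notMem_outer (hX : X ∈ mergedVacuum κ κ' V A U W B U') (h2 : X.2 < B.2) :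
    X ∉ lowerOuter κ V A U := by
  have h1 := h.fst_gt_of_mergedVacuum hX
  rw [h.mergedVacuum_eq] at hX
  rcases hX with ⟨hX, -⟩ | ⟨hX, hC⟩
  · exact notMem_outer_of_inner hX.2
  · exact notMem_outer_of_inner (h.inner_of_side h1 hC h2)

theorem mergedOuter_notMem_outer (hX : X ∈ mergedOuter κ' A W B U') (h2 : X.2 < B.2) :
    X ∉ lowerOuter κ V A U := by
  rcases le_or_gt (coordC W B U' X) 0 with hC | hC
  · exact absurd (Or.inl ⟨hC, h2.le⟩) hX.2
  · exact notMem_outer_of_inner (h.inner_of_side hX.1 hC.le h2)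

theorem side_neg_of_conic (hC : 0 < coordC V A U X) (h0 : conic κ V A U X = 0)
    (h1 : A.1 < X.1) (h2 : X.2 < B.2) : coordC W B U' X < 0 := by
  by_contra hcon
  have := (h.inner_of_side h1 (not_lt.1 hcon) h2).2.2
  rcases this with h3 | h3 <;> linarith

theorem side_of_snd_eq (h2 : X.2 = B.2) : coordC W B U' X < 0 ↔ B.1 < X.1 := by
  rw [h.side_neg_iff, h2, mul_comm]
  have hd := sub_pos.2 h.lt_meeting
  constructor
  · intro h3
    have := lt_of_mul_lt_mul_right h3 hd.le
    linarith
  · intro h3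
    exact mul_lt_mul_of_pos_right (by linarith) hd

/-- The conic function vanishes at `B` and is strictly monotone to the right along its height, so
the first conic leaves exactly the points right of `B` ahead of it. -/
theorem outer_iff_of_snd_eq (h2 : X.2 = B.2) :
    (0 < coordC V A U X ∧ 0 < conic κ V A U X) ↔ B.1 < X.1 := by
  constructor
  · rintro ⟨hC, hF⟩
    by_contra hcon
    have := h.conic_le h2 (by rw [h2]; exact h.corner_snd_lt.le) hC.le (not_lt.1 hcon)
    linarith [h.conic_zero]
  · intro h1
    have e1 := h.coordC_lt h2.symm h1
    have e2 := h.conic_lt h2.symm h.corner_snd_lt.le h.coordC_pos.le h1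
    have := h.conic_zero
    have := h.coordC_pos
    constructor <;> linarith

theorem ae_side_ne_zero : ∀ᵐ x : ℝ × ℝ, coordC W B U' (W + x) ≠ 0 := by
  have h1 := sub_pos.2 h.lt_meeting
  filter_upwards [ae_linear_ne_zero (a := B.2 - W.2) (b := W.1 - B.1) (Or.inl h1.ne')] with x hx
  rw [coordC, br_eq]
  refine div_ne_zero ?_ h.br_neg'.ne
  convert hx using 1
  simp; ring

end MergeConfig

/-! ### Inelastic merging, and the direction of a vacuum shock -/

theorem conserved_smul (c m : ℝ) (U : ℝ × ℝ) (n : ℝ) (k : Fin 4) :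
    conserved (c * m) U (c * n) k = c * conserved m U n k := by
  revert k
  refine forall_fin_four ?_ ?_ ?_ ?_ <;> simp only [conserved_zero, conserved_one, conserved_two,
    conserved_three] <;> ring

/-- The sum of two concentrated masses, with their momenta and energies. -/
theorem conserved_merge {ma mb : ℝ} (hm : ma + mb ≠ 0) (Ua Ub : ℝ × ℝ) (na nb : ℝ) (k : Fin 4) :
    conserved (ma + mb) ((ma + mb)⁻¹ • (ma • Ua + mb • Ub))
      (na + nb + ma * mb / (2 * (ma + mb)) * ((Ua.1 - Ub.1) ^ 2 + (Ua.2 - Ub.2) ^ 2)) k =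
    conserved ma Ua na k + conserved mb Ub nb k := by
  revert k
  refine forall_fin_four rfl ?_ ?_ ?_
  · simp only [conserved_one, Prod.smul_fst, Prod.fst_add, smul_eq_mul]
    field_simp
  · simp only [conserved_two, Prod.smul_snd, Prod.snd_add, smul_eq_mul]
    field_simp
  · simp only [conserved_three, Prod.smul_fst, Prod.smul_snd, Prod.fst_add, Prod.snd_add,
      smul_eq_mul]
    field_simp
    ring

theorem exists_deltaVel_eq {L R : State} (hL : 0 < L.ρ) (hR : 0 < R.ρ) :
    ∃ w : ℝ, 0 < w ∧ deltaVel L R = (1 - w) • L.vel + w • R.vel := by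
  have h1 := Real.sqrt_pos.2 hL
  have h2 := Real.sqrt_pos.2 hR
  refine ⟨√R.ρ / (√L.ρ + √R.ρ), by positivity, ?_⟩
  have e : 1 - √R.ρ / (√L.ρ + √R.ρ) = (√L.ρ + √R.ρ)⁻¹ * √L.ρ := by field_simp; ring
  rw [e, div_eq_inv_mul, deltaVel, smul_add, smul_smul, smul_smul]

section
variable {R : State} {P U₀ : ℝ × ℝ} {m₀ n₀ s : ℝ}

theorem vacuumShock_U_eq : (vacuumShock R P U₀ m₀ n₀).U s =
    (1 - (shockRatio (shockShape R P U₀ m₀) s)⁻¹) • R.vel +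
      (shockRatio (shockShape R P U₀ m₀) s)⁻¹ • U₀ := by
  simp only [vacuumShock]
  module

/-- The velocity lies on the tangent at `Ξ`, and the strictly convex curve leaves its starting point
on one side of that tangent. -/
theorem br_start_vacuumShock_neg (hρ : 0 < R.ρ) (hm : 0 < m₀) (hb : br R.vel U₀ P < 0)
    (hs : s < 0) :
    br P ((vacuumShock R P U₀ m₀ n₀).U s) ((vacuumShock R P U₀ m₀ n₀).Ξ s) < 0 := by
  have hκ := shockShape_pos hρ hm hb
  have h1 := one_lt_shockRatio hκ hs
  have h2 := exp_mul_shockRatio hκ hs.le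
  have hE := Real.exp_pos s
  have e : br P ((vacuumShock R P U₀ m₀ n₀).U s) ((vacuumShock R P U₀ m₀ n₀).Ξ s) =
      br R.vel U₀ P * (Real.exp s * (shockShape R P U₀ m₀ *
        (shockRatio (shockShape R P U₀ m₀) s - 1) ^ 2 /
          (2 * shockRatio (shockShape R P U₀ m₀) s))) := by
    simp only [br_eq, vacuumShock, Prod.fst_add, Prod.snd_add, Prod.smul_fst, Prod.smul_snd,
      Prod.fst_sub, Prod.snd_sub, smul_eq_mul]
    generalize shockShape R P U₀ m₀ = κ at *
    generalize shockRatio κ s = r at *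
    generalize Real.exp s = E at *
    have hr : r ≠ 0 := by linarith
    field_simp
    linear_combination (2 * ((U₀.1 - R.vel.1) * (P.2 - R.vel.2) -
      (U₀.2 - R.vel.2) * (P.1 - R.vel.1))) * h2
  rw [e]
  have h3 : 0 < shockRatio (shockShape R P U₀ m₀) s - 1 := by linarith
  have h4 : 0 < shockRatio (shockShape R P U₀ m₀) s := by linarith
  exact mul_neg_of_neg_of_pos hb (by positivity)

/-- The shock keeps rising: its next direction `U - Ξ` points upwards. -/
theorem vacuumShock_snd_lt (hρ : 0 < R.ρ) (hm : 0 < m₀) (hb : br R.vel U₀ P < 0)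
    (hP : U₀.2 = P.2) (hV : P.2 < R.vel.2) (hs : s < 0) :
    ((vacuumShock R P U₀ m₀ n₀).Ξ s).2 < ((vacuumShock R P U₀ m₀ n₀).U s).2 := by
  have hκ := shockShape_pos hρ hm hb
  have h1 := one_lt_shockRatio hκ hs
  have h2 := exp_mul_shockRatio hκ hs.le
  have hE := Real.exp_pos s
  simp only [vacuumShock, Prod.snd_add, Prod.smul_snd, Prod.snd_sub, smul_eq_mul, hP]
  generalize shockShape R P U₀ m₀ = κ at *
  generalize shockRatio κ s = r at *
  generalize Real.exp s = E at *
  have hr : 0 < r := by linarith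
  have hr1 : 0 < r - 1 := by linarith
  have h3 : r⁻¹ < E * (1 + κ * (r - 1)) := by
    rw [inv_lt_iff_one_lt_mul₀ hr]
    -- This is `E r (1 + κ (r - 1)) - 1`, with `1` expressed by `h2`.
    have : 0 < E * ((r - 1) + κ * (r - 1) ^ 2 / 2) := by positivity
    linarith
  linarith [mul_lt_mul_of_pos_right h3 (sub_pos.2 hV)]

end

/-! ### The collision of the rising shock with the shock from the right -/

/-- The delta shock between `S₃` and `S₁` from infinity to the point of `lowerShock` with parameter
`s`. -/
noncomputable def rightShock (S₁ S₂ S₃ : State) (s : ℝ) : DeltaCurve :=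
  straightDelta S₃ S₁ ((lowerShock S₁ S₂ S₃).Ξ s)

/-- The factor `exp s` passes from the label of `lowerShock` to that of the new parametrization,
which has its origin at the collision. -/
noncomputable def mergedMass (S₁ S₂ S₃ : State) (s : ℝ) : ℝ :=
  Real.exp s * (lowerShock S₁ S₂ S₃).m s + (rightShock S₁ S₂ S₃ s).m 0

noncomputable def mergedVel (S₁ S₂ S₃ : State) (s : ℝ) : ℝ × ℝ :=
  (mergedMass S₁ S₂ S₃ s)⁻¹ • ((Real.exp s * (lowerShock S₁ S₂ S₃).m s) •
    (lowerShock S₁ S₂ S₃).U s + (rightShock S₁ S₂ S₃ s).m 0 • deltaVel S₃ S₁)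

/-- The last summand is the kinetic energy lost in the inelastic collision; conservation of total
energy turns it into internal energy. -/
noncomputable def mergedEnergy (S₁ S₂ S₃ : State) (s : ℝ) : ℝ :=
  Real.exp s * (lowerShock S₁ S₂ S₃).n s + (rightShock S₁ S₂ S₃ s).n 0 +
    (Real.exp s * (lowerShock S₁ S₂ S₃).m s) * (rightShock S₁ S₂ S₃ s).m 0 /
      (2 * mergedMass S₁ S₂ S₃ s) *
      ((((lowerShock S₁ S₂ S₃).U s).1 - (deltaVel S₃ S₁).1) ^ 2 +
        (((lowerShock S₁ S₂ S₃).U s).2 - (deltaVel S₃ S₁).2) ^ 2)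

/-- The delta shock between vacuum and `S₁` that emerges from the collision of `lowerShock` and
`rightShock`. -/
noncomputable def upperShock (S₁ S₂ S₃ : State) (s : ℝ) : DeltaCurve :=
  vacuumShock S₁ ((lowerShock S₁ S₂ S₃).Ξ s) (mergedVel S₁ S₂ S₃ s) (mergedMass S₁ S₂ S₃ s)
    (mergedEnergy S₁ S₂ S₃ s)

/-- The shape parameter of `upperShock`. -/
noncomputable def upperShape (S₁ S₂ S₃ : State) (s : ℝ) : ℝ :=
  shockShape S₁ ((lowerShock S₁ S₂ S₃).Ξ s) (mergedVel S₁ S₂ S₃ s) (mergedMass S₁ S₂ S₃ s)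

/-- The delta shocks `lowerShock` and `rightShock` meet at the parameter `s`. -/
structure Meets (S₁ S₂ S₃ : State) (s : ℝ) : Prop extends Admissible S₁ S₂ S₃ where
  v_lt_v : S₁.v < S₃.v
  neg : s < 0
  meet : ((lowerShock S₁ S₂ S₃).Ξ s).2 = (deltaVel S₃ S₁).2

namespace Admissible
variable {S₁ S₂ S₃ : State} (h : Admissible S₁ S₂ S₃)
include h

theorem strictAntiOn_lowerShock_snd :
    StrictAntiOn (fun s => ((lowerShock S₁ S₂ S₃).Ξ s).2) (Iic 0) := by
  have hd : ∀ s ≤ (0 : ℝ), HasDerivAt (fun s => ((lowerShock S₁ S₂ S₃).Ξ s).2)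
      ((lowerShock S₁ S₂ S₃).Ξ s - (lowerShock S₁ S₂ S₃).U s).2 s := fun s hs =>
    (hasDerivAt_vacuumShock_Ξ h.ρ₃ h.leftShock_pos.1 h.br_lower hs).snd
  refine strictAntiOn_of_deriv_neg (convex_Iic 0)
    (fun s hs => (hd s hs).continuousAt.continuousWithinAt) fun s hs => ?_
  rw [interior_Iic] at hs
  rw [(hd s (le_of_lt hs)).deriv, Prod.snd_sub]
  exact sub_neg.2 (vacuumShock_snd_lt h.ρ₃ h.leftShock_pos.1 h.br_lower rfl
    h.lowerConfig.snd_lt hs)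

/-- The height starts at `v_δ²³ < v₁ < v_δ³¹` and tends to `v₃ > v_δ³¹`, so it takes the value
`v_δ³¹` in between. By `strictAntiOn_lowerShock_snd` it does so only once. -/
theorem exists_meets (hv : S₁.v < S₃.v) : ∃ s, Meets S₁ S₂ S₃ s := by
  have hH := deltaVel_snd_mem h.ρ₁ h.ρ₃ hv
  rw [deltaVel_comm] at hH
  have ht : Tendsto (fun s => ((lowerShock S₁ S₂ S₃).Ξ s).2) atBot (𝓝 S₃.vel.2) := by
    have := h.emergesAt_lowerShock.2.2.2.1
    exact ((continuous_snd.comp (continuous_snd.comp (continuous_snd.comp continuous_snd))).tendsto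
      _).comp this
  obtain ⟨s₀, h1, h2⟩ := ((ht.eventually_const_lt hH.2).and (eventually_lt_atBot 0)).exists
  have hc : ContinuousOn (fun s => ((lowerShock S₁ S₂ S₃).Ξ s).2) (Icc s₀ 0) := fun s hs =>
    (continuous_snd.continuousAt.comp (hasDerivAt_vacuumShock_Ξ h.ρ₃ h.leftShock_pos.1 h.br_lower
      hs.2).continuousAt).continuousWithinAt
  have h0 : ((lowerShock S₁ S₂ S₃).Ξ 0).2 < (deltaVel S₃ S₁).2 := by
    rw [show (lowerShock S₁ S₂ S₃).Ξ 0 = corner S₁ S₂ S₃ from vacuumShock_Ξ_zero]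
    exact h.corner_lt.trans hH.1
  obtain ⟨s, hs, he⟩ := intermediate_value_Icc' h2.le hc ⟨h0.le, h1.le⟩
  refine ⟨s, h, hv, lt_of_le_of_ne hs.2 ?_, he⟩
  rintro rfl
  exact h0.ne he

end Admissible

namespace Meets
variable {S₁ S₂ S₃ : State} {s : ℝ} (h : Meets S₁ S₂ S₃ s)
include h

theorem lt_height : S₁.v < (deltaVel S₃ S₁).2 := by
  rw [deltaVel_comm]; exact (deltaVel_snd_mem h.ρ₁ h.ρ₃ h.v_lt_v).1

theorem u_lt_u : S₁.u < S₃.u := h.u_eq.trans_lt h.u_lt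

/-- The line through the corner and `S₃.vel` separates the two points. The velocity `U_δ³¹` is a
mixture of `S₃.vel`, on that line, and `S₁.vel`, strictly left of it, while the rising shock is
strictly right of it. At equal heights `coordC` orders points from left to right. -/
theorem deltaVel_fst_lt : (deltaVel S₃ S₁).1 < ((lowerShock S₁ S₂ S₃).Ξ s).1 := by
  have hc := h.lowerConfig
  have hB := (h.lowerShock_coords h.neg).2.1
  have hW : coordC S₃.vel (corner S₁ S₂ S₃) (deltaVel S₂ S₃) S₁.vel < 0 :=
    hc.coordC_neg_of_fst_le le_rfl h.corner_lt
  obtain ⟨w, hw, e⟩ := exists_deltaVel_eq h.ρ₃ h.ρ₁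
  have hC : coordC S₃.vel (corner S₁ S₂ S₃) (deltaVel S₂ S₃) (deltaVel S₃ S₁) < 0 := by
    rw [e, coordC_combo (sub_add_cancel 1 w)]
    have : coordC S₃.vel (corner S₁ S₂ S₃) (deltaVel S₂ S₃) S₃.vel = 0 := by
      simp [coordC, br_eq]
    rw [this, mul_zero, zero_add]
    exact mul_neg_of_pos_of_neg hw hW
  by_contra hcon
  have := hc.coordC_le h.meet (not_lt.1 hcon)
  linarith

theorem br_right : 0 < br S₃.vel S₁.vel ((lowerShock S₁ S₂ S₃).Ξ s) := by
  obtain ⟨w, hw, e⟩ := exists_deltaVel_eq h.ρ₃ h.ρ₁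
  have e1 : (deltaVel S₃ S₁).1 = (1 - w) * S₃.u + w * S₁.u := by rw [e]; rfl
  have e2 : (deltaVel S₃ S₁).2 = (1 - w) * S₃.v + w * S₁.v := by rw [e]; rfl
  have e3 : br S₃.vel S₁.vel ((lowerShock S₁ S₂ S₃).Ξ s) =
      (S₃.v - S₁.v) * (((lowerShock S₁ S₂ S₃).Ξ s).1 - (deltaVel S₃ S₁).1) := by
    rw [br_eq, h.meet, e1, e2]; simp only [State.vel]; ring
  rw [e3]
  exact mul_pos (sub_pos.2 h.v_lt_v) (sub_pos.2 h.deltaVel_fst_lt)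

theorem rightShock_pos : 0 < (rightShock S₁ S₂ S₃ s).m 0 ∧ 0 < (rightShock S₁ S₂ S₃ s).n 0 :=
  straightDelta_pos h.ρ₃ h.ρ₁ h.H₃ h.H₁ h.br_right 0

theorem lowerShock_pos : 0 < (lowerShock S₁ S₂ S₃).m s ∧ 0 < (lowerShock S₁ S₂ S₃).n s :=
  h.emergesAt_lowerShock.2.2.1.1 s h.neg.le

theorem mergedMass_pos : 0 < mergedMass S₁ S₂ S₃ s :=
  add_pos (mul_pos (Real.exp_pos s) h.lowerShock_pos.1) h.rightShock_pos.1

theorem mergedEnergy_pos : 0 < mergedEnergy S₁ S₂ S₃ s := by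
  have h1 := h.lowerShock_pos
  have h2 := h.rightShock_pos
  have h3 := h.mergedMass_pos
  have h4 := Real.exp_pos s
  rw [mergedEnergy]
  have h5 : 0 < Real.exp s * (lowerShock S₁ S₂ S₃).n s := mul_pos h4 h1.2
  have h6 : 0 < Real.exp s * (lowerShock S₁ S₂ S₃).m s := mul_pos h4 h1.1
  have h7 := mul_nonneg (div_pos (mul_pos h6 h2.1) (mul_pos two_pos h3)).le
    (add_nonneg (sq_nonneg (((lowerShock S₁ S₂ S₃).U s).1 - (deltaVel S₃ S₁).1))
      (sq_nonneg (((lowerShock S₁ S₂ S₃).U s).2 - (deltaVel S₃ S₁).2)))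
  linarith [h2.2]

theorem upperShock_cons (k : Fin 4) : (upperShock S₁ S₂ S₃ s).cons 0 k =
    Real.exp s * (lowerShock S₁ S₂ S₃).cons s k + (rightShock S₁ S₂ S₃ s).cons 0 k := by
  simp only [DeltaCurve.cons, upperShock, vacuumShock_m_zero, vacuumShock_U_zero,
    vacuumShock_n_zero]
  rw [← conserved_smul]
  exact conserved_merge h.mergedMass_pos.ne' _ _ _ _ k

/-- The weights of the convex combination `mergedVel`. -/
theorem exists_mergedVel_eq : ∃ w : ℝ, 0 < w ∧ 0 < 1 - w ∧
    mergedVel S₁ S₂ S₃ s = (1 - w) • (lowerShock S₁ S₂ S₃).U s + w • deltaVel S₃ S₁ := by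
  have hM := h.mergedMass_pos
  have h1 := h.rightShock_pos.1
  have h2 := mul_pos (Real.exp_pos s) h.lowerShock_pos.1
  have e : 1 - (rightShock S₁ S₂ S₃ s).m 0 / mergedMass S₁ S₂ S₃ s =
      (mergedMass S₁ S₂ S₃ s)⁻¹ * (Real.exp s * (lowerShock S₁ S₂ S₃).m s) := by
    rw [inv_mul_eq_div, eq_div_iff hM.ne', sub_mul, div_mul_cancel₀ _ hM.ne', mergedMass]; ring
  refine ⟨(rightShock S₁ S₂ S₃ s).m 0 / mergedMass S₁ S₂ S₃ s, div_pos h1 hM, ?_, ?_⟩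
  · rw [e]; exact mul_pos (inv_pos.2 hM) h2
  · rw [e, mergedVel, smul_add, smul_smul, smul_smul, inv_mul_eq_div
      (b := (rightShock _ _ _ _).m 0)]

theorem snd_lt_vel : ((lowerShock S₁ S₂ S₃).Ξ s).2 < ((lowerShock S₁ S₂ S₃).U s).2 :=
  vacuumShock_snd_lt h.ρ₃ h.leftShock_pos.1 h.br_lower rfl h.lowerConfig.snd_lt h.neg

theorem fst_lt_vel : S₁.u < ((lowerShock S₁ S₂ S₃).U s).1 := by
  have h1 := one_lt_shockRatio h.lowerConfig.pos h.neg
  have h2 : S₁.u < (deltaVel S₂ S₃).1 := h.lowerConfig.fst_lt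
  have h3 := h.u_lt_u
  have e : ((lowerShock S₁ S₂ S₃).U s).1 = (1 - (shockRatio (lowerShape S₁ S₂ S₃) s)⁻¹) * S₃.u +
      (shockRatio (lowerShape S₁ S₂ S₃) s)⁻¹ * (deltaVel S₂ S₃).1 := by
    rw [lowerShock, vacuumShock_U_eq]; rfl
  rw [e]
  have h4 : 0 < (shockRatio (lowerShape S₁ S₂ S₃) s)⁻¹ := inv_pos.2 (by linarith)
  have h5 : 0 < 1 - (shockRatio (lowerShape S₁ S₂ S₃) s)⁻¹ := sub_pos.2 (inv_lt_one_of_one_lt₀ h1)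
  linarith [mul_lt_mul_of_pos_left h2 h4, mul_lt_mul_of_pos_left h3 h5]

/-- The entropy condition of the new shock. The determinant is affine in the velocity, and the
merged velocity is a convex combination of the two incoming ones, so it suffices to check both. -/
theorem br_upper : br S₁.vel (mergedVel S₁ S₂ S₃ s) ((lowerShock S₁ S₂ S₃).Ξ s) < 0 := by
  obtain ⟨w, hw, hw', e⟩ := h.exists_mergedVel_eq
  have b1 : br S₁.vel (deltaVel S₃ S₁) ((lowerShock S₁ S₂ S₃).Ξ s) < 0 := by
    have e1 : br S₁.vel (deltaVel S₃ S₁) ((lowerShock S₁ S₂ S₃).Ξ s) =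
        ((deltaVel S₃ S₁).2 - S₁.v) *
          ((deltaVel S₃ S₁).1 - ((lowerShock S₁ S₂ S₃).Ξ s).1) := by
      rw [br_eq, h.meet]; simp only [State.vel]; ring
    rw [e1]
    exact mul_neg_of_pos_of_neg (sub_pos.2 h.lt_height) (sub_neg.2 h.deltaVel_fst_lt)
  have b2 : br S₁.vel ((lowerShock S₁ S₂ S₃).U s) ((lowerShock S₁ S₂ S₃).Ξ s) < 0 := by
    have c1 : br (corner S₁ S₂ S₃) ((lowerShock S₁ S₂ S₃).U s) ((lowerShock S₁ S₂ S₃).Ξ s) < 0 :=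
      br_start_vacuumShock_neg h.ρ₃ h.leftShock_pos.1 h.br_lower h.neg
    have c2 := mul_pos (sub_pos.2 h.snd_lt_vel) (sub_pos.2 (h.lowerShock_fst_gt h.neg))
    have d1 := sub_pos.2 h.corner_lt
    have d2 := sub_pos.2 (h.lt_height.trans_eq h.meet.symm)
    -- `S₁.vel` lies on the contact line between the corner and the point at the height of the
    -- collision. The determinant is affine in its first argument and negative at both of these
    -- points.
    have c3 : (((lowerShock S₁ S₂ S₃).Ξ s).2 - (corner S₁ S₂ S₃).2) *
        br S₁.vel ((lowerShock S₁ S₂ S₃).U s) ((lowerShock S₁ S₂ S₃).Ξ s) =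
        (((lowerShock S₁ S₂ S₃).Ξ s).2 - S₁.v) *
          br (corner S₁ S₂ S₃) ((lowerShock S₁ S₂ S₃).U s) ((lowerShock S₁ S₂ S₃).Ξ s) -
        (S₁.v - (corner S₁ S₂ S₃).2) *
          ((((lowerShock S₁ S₂ S₃).U s).2 - ((lowerShock S₁ S₂ S₃).Ξ s).2) *
            (((lowerShock S₁ S₂ S₃).Ξ s).1 - S₁.u)) := by
      simp only [br_eq, State.vel, corner]; ring
    have d3 : 0 < ((lowerShock S₁ S₂ S₃).Ξ s).2 - (corner S₁ S₂ S₃).2 :=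
      sub_pos.2 (h.lowerShock_snd_gt h.neg)
    have c4 := mul_neg_of_pos_of_neg d2 c1
    have c5 := mul_pos (sub_pos.2 (show (corner S₁ S₂ S₃).2 < S₁.v from h.corner_lt)) c2
    by_contra hcon
    have := mul_nonneg d3.le (not_lt.1 hcon)
    linarith
  have e2 : br S₁.vel (mergedVel S₁ S₂ S₃ s) ((lowerShock S₁ S₂ S₃).Ξ s) =
      (1 - w) * br S₁.vel ((lowerShock S₁ S₂ S₃).U s) ((lowerShock S₁ S₂ S₃).Ξ s) +
        w * br S₁.vel (deltaVel S₃ S₁) ((lowerShock S₁ S₂ S₃).Ξ s) := by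
    simp only [e, br_eq, Prod.fst_add, Prod.snd_add, Prod.smul_fst, Prod.smul_snd, smul_eq_mul]
    ring
  rw [e2]
  linarith [mul_neg_of_pos_of_neg hw b1, mul_neg_of_pos_of_neg hw' b2]

theorem mergeConfig : MergeConfig (lowerShape S₁ S₂ S₃) (upperShape S₁ S₂ S₃ s) S₃.vel
    (corner S₁ S₂ S₃) (deltaVel S₂ S₃) S₁.vel ((lowerShock S₁ S₂ S₃).Ξ s)
    (mergedVel S₁ S₂ S₃ s) where
  toLowerConfig := h.lowerConfig
  pos' := shockShape_pos h.ρ₁ h.mergedMass_pos h.br_upper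
  fst_eq := rfl
  corner_lt := h.corner_lt
  lt_meeting := h.lt_height.trans_eq h.meet.symm
  coordA_pos := (h.lowerShock_coords h.neg).1
  coordC_pos := (h.lowerShock_coords h.neg).2.1
  conic_zero := (h.lowerShock_coords h.neg).2.2
  br_neg' := h.br_upper
  fst_lt_vel := by
    obtain ⟨w, hw, hw', e⟩ := h.exists_mergedVel_eq
    have h1 := h.fst_lt_vel
    have h2 : S₁.u < (deltaVel S₃ S₁).1 := by
      rw [deltaVel_comm]; exact (deltaVel_fst_mem h.ρ₁ h.ρ₃ h.u_lt_u).1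
    rw [e]
    simp only [Prod.fst_add, Prod.smul_fst, smul_eq_mul, State.vel]
    linarith [mul_lt_mul_of_pos_left h1 hw', mul_lt_mul_of_pos_left h2 hw]
  snd_lt_vel := by
    obtain ⟨w, hw, hw', e⟩ := h.exists_mergedVel_eq
    have h1 := h.snd_lt_vel
    rw [h.meet] at h1 ⊢
    rw [e]
    simp only [Prod.snd_add, Prod.smul_snd, smul_eq_mul]
    linarith [mul_lt_mul_of_pos_left h1 hw']

theorem isDeltaShock_rightShock : IsDeltaShock S₃ S₁ (rightShock S₁ S₂ S₃ s) (Ici 0) :=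
  isDeltaShock_straightDelta h.ρ₃ h.ρ₁ h.H₃ h.H₁ h.br_right _

theorem isDeltaShock_upperShock : IsDeltaShock vacuum S₁ (upperShock S₁ S₂ S₃ s) (Iic 0) :=
  isDeltaShock_vacuumShock h.ρ₁ h.H₁ h.mergedMass_pos h.mergedEnergy_pos h.br_upper

theorem upperShock_behaviour : VacuumShockBehaviour S₁ (upperShock S₁ S₂ S₃ s) :=
  vacuumShockBehaviour h.ρ₁ h.mergedMass_pos h.br_upper

end Meets

/-! ### Case 5: the regions and waves after the collision -/

/-- The regions when two delta shocks collide. -/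
def collisionRegions (S₁ S₂ S₃ : State) (s : ℝ) : Fin 4 → Set (ℝ × ℝ) :=
  ![mergedVacuum (lowerShape S₁ S₂ S₃) (upperShape S₁ S₂ S₃ s) S₃.vel (corner S₁ S₂ S₃)
      (deltaVel S₂ S₃) S₁.vel ((lowerShock S₁ S₂ S₃).Ξ s) (mergedVel S₁ S₂ S₃ s),
    mergedOuter (upperShape S₁ S₂ S₃ s) (corner S₁ S₂ S₃) S₁.vel ((lowerShock S₁ S₂ S₃).Ξ s)
      (mergedVel S₁ S₂ S₃ s),
    leftRegion S₁ S₂ S₃,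
    lowerRegion S₁ S₂ S₃ ((lowerShock S₁ S₂ S₃).Ξ s).2]

theorem isOpen_collisionRegions {S₁ S₂ S₃ : State} {s : ℝ} (i : Fin 4) :
    IsOpen (collisionRegions S₁ S₂ S₃ s i) := by
  revert i
  exact forall_fin_four isOpen_mergedVacuum isOpen_mergedOuter isOpen_leftRegion isOpen_lowerRegion

theorem DeltaCurve.Separates.mono {d : DeltaCurve} {I : Set ℝ} {DL DR EL ER : Set (ℝ × ℝ)}
    (h : d.Separates I DL DR) (hL : DL ⊆ EL) (hR : DR ⊆ ER) : d.Separates I EL ER :=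
  fun s hs => (h s hs).mono fun _ hε => ⟨hL hε.1, hR hε.2⟩

theorem IsContactAt.mono {X e : ℝ × ℝ} {L R : State} {DL DR EL : Set (ℝ × ℝ)}
    (h : IsContactAt X e L R DL DR) (hL : DL ⊆ EL) : IsContactAt X e L R EL DR :=
  ⟨h.1, h.2.1, h.2.2.mono fun _ hε => ⟨hL hε.1, hε.2⟩⟩

theorem forall_fin_three {p : Fin 3 → Prop} (h0 : p 0) (h1 : p 1) (h2 : p 2) (k : Fin 3) : p k := by
  fin_cases k <;> assumption

namespace Meets
variable {S₁ S₂ S₃ : State} {s : ℝ} (h : Meets S₁ S₂ S₃ s)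
include h

theorem rightShock_Ξ_snd (σ : ℝ) :
    ((rightShock S₁ S₂ S₃ s).Ξ σ).2 = ((lowerShock S₁ S₂ S₃).Ξ s).2 :=
  straightDelta_Ξ_snd h.meet.symm σ

theorem rightShock_Ξ_fst {σ : ℝ} (hσ : 0 < σ) :
    ((lowerShock S₁ S₂ S₃).Ξ s).1 < ((rightShock S₁ S₂ S₃ s).Ξ σ).1 :=
  straightDelta_Ξ_fst_gt h.deltaVel_fst_lt hσ

theorem rightShock_injective : Function.Injective (rightShock S₁ S₂ S₃ s).Ξ :=
  straightDelta_Ξ_injective h.deltaVel_fst_lt.ne'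

theorem exists_rightShock {X : ℝ × ℝ} (h2 : X.2 = ((lowerShock S₁ S₂ S₃).Ξ s).2)
    (h1 : ((lowerShock S₁ S₂ S₃).Ξ s).1 < X.1) : ∃ σ > 0, (rightShock S₁ S₂ S₃ s).Ξ σ = X :=
  exists_straightDelta_of_fst_gt h.meet.symm h.deltaVel_fst_lt h2 h1

theorem image_rightShock : (rightShock S₁ S₂ S₃ s).Ξ '' Ici 0 =
    {X | X.2 = ((lowerShock S₁ S₂ S₃).Ξ s).2 ∧ ((lowerShock S₁ S₂ S₃).Ξ s).1 ≤ X.1} :=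
  image_straightDelta_right h.meet.symm h.deltaVel_fst_lt

theorem lowerShock_snd_lt_meeting {σ : ℝ} (hσ : s < σ) (hσ0 : σ ≤ 0) :
    ((lowerShock S₁ S₂ S₃).Ξ σ).2 < ((lowerShock S₁ S₂ S₃).Ξ s).2 :=
  h.strictAntiOn_lowerShock_snd (mem_Iic.2 h.neg.le) (mem_Iic.2 hσ0) hσ

theorem gt_of_lowerShock_snd {σ : ℝ} (hσ0 : σ < 0)
    (hlt : ((lowerShock S₁ S₂ S₃).Ξ σ).2 < ((lowerShock S₁ S₂ S₃).Ξ s).2) : s < σ :=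
  (h.strictAntiOn_lowerShock_snd.lt_iff_gt (mem_Iic.2 hσ0.le) (mem_Iic.2 h.neg.le)).1 hlt

/-- Left of the chord from `S₁.vel` to the collision point, and below that point, everything is
strictly behind the first shock. So the arc `A B` must lie to the right of the chord. -/
theorem side_lowerShock {σ : ℝ} (hσ : s < σ) (hσ0 : σ < 0) :
    coordC S₁.vel ((lowerShock S₁ S₂ S₃).Ξ s) (mergedVel S₁ S₂ S₃ s)
      ((lowerShock S₁ S₂ S₃).Ξ σ) < 0 :=
  h.mergeConfig.side_neg_of_conic (h.lowerShock_coords hσ0).2.1 (h.lowerShock_coords hσ0).2.2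
    (h.lowerShock_fst_gt hσ0) (h.lowerShock_snd_lt_meeting hσ hσ0.le)

theorem side_rightShock {σ : ℝ} (hσ : 0 < σ) :
    coordC S₁.vel ((lowerShock S₁ S₂ S₃).Ξ s) (mergedVel S₁ S₂ S₃ s)
      ((rightShock S₁ S₂ S₃ s).Ξ σ) < 0 :=
  (h.mergeConfig.side_of_snd_eq (h.rightShock_Ξ_snd σ)).2 (h.rightShock_Ξ_fst hσ)

theorem upperShock_coords {σ : ℝ} (hσ : σ < 0) :
    0 < coordA S₁.vel ((lowerShock S₁ S₂ S₃).Ξ s) (mergedVel S₁ S₂ S₃ s)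
      ((upperShock S₁ S₂ S₃ s).Ξ σ) ∧
    0 < coordC S₁.vel ((lowerShock S₁ S₂ S₃).Ξ s) (mergedVel S₁ S₂ S₃ s)
      ((upperShock S₁ S₂ S₃ s).Ξ σ) ∧
    conic (upperShape S₁ S₂ S₃ s) S₁.vel ((lowerShock S₁ S₂ S₃).Ξ s) (mergedVel S₁ S₂ S₃ s)
      ((upperShock S₁ S₂ S₃ s).Ξ σ) = 0 :=
  ⟨coordA_vacuumShock_pos h.br_upper,
    coordC_vacuumShock_pos h.ρ₁ h.mergedMass_pos h.br_upper hσ,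
    conic_vacuumShock h.ρ₁ h.mergedMass_pos h.br_upper hσ.le⟩

theorem image_upperShock : (upperShock S₁ S₂ S₃ s).Ξ '' Iic 0 =
    {X | 0 < coordA S₁.vel ((lowerShock S₁ S₂ S₃).Ξ s) (mergedVel S₁ S₂ S₃ s) X ∧
      0 ≤ coordC S₁.vel ((lowerShock S₁ S₂ S₃).Ξ s) (mergedVel S₁ S₂ S₃ s) X ∧
      conic (upperShape S₁ S₂ S₃ s) S₁.vel ((lowerShock S₁ S₂ S₃).Ξ s)
        (mergedVel S₁ S₂ S₃ s) X = 0} :=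
  image_vacuumShock h.ρ₁ h.mergedMass_pos h.br_upper

theorem exists_upperShock {X : ℝ × ℝ}
    (hA : 0 < coordA S₁.vel ((lowerShock S₁ S₂ S₃).Ξ s) (mergedVel S₁ S₂ S₃ s) X)
    (hC : 0 < coordC S₁.vel ((lowerShock S₁ S₂ S₃).Ξ s) (mergedVel S₁ S₂ S₃ s) X)
    (h0 : conic (upperShape S₁ S₂ S₃ s) S₁.vel ((lowerShock S₁ S₂ S₃).Ξ s)
      (mergedVel S₁ S₂ S₃ s) X = 0) : ∃ σ < 0, (upperShock S₁ S₂ S₃ s).Ξ σ = X := by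
  obtain ⟨σ, hσ, rfl⟩ := exists_vacuumShock_of_conic (n₀ := mergedEnergy S₁ S₂ S₃ s) h.ρ₁
    h.mergedMass_pos h.br_upper hA hC.le h0
  refine ⟨σ, lt_of_le_of_ne hσ ?_, rfl⟩
  rintro rfl
  rw [coordC_vacuumShock h.br_upper, shockRatio_zero, sub_self, mul_zero, mul_zero] at hC
  exact lt_irrefl _ hC

theorem disjoint_collisionRegions : Pairwise (Function.onFun Disjoint
    (collisionRegions S₁ S₂ S₃ s)) := by
  have hc := h.mergeConfig
  refine pairwise_disjoint_fin_four ?_ ?_ ?_ ?_ ?_ ?_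
  · exact fun X hX => hc.mergedVacuum_notMem_mergedOuter hX
  · exact fun X hX hX' => lt_asymm (hc.fst_gt_of_mergedVacuum hX) hX'.1
  · exact fun X hX hX' => hc.mergedVacuum_notMem_outer hX hX'.1 hX'.2
  · exact fun X hX hX' => lt_asymm (show S₁.u < X.1 from hX.1) hX'.1
  · exact fun X hX hX' => hc.mergedOuter_notMem_outer hX hX'.1 hX'.2
  · exact fun X hX => h.notMem_lowerRegion_of_leftRegion hX

theorem notMem_waves_of_mem_regions {X : ℝ × ℝ} (hX : X ∈ collisionRegions S₁ S₂ S₃ s 0 ∨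
      X ∈ collisionRegions S₁ S₂ S₃ s 1 ∨ X ∈ collisionRegions S₁ S₂ S₃ s 2 ∨ X ∈ collisionRegions
        S₁ S₂ S₃ s 3) :
    X ∉ {X | X.2 = (corner S₁ S₂ S₃).2 ∧ X.1 ≤ S₁.u} ∧
    X ∉ (lowerShock S₁ S₂ S₃).Ξ '' Icc s 0 ∧
    X ∉ {X | X.2 = ((lowerShock S₁ S₂ S₃).Ξ s).2 ∧ ((lowerShock S₁ S₂ S₃).Ξ s).1 ≤ X.1} ∧
    X ∉ {X | 0 < coordA S₁.vel ((lowerShock S₁ S₂ S₃).Ξ s) (mergedVel S₁ S₂ S₃ s) X ∧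
      0 ≤ coordC S₁.vel ((lowerShock S₁ S₂ S₃).Ξ s) (mergedVel S₁ S₂ S₃ s) X ∧
      conic (upperShape S₁ S₂ S₃ s) S₁.vel ((lowerShock S₁ S₂ S₃).Ξ s)
        (mergedVel S₁ S₂ S₃ s) X = 0} ∧
    X ∉ {X | X.1 = S₁.u ∧ (corner S₁ S₂ S₃).2 ≤ X.2} := by
  have hc := h.mergeConfig
  have hcontact : X ∉ {X | X.1 = S₁.u ∧ (corner S₁ S₂ S₃).2 ≤ X.2} := by
    rintro ⟨h1, h2⟩
    rcases hX with hX | hX | hX | hX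
    · exact (hc.fst_gt_of_mergedVacuum hX).ne' h1
    · exact (show S₁.u < X.1 from hX.1).ne' h1
    · exact (show X.1 < S₁.u from hX.1).ne h1
    · exact (h.fst_gt_of_lowerRegion hX h2).ne' h1
  have hmeet : X ≠ (lowerShock S₁ S₂ S₃).Ξ s := by
    rintro rfl
    rcases hX with hX | hX | hX | hX
    · rw [show collisionRegions S₁ S₂ S₃ s 0 = _ from hc.mergedVacuum_eq] at hX
      rcases hX with hX | hX
      · exact lt_irrefl _ (show ((lowerShock S₁ S₂ S₃).Ξ s).2 < _ from hX.1.1.2)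
      · exact hc.meeting_notMem_conicInterior hX.1
    · exact hX.2 (Or.inl ⟨coordC_base.le, le_rfl⟩)
    · exact lt_asymm (show _ < S₁.u from hX.1) (h.lowerShock_fst_gt h.neg)
    · exact lt_irrefl _ (show ((lowerShock S₁ S₂ S₃).Ξ s).2 < _ from hX.1)
  refine ⟨?_, fun hW => ?_, ?_, ?_, hcontact⟩
  · rintro ⟨h2, h1⟩
    rcases hX with hX | hX | hX | hX
    · exact absurd (hc.fst_gt_of_mergedVacuum hX) (not_lt.2 h1)
    · exact absurd (show S₁.u < X.1 from hX.1) (not_lt.2 h1)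
    · exact (show (corner S₁ S₂ S₃).2 < X.2 from hX.2).ne' h2
    · exact absurd (h.fst_gt_of_lowerRegion hX h2.ge) (not_lt.2 h1)
  · rcases image_lowerShock_Icc_subset hW with rfl | ⟨σ, hσ, hσ0, rfl⟩
    · exact hcontact ⟨rfl, le_rfl⟩
    · rcases eq_or_lt_of_le hσ with rfl | hσ
      · exact hmeet rfl
      · have hside := h.side_lowerShock hσ hσ0
        rcases hX with hX | hX | hX | hX
        · rw [show collisionRegions S₁ S₂ S₃ s 0 = _ from hc.mergedVacuum_eq] at hX
          rcases hX with hX | hX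
          · exact h.lowerShock_notMem_inner hσ0 hX.1.2
          · exact absurd hside (not_lt.2 hX.2)
        · exact hX.2 (Or.inl ⟨hside.le, (h.lowerShock_snd_lt_meeting hσ hσ0.le).le⟩)
        · exact lt_asymm (show _ < S₁.u from hX.1) (h.lowerShock_fst_gt hσ0)
        · exact h.lowerShock_notMem_outer hσ0 hX.2
  · rintro ⟨h2, h1⟩
    rcases eq_or_lt_of_le h1 with h1 | h1
    · exact hmeet (Prod.ext h1.symm h2)
    · have hside := (hc.side_of_snd_eq h2).2 h1
      rcases hX with hX | hX | hX | hX
      · rw [show collisionRegions S₁ S₂ S₃ s 0 = _ from hc.mergedVacuum_eq] at hX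
        rcases hX with hX | hX
        · exact (show X.2 < _ from hX.1.1.2).ne h2
        · exact absurd hside (not_lt.2 hX.2)
      · exact hX.2 (Or.inl ⟨hside.le, h2.le⟩)
      · exact lt_asymm (show _ < S₁.u from hX.1) ((h.lowerShock_fst_gt h.neg).trans h1)
      · exact (show X.2 < _ from hX.1).ne h2
  · rintro ⟨hA, hC, h0⟩
    have h1 := hc.fst_gt_of_coords hA hC
    rcases hX with hX | hX | hX | hX
    · rw [show collisionRegions S₁ S₂ S₃ s 0 = _ from hc.mergedVacuum_eq] at hX
      have hM : X ∈ conicInterior (upperShape S₁ S₂ S₃ s) S₁.vel ((lowerShock S₁ S₂ S₃).Ξ s)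
          (mergedVel S₁ S₂ S₃ s) := by
        rcases hX with hX | hX
        · exact (hc.mergeInner_chord (le_antisymm hX.2 hC)).1 hX.1
        · exact hX.1
      exact (show conic _ _ _ _ X < 0 from hM.2).ne h0
    · exact hX.2 (Or.inr ⟨hC, hA.le, h0.le⟩)
    · exact lt_asymm h1 hX.1
    · exact notMem_outer_of_inner (hc.inner_of_side h1 hC hX.1) hX.2

/-- Above the corner and right of the contact line, the line through `S₁.vel` and the collision
point decides: to its right the first conic and the horizontal shock bound the regions, to its left
the second conic. -/
theorem mem_regions_of_notMem_waves {X : ℝ × ℝ}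
    (w1 : X ∉ {X | X.2 = (corner S₁ S₂ S₃).2 ∧ X.1 ≤ S₁.u})
    (w2 : X ∉ (lowerShock S₁ S₂ S₃).Ξ '' Icc s 0)
    (w3 : X ∉ {X | X.2 = ((lowerShock S₁ S₂ S₃).Ξ s).2 ∧ ((lowerShock S₁ S₂ S₃).Ξ s).1 ≤ X.1})
    (w4 : X ∉ {X | 0 < coordA S₁.vel ((lowerShock S₁ S₂ S₃).Ξ s) (mergedVel S₁ S₂ S₃ s) X ∧
      0 ≤ coordC S₁.vel ((lowerShock S₁ S₂ S₃).Ξ s) (mergedVel S₁ S₂ S₃ s) X ∧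
      conic (upperShape S₁ S₂ S₃ s) S₁.vel ((lowerShock S₁ S₂ S₃).Ξ s)
        (mergedVel S₁ S₂ S₃ s) X = 0})
    (w5 : X ∉ {X | X.1 = S₁.u ∧ (corner S₁ S₂ S₃).2 ≤ X.2}) :
    X ∈ collisionRegions S₁ S₂ S₃ s 0 ∨ X ∈ collisionRegions S₁ S₂ S₃ s 1 ∨
      X ∈ collisionRegions S₁ S₂ S₃ s 2 ∨ X ∈ collisionRegions S₁ S₂ S₃ s 3 := by
  have hc := h.mergeConfig
  have hH := hc.corner_snd_lt
  rcases lt_trichotomy X.2 (corner S₁ S₂ S₃).2 with h2 | h2 | h2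
  · exact Or.inr (Or.inr (Or.inr (subset_lowerRegion hH h2)))
  · have h1 : S₁.u < X.1 := lt_of_not_ge fun h1 => w1 ⟨h2, h1⟩
    exact Or.inr (Or.inr (Or.inr ⟨h2.trans_lt hH, hc.outer_of_snd_le h2.le h1⟩))
  rcases lt_trichotomy X.1 S₁.u with h1 | h1 | h1
  · exact Or.inr (Or.inr (Or.inl ⟨h1, h2⟩))
  · exact absurd ⟨h1, h2.le⟩ w5
  rcases lt_trichotomy
    (coordC S₁.vel ((lowerShock S₁ S₂ S₃).Ξ s) (mergedVel S₁ S₂ S₃ s) X) 0 with hC | hC | hC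
  · rcases lt_trichotomy X.2 ((lowerShock S₁ S₂ S₃).Ξ s).2 with h3 | h3 | h3
    · rcases hc.inner_or_conic_or_outer h2 (h3.trans hc.meeting_snd_lt) with h4 | ⟨h4, h5, h6⟩ | h4
      · exact Or.inl (Or.inl (Or.inl ⟨⟨⟨h1, h3⟩, h4⟩, hC⟩))
      · obtain ⟨σ, hσ, rfl⟩ := h.exists_lowerShock h4 h5 h6
        exact absurd ⟨σ, ⟨(h.gt_of_lowerShock_snd hσ h3).le, hσ.le⟩, rfl⟩ w2
      · exact Or.inr (Or.inr (Or.inr ⟨h3, h4⟩))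
    · exact absurd ⟨h3, ((hc.side_of_snd_eq h3).1 hC).le⟩ w3
    · exact Or.inr (Or.inl ((mergedOuter_of_side_neg h1 hC).2 h3))
  -- On the dividing line: vacuum before the collision point, the wave at it, state 1 beyond it.
  · have e1 := hc.fst_chord hC
    have e2 := hc.snd_chord hC
    have hA : 0 < coordA S₁.vel ((lowerShock S₁ S₂ S₃).Ξ s) (mergedVel S₁ S₂ S₃ s) X :=
      pos_of_mul_pos_left (e1 ▸ sub_pos.2 h1) (sub_pos.2 hc.fst_lt_meeting).le
    rcases lt_or_ge (coordA S₁.vel ((lowerShock S₁ S₂ S₃).Ξ s) (mergedVel S₁ S₂ S₃ s) X) 1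
      with h3 | h3
    · have hM := (hc.conicInterior_chord hC).2 ⟨hA, h3⟩
      exact Or.inl (Or.inl (Or.inr ⟨(hc.mergeInner_chord hC).2 hM, hM⟩))
    · have e3 : conic (upperShape S₁ S₂ S₃ s) S₁.vel ((lowerShock S₁ S₂ S₃).Ξ s)
          (mergedVel S₁ S₂ S₃ s) X = 2 * upperShape S₁ S₂ S₃ s *
          coordA S₁.vel ((lowerShock S₁ S₂ S₃).Ξ s) (mergedVel S₁ S₂ S₃ s) X *
          (coordA S₁.vel ((lowerShock S₁ S₂ S₃).Ξ s) (mergedVel S₁ S₂ S₃ s) X - 1) := by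
        rw [conic, hC]; ring
      have hp : 0 < 2 * upperShape S₁ S₂ S₃ s *
          coordA S₁.vel ((lowerShock S₁ S₂ S₃).Ξ s) (mergedVel S₁ S₂ S₃ s) X :=
        mul_pos (mul_pos two_pos hc.pos') hA
      rcases eq_or_lt_of_le h3 with h3 | h3
      · exact absurd ⟨hA, hC.ge, by rw [e3, ← h3, sub_self, mul_zero]⟩ w4
      · refine Or.inr (Or.inl ⟨h1, ?_⟩)
        rintro (⟨-, h4⟩ | ⟨-, -, h4⟩)
        · have := mul_neg_of_neg_of_pos (sub_neg.2 h3) (sub_pos.2 hc.lt_meeting)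
          linarith
        · rw [e3] at h4
          exact absurd h4 (not_le.2 (mul_pos hp (sub_pos.2 h3)))
  · by_cases hF : 0 < coordA S₁.vel ((lowerShock S₁ S₂ S₃).Ξ s) (mergedVel S₁ S₂ S₃ s) X →
        0 < conic (upperShape S₁ S₂ S₃ s) S₁.vel ((lowerShock S₁ S₂ S₃).Ξ s)
          (mergedVel S₁ S₂ S₃ s) X
    · exact Or.inr (Or.inl ((mergedOuter_of_side_pos h1 hC).2 hF))
    · push Not at hF
      rcases eq_or_lt_of_le hF.2 with h3 | h3
      · exact absurd ⟨hF.1, hC.le, h3⟩ w4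
      · exact Or.inl (Or.inr ⟨⟨hF.1, h3⟩, hC⟩)

theorem iUnion_collisionRegions : ⋃ i, collisionRegions S₁ S₂ S₃ s i =
    ((leftShock S₁ S₂ S₃).Ξ '' Ici 0 ∪ (lowerShock S₁ S₂ S₃).Ξ '' Icc s 0 ∪
      (rightShock S₁ S₂ S₃ s).Ξ '' Ici 0 ∪ (upperShock S₁ S₂ S₃ s).Ξ '' Iic 0 ∪
      {X | X.1 = S₁.u ∧ (corner S₁ S₂ S₃).2 ≤ X.2})ᶜ := by
  rw [h.image_leftShock, h.image_rightShock, h.image_upperShock]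
  ext X
  rw [mem_iUnion_fin_four, mem_compl_iff]
  constructor
  · rintro hX ((((hW | hW) | hW) | hW) | hW)
    · exact (h.notMem_waves_of_mem_regions hX).1 hW
    · exact (h.notMem_waves_of_mem_regions hX).2.1 hW
    · exact (h.notMem_waves_of_mem_regions hX).2.2.1 hW
    · exact (h.notMem_waves_of_mem_regions hX).2.2.2.1 hW
    · exact (h.notMem_waves_of_mem_regions hX).2.2.2.2 hW
  · intro hW
    exact h.mem_regions_of_notMem_waves
      (fun hX => hW (Or.inl (Or.inl (Or.inl (Or.inl hX)))))
      (fun hX => hW (Or.inl (Or.inl (Or.inl (Or.inr hX)))))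
      (fun hX => hW (Or.inl (Or.inl (Or.inr hX)))) (fun hX => hW (Or.inl (Or.inr hX)))
      (fun hX => hW (Or.inr hX))

end Meets

/-! ### Case 5: wave pattern, particle paths and the weak solution -/

namespace Meets
variable {S₁ S₂ S₃ : State} {s : ℝ} (h : Meets S₁ S₂ S₃ s)
include h

theorem isWavePattern_collision :
    IsWavePattern S₁ S₂ S₃ (patch S₁ S₂ S₃ (collisionRegions S₁ S₂ S₃ s))
      (collisionRegions S₁ S₂ S₃ s)
      ((leftShock S₁ S₂ S₃).Ξ '' Ici 0 ∪ (lowerShock S₁ S₂ S₃).Ξ '' Icc s 0 ∪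
        (rightShock S₁ S₂ S₃ s).Ξ '' Ici 0 ∪ (upperShock S₁ S₂ S₃ s).Ξ '' Iic 0 ∪
        {X | X.1 = S₁.u ∧ (corner S₁ S₂ S₃).2 ≤ X.2}) := by
  have hc := h.mergeConfig
  refine ⟨isOpen_collisionRegions, h.disjoint_collisionRegions, h.iUnion_collisionRegions,
    hc.isConnected_mergedVacuum, hc.isBounded_mergedVacuum, fun X h1 h2 => ?_,
    fun X h1 h2 => ?_, fun X h2 => ?_, patch_values S₁ S₂ S₃ h.disjoint_collisionRegions⟩
  · -- far out, the point is ahead of every curve that bounds the region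
    have hray : ∀ᶠ r : ℝ in atTop, S₁.u < r * X.1 ∧ ((lowerShock S₁ S₂ S₃).Ξ s).2 < r * X.2 ∧
        ((mergedVel S₁ S₂ S₃ s).2 + ((lowerShock S₁ S₂ S₃).Ξ s).2 - S₁.v) < r * X.2 :=
      (eventually_lt_mul h1 _).and ((eventually_lt_mul h2 _).and (eventually_lt_mul h2 _))
    filter_upwards [hray] with r ⟨e1, e2, e3⟩
    refine ⟨e1, ?_⟩
    rintro (⟨-, h4⟩ | ⟨hC, hA, hF⟩)
    · exact absurd h4 (not_le.2 e2)
    · have hκ := hc.pos'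
      -- A point with `α, γ ≥ 0` and `conic ≤ 0` also has `β ≥ 0`. Its coordinates are then at most
      -- 1, which bounds its height and contradicts `e3`.
      have hB : 0 ≤ 1 - coordA S₁.vel ((lowerShock S₁ S₂ S₃).Ξ s) (mergedVel S₁ S₂ S₃ s) (r • X) -
          coordC S₁.vel ((lowerShock S₁ S₂ S₃).Ξ s) (mergedVel S₁ S₂ S₃ s) (r • X) := by
        rcases eq_or_lt_of_le hA with h5 | h5
        · rw [conic, ← h5] at hF
          have : coordC S₁.vel ((lowerShock S₁ S₂ S₃).Ξ s) (mergedVel S₁ S₂ S₃ s) (r • X) = 0 := by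
            refine pow_eq_zero_iff two_ne_zero |>.1 (le_antisymm ?_ (sq_nonneg _))
            linarith
          rw [← h5, this]; norm_num
        · rw [conic] at hF
          refine nonneg_of_mul_nonneg_right (a := 2 * upperShape S₁ S₂ S₃ s *
            coordA S₁.vel ((lowerShock S₁ S₂ S₃).Ξ s) (mergedVel S₁ S₂ S₃ s) (r • X)) ?_
              (by positivity)
          linarith [sq_nonneg (coordC S₁.vel ((lowerShock S₁ S₂ S₃).Ξ s)
            (mergedVel S₁ S₂ S₃ s) (r • X))]
      have e := snd_eq_of_coords hc.br_neg'.ne (r • X)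
      have d2 := sub_pos.2 hc.lt_meeting
      have d4 := sub_pos.2 (hc.lt_meeting.trans hc.snd_lt_vel)
      have m2 := mul_le_mul_of_nonneg_right (show coordA S₁.vel ((lowerShock S₁ S₂ S₃).Ξ s)
        (mergedVel S₁ S₂ S₃ s) (r • X) ≤ 1 by linarith) d2.le
      have m4 := mul_le_mul_of_nonneg_right (show coordC S₁.vel ((lowerShock S₁ S₂ S₃).Ξ s)
        (mergedVel S₁ S₂ S₃ s) (r • X) ≤ 1 by linarith) d4.le
      have e' : (r • X).2 = r * X.2 := rfl
      simp only [State.vel] at e m2 m4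
      linarith
  · filter_upwards [eventually_mul_lt h1 S₁.u, eventually_lt_mul h2 (corner S₁ S₂ S₃).2]
      with r e1 e2
    exact ⟨e1, e2⟩
  · filter_upwards [eventually_mul_lt h2 (corner S₁ S₂ S₃).2] with r e2
    exact subset_lowerRegion hc.corner_snd_lt e2

theorem separates_lowerShock_collision : (lowerShock S₁ S₂ S₃).Separates (Ioo s 0)
    (collisionRegions S₁ S₂ S₃ s 0) (collisionRegions S₁ S₂ S₃ s 3) := by
  refine (h.separates_lowerShock (fun σ hσ => hσ.2)
    (((isOpen_lt continuous_const continuous_fst).inter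
      (isOpen_lt continuous_snd continuous_const)).inter
        (isOpen_lt continuous_coordC continuous_const))
    (isOpen_lt continuous_snd continuous_const)
    (fun σ hσ => ⟨⟨h.lowerShock_fst_gt hσ.2, h.lowerShock_snd_lt_meeting hσ.1 hσ.2.le⟩,
      h.side_lowerShock hσ.1 hσ.2⟩)
    (fun σ hσ => h.lowerShock_snd_lt_meeting hσ.1 hσ.2.le)).mono ?_ Subset.rfl
  rintro X ⟨⟨hX, hC⟩, hI⟩
  exact Or.inl (Or.inl ⟨⟨hX, hI⟩, hC⟩)

theorem rightShock_outer {σ : ℝ} (hσ : 0 < σ) :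
    0 < coordC S₃.vel (corner S₁ S₂ S₃) (deltaVel S₂ S₃) ((rightShock S₁ S₂ S₃ s).Ξ σ) ∧
    0 < conic (lowerShape S₁ S₂ S₃) S₃.vel (corner S₁ S₂ S₃) (deltaVel S₂ S₃)
      ((rightShock S₁ S₂ S₃ s).Ξ σ) :=
  (h.mergeConfig.outer_iff_of_snd_eq (h.rightShock_Ξ_snd σ)).2 (h.rightShock_Ξ_fst hσ)

theorem rightShock_fst_gt {σ : ℝ} (hσ : 0 < σ) : S₁.u < ((rightShock S₁ S₂ S₃ s).Ξ σ).1 :=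
  (h.lowerShock_fst_gt h.neg).trans (h.rightShock_Ξ_fst hσ)

theorem separates_rightShock : (rightShock S₁ S₂ S₃ s).Separates (Ioi 0)
    (collisionRegions S₁ S₂ S₃ s 3) (collisionRegions S₁ S₂ S₃ s 1) := by
  intro σ hσ
  have h2 := h.rightShock_Ξ_snd σ
  have h3 := sub_pos.2 h.deltaVel_fst_lt
  have e : rot ((rightShock S₁ S₂ S₃ s).U σ - (rightShock S₁ S₂ S₃ s).Ξ σ) = _ :=
    rot_straightDelta (P := (lowerShock S₁ S₂ S₃).Ξ s) h.meet.symm σ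
  have hL := isOpen_lowerOuter.mem_nhds (Or.inr (h.rightShock_outer hσ) :
    (rightShock S₁ S₂ S₃ s).Ξ σ ∈ lowerOuter (lowerShape S₁ S₂ S₃) S₃.vel (corner S₁ S₂ S₃)
      (deltaVel S₂ S₃))
  have hR := ((isOpen_lt continuous_const continuous_fst).inter
    (isOpen_lt continuous_coordC continuous_const)).mem_nhds
      (show (rightShock S₁ S₂ S₃ s).Ξ σ ∈ {X | S₁.u < X.1} ∩
        {X | coordC S₁.vel ((lowerShock S₁ S₂ S₃).Ξ s) (mergedVel S₁ S₂ S₃ s) X < 0} from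
        ⟨h.rightShock_fst_gt hσ, h.side_rightShock hσ⟩)
  rw [e]
  filter_upwards [self_mem_nhdsWithin, (tendsto_add_smul_nhdsGT _ _) hL,
    (tendsto_sub_smul_nhdsGT _ _) hR] with ε hε e1 e2
  have h4 := mul_pos (mem_Ioi.1 hε) (mul_pos (Real.exp_pos σ) h3)
  refine ⟨⟨?_, e1⟩, (mergedOuter_of_side_neg (A := corner S₁ S₂ S₃) e2.1 e2.2).2 ?_⟩
  · simp only [mem_ofPred_eq, Prod.snd_add, Prod.smul_snd, smul_eq_mul, h2]; linarith
  · simp only [Prod.snd_sub, Prod.smul_snd, smul_eq_mul, h2]; linarith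

theorem separates_upperShock : (upperShock S₁ S₂ S₃ s).Separates (Iio 0)
    (collisionRegions S₁ S₂ S₃ s 0) (collisionRegions S₁ S₂ S₃ s 1) := by
  intro σ hσ
  obtain ⟨hA, hC, h0⟩ := h.upperShock_coords hσ
  have hsep := vacuumShock_separates (n₀ := mergedEnergy S₁ S₂ S₃ s) h.ρ₁ h.mergedMass_pos
    h.br_upper (le_of_lt hσ)
  have hn := (((isOpen_lt continuous_const continuous_fst).inter
    (isOpen_lt continuous_const continuous_coordA)).inter
      (isOpen_lt continuous_const continuous_coordC)).mem_nhds
      (show (upperShock S₁ S₂ S₃ s).Ξ σ ∈ {X | S₁.u < X.1} ∩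
        {X | 0 < coordA S₁.vel ((lowerShock S₁ S₂ S₃).Ξ s) (mergedVel S₁ S₂ S₃ s) X} ∩
        {X | 0 < coordC S₁.vel ((lowerShock S₁ S₂ S₃).Ξ s) (mergedVel S₁ S₂ S₃ s) X} from
        ⟨⟨h.mergeConfig.fst_gt_of_coords hA hC.le, hA⟩, hC⟩)
  filter_upwards [hsep, (tendsto_add_smul_nhdsGT _ _) hn, (tendsto_sub_smul_nhdsGT _ _) hn]
    with ε e1 e2 e3
  exact ⟨Or.inr ⟨⟨e2.1.2, e1.1⟩, e2.2⟩, (mergedOuter_of_side_pos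
    (A := corner S₁ S₂ S₃) e3.1.1 e3.2).2 fun _ => e1.2⟩

theorem contact_states {y : ℝ} (hy : S₁.v < y) : IsContactAt (S₁.u, y) (0, -1) S₁ S₂
    (collisionRegions S₁ S₂ S₃ s 1) (collisionRegions S₁ S₂ S₃ s 2) := by
  have hc := h.mergeConfig
  refine (h.contact_left isClosed_mergedOuter_compl.isOpen_compl (h.corner_lt.trans hy) ?_).1
  have hC : 0 < coordC S₁.vel ((lowerShock S₁ S₂ S₃).Ξ s) (mergedVel S₁ S₂ S₃ s) (S₁.u, y) := by
    rw [hc.side_pos_iff]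
    have := mul_pos (sub_pos.2 hy) (sub_pos.2 hc.fst_lt_meeting)
    simpa [State.vel] using this
  have e := fst_eq_of_coords hc.br_neg'.ne ((S₁.u, y) : ℝ × ℝ)
  have hA : coordA S₁.vel ((lowerShock S₁ S₂ S₃).Ξ s) (mergedVel S₁ S₂ S₃ s) (S₁.u, y) < 0 := by
    by_contra hcon
    have h1 := mul_nonneg (not_lt.1 hcon) (sub_pos.2 hc.fst_lt_meeting).le
    have h2 := mul_pos hC (sub_pos.2 hc.fst_lt_vel)
    have e' : ((S₁.u, y) : ℝ × ℝ).1 = S₁.vel.1 := rfl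
    linarith
  rintro (⟨h1, -⟩ | ⟨-, h1, -⟩) <;> linarith

theorem contact_vacuum {y : ℝ} (hy : (corner S₁ S₂ S₃).2 < y) (hy' : y < S₁.v) :
    IsContactAt (S₁.u, y) (0, -1) vacuum S₂
      (collisionRegions S₁ S₂ S₃ s 0) (collisionRegions S₁ S₂ S₃ s 2) := by
  have hc := h.mergeConfig
  refine (h.contact_left (((isOpen_lt continuous_snd continuous_const).inter
    isOpen_lowerInner).inter (isOpen_lt continuous_coordC continuous_const)) hy
    (show (S₁.u, y) ∈ {X | X.2 < ((lowerShock S₁ S₂ S₃).Ξ s).2} ∩ lowerInner (lowerShape S₁ S₂ S₃)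
      S₃.vel (corner S₁ S₂ S₃) (deltaVel S₂ S₃) ∩
      {X | coordC S₁.vel ((lowerShock S₁ S₂ S₃).Ξ s) (mergedVel S₁ S₂ S₃ s) X < 0} from
      ⟨⟨hy'.trans hc.lt_meeting, hy, hy'.trans h.v_lt_v,
        Or.inl (hc.coordC_neg_of_fst_le le_rfl hy)⟩, ?_⟩)).2.mono ?_
  · simp only [mem_ofPred_eq]
    rw [hc.side_neg_iff]
    have := mul_neg_of_neg_of_pos (sub_neg.2 hy') (sub_pos.2 hc.fst_lt_meeting)
    simpa [State.vel] using this
  · rintro X ⟨h1, ⟨h2, h3⟩, h4⟩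
    exact Or.inl (Or.inl ⟨⟨⟨h1, h2⟩, h3⟩, h4⟩)

theorem exists_rightShock_ray {V x : ℝ × ℝ} (hV : (((lowerShock S₁ S₂ S₃).Ξ s).2 - V.2) / x.2 > 0)
    (hX : ∀ r : ℝ, 0 < r → (V + r • x).2 = ((lowerShock S₁ S₂ S₃).Ξ s).2 →
      ((lowerShock S₁ S₂ S₃).Ξ s).1 < (V + r • x).1) :
    ∃ σ ∈ Ioi (0 : ℝ), ∃ r : ℝ, 0 < r ∧ x = r • ((rightShock S₁ S₂ S₃ s).Ξ σ - V) := by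
  have hx : x.2 ≠ 0 := by
    rintro h0; rw [h0, div_zero] at hV; exact lt_irrefl _ hV
  have h2 : (V + ((((lowerShock S₁ S₂ S₃).Ξ s).2 - V.2) / x.2) • x).2 =
      ((lowerShock S₁ S₂ S₃).Ξ s).2 := by
    simp only [Prod.snd_add, Prod.smul_snd, smul_eq_mul, div_mul_cancel₀ _ hx]; ring
  obtain ⟨σ, hσ, he⟩ := h.exists_rightShock h2 (hX _ hV h2)
  exact ⟨σ, hσ, _, inv_pos.2 hV, eq_smul_sub_of_eq_add_smul hV he⟩

/-- Compared with Case 9, the horizontal shock now catches the particles that would have hit the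
rising shock beyond the collision point or escaped it. Almost no particle of state 3 survives. -/
theorem isSweptBy_lowerRegion_collision :
    IsSweptBy S₃.vel (collisionRegions S₁ S₂ S₃ s 3) {q | q.2 < 0}
      ![leftShock S₁ S₂ S₃, lowerShock S₁ S₂ S₃, rightShock S₁ S₂ S₃ s]
      ![Ioi 0, Ioo s 0, Ioi 0] where
  tame := forall_fin_three (tame_straightDelta h.ρ₂ h.ρ₃ h.br_corner)
    (h.tame_lowerShock.mono isOpen_Ioo Ioo_subset_Iio_self)
    (tame_straightDelta h.ρ₃ h.ρ₁ h.br_right)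
  bounded_flux := forall_fin_three (bounded_flux_right h.ρ₂ h.ρ₃ h.br_corner _)
    (h.bounded_flux_lowerShock fun _ hσ => le_of_lt hσ.2)
    (bounded_flux_left h.ρ₃ h.ρ₁ h.br_right _)
  measurableSet_region := isOpen_lowerRegion.measurableSet
  measurableSet_source := by measurability
  injective := by
    have n1 : ∀ σ σ' : ℝ, σ' < 0 →
        (leftShock S₁ S₂ S₃).Ξ σ ≠ (lowerShock S₁ S₂ S₃).Ξ σ' := fun σ σ' hσ' he =>
      (h.lowerShock_snd_gt hσ').ne (by rw [← he, leftShock_Ξ_snd])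
    have n2 : ∀ σ σ' : ℝ, (leftShock S₁ S₂ S₃).Ξ σ ≠ (rightShock S₁ S₂ S₃ s).Ξ σ' :=
      fun σ σ' he => h.mergeConfig.corner_snd_lt.ne
        (by rw [← h.rightShock_Ξ_snd σ', ← he, leftShock_Ξ_snd])
    have n3 : ∀ σ σ' : ℝ, σ ∈ Ioo s 0 → (lowerShock S₁ S₂ S₃).Ξ σ ≠ (rightShock S₁ S₂ S₃ s).Ξ σ' :=
      fun σ σ' hσ he => (h.lowerShock_snd_lt_meeting hσ.1 hσ.2.le).ne
        (by rw [he, h.rightShock_Ξ_snd σ'])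
    refine forall_fin_three (forall_fin_three ?_ ?_ ?_) (forall_fin_three ?_ ?_ ?_)
      (forall_fin_three ?_ ?_ ?_)
    · exact fun σ σ' _ _ he => ⟨rfl, straightDelta_Ξ_injective h.corner_fst_lt.ne he⟩
    · exact fun σ σ' _ hσ' he => absurd he (n1 σ σ' hσ'.2)
    · exact fun σ σ' _ _ he => absurd he (n2 σ σ')
    · exact fun σ σ' hσ _ he => absurd he.symm (n1 σ' σ hσ.2)
    · exact fun σ σ' _ _ he => ⟨rfl, h.lowerShock_injective he⟩
    · exact fun σ σ' hσ _ he => absurd he (n3 σ σ' hσ)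
    · exact fun σ σ' _ _ he => absurd he.symm (n2 σ' σ)
    · exact fun σ σ' _ hσ' he => absurd he.symm (n3 σ' σ hσ')
    · exact fun σ σ' _ _ he => ⟨rfl, h.rightShock_injective he⟩
  source := by
    refine forall_fin_three (fun σ hσ r hr => ?_) (fun σ hσ r hr => ?_) (fun σ hσ r hr => ?_)
    · refine mul_neg_of_pos_of_neg hr (sub_neg.2 ?_)
      exact (leftShock_Ξ_snd (S₁ := S₁) σ).trans_lt h.lowerConfig.snd_lt
    · exact mul_neg_of_pos_of_neg hr (sub_neg.2 (h.lowerShock_snd_lt hσ.2))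
    · refine mul_neg_of_pos_of_neg hr (sub_neg.2 ?_)
      exact (h.rightShock_Ξ_snd σ).trans_lt h.mergeConfig.meeting_snd_lt
  exit := by
    refine forall_fin_three (fun σ hσ r hr => ?_) (fun σ hσ r hr => ?_) (fun σ hσ r hr => ?_)
    · exact h.lowerConfig.exit_left h.mergeConfig.corner_snd_lt (leftShock_Ξ_snd σ)
        (h.leftShock_Ξ_fst hσ) hr
    · obtain ⟨hA, hC, h0⟩ := h.lowerShock_coords hσ.2
      exact h.lowerConfig.exit_conic hA hC h0 (h.lowerShock_snd_lt_meeting hσ.1 hσ.2.le) hr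
    · exact h.lowerConfig.exit_right (h.rightShock_Ξ_snd σ) h.mergeConfig.meeting_snd_lt
        (h.rightShock_outer hσ).1 (h.rightShock_outer hσ).2
  hit_or_stay := by
    have hc := h.mergeConfig
    have hV := sub_neg.2 hc.meeting_snd_lt
    -- The second condition removes the ray through the collision point.
    filter_upwards [h.lowerConfig.ae_coordC_ne_zero, ae_linear_ne_zero
      (a := ((lowerShock S₁ S₂ S₃).Ξ s).2 - S₃.vel.2)
      (b := S₃.vel.1 - ((lowerShock S₁ S₂ S₃).Ξ s).1) (Or.inl hV.ne)] with x hx hx' hQ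
    have hQ' : x.2 < 0 := hQ
    have hdiv := div_pos_of_neg_of_neg hV hQ'
    left
    rcases lt_or_gt_of_ne hx with hC | hC
    · obtain ⟨σ, hσ, hr⟩ := h.exists_leftShock_ray hQ hC
      exact ⟨0, σ, hσ, hr⟩
    rcases lt_or_ge 0 (coordA S₃.vel (corner S₁ S₂ S₃) (deltaVel S₂ S₃) (S₃.vel + x)) with hA | hA
    · obtain ⟨σ, hσ, r, hr, he⟩ := h.exists_lowerShock_ray hA hC
      obtain ⟨hA', hC', h0⟩ := h.lowerShock_coords hσ
      have hx0 := eq_smul_sub_of_eq_add_smul hr he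
      rcases lt_trichotomy ((lowerShock S₁ S₂ S₃).Ξ σ).2 ((lowerShock S₁ S₂ S₃).Ξ s).2
        with h2 | h2 | h2
      · exact ⟨1, σ, ⟨h.gt_of_lowerShock_snd hσ h2, hσ⟩, r⁻¹, inv_pos.2 hr, hx0⟩
      · refine absurd ?_ hx'
        have : σ = s := h.strictAntiOn_lowerShock_snd.injOn (mem_Iic.2 hσ.le) (mem_Iic.2 h.neg.le)
          h2
        rw [this] at hx0
        rw [hx0]
        simp only [Prod.smul_fst, Prod.smul_snd, Prod.fst_sub, Prod.snd_sub, smul_eq_mul]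
        ring
      · obtain ⟨τ, hτ, hr'⟩ := h.exists_rightShock_ray hdiv fun ρ hρ hZ => by
          have e : S₃.vel + ρ • x = S₃.vel + (ρ * r⁻¹) • ((lowerShock S₁ S₂ S₃).Ξ σ - S₃.vel) := by
            rw [mul_smul, ← hx0]
          have hρ' : 0 < ρ * r⁻¹ := mul_pos hρ (inv_pos.2 hr)
          -- The ray would meet the conic above the collision height. At that height it is farther
          -- from `S₃.vel`, hence still outside the conic, hence to the right of the collision
          -- point.
          have h3 : 1 < ρ * r⁻¹ := by
            rw [← hZ, e] at h2
            simp only [Prod.snd_add, Prod.smul_snd, Prod.snd_sub, smul_eq_mul] at h2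
            have h4 : 0 < (ρ * r⁻¹ - 1) * (S₃.vel.2 - ((lowerShock S₁ S₂ S₃).Ξ σ).2) := by linarith
            have h5 : ((lowerShock S₁ S₂ S₃).Ξ σ).2 < S₃.vel.2 := h.lowerShock_snd_lt hσ
            linarith [pos_of_mul_pos_left h4 (sub_pos.2 h5).le]
          refine (hc.outer_iff_of_snd_eq hZ).1 ⟨?_, ?_⟩
          · rw [coordC_ray]; exact mul_pos hρ hC
          · rw [e]; exact (conic_ray_pos_iff hc.pos hA' h0 hρ').2 h3
        exact ⟨2, τ, hτ, hr'⟩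
    · obtain ⟨τ, hτ, hr'⟩ := h.exists_rightShock_ray hdiv fun ρ hρ hZ => by
        refine (hc.outer_iff_of_snd_eq hZ).1 ?_
        refine (h.lowerConfig.outer_ray_of_coordA_nonpos hA hC hρ).resolve_left ?_
        rw [hZ]; exact not_lt.2 hc.corner_snd_lt.le
      exact ⟨2, τ, hτ, hr'⟩
  not_mem := by
    refine Eventually.of_forall fun x hx r hr hD => hx ?_
    have h1 : (S₃.vel + r • x).2 < ((lowerShock S₁ S₂ S₃).Ξ s).2 := hD.1
    have h2 := h.mergeConfig.meeting_snd_lt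
    simp only [Prod.snd_add, Prod.smul_snd, smul_eq_mul] at h1
    by_contra hc
    linarith [mul_nonneg hr.le (not_lt.1 hc)]

/-- Rays from `S₁.vel` to the right of the line through the collision point reach the horizontal
shock. Those to its left reach the new shock if `α > 0`; for `α ≤ 0` they lie beyond its tangent at
`S₁.vel` and are never absorbed. -/
theorem isSweptBy_mergedOuter :
    IsSweptBy S₁.vel (collisionRegions S₁ S₂ S₃ s 1) {q | 0 ≤ q.1 ∧ 0 ≤ q.2}
      ![rightShock S₁ S₂ S₃ s, upperShock S₁ S₂ S₃ s] ![Ioi 0, Iio 0] where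
  tame := Fin.forall_fin_two.2 ⟨tame_straightDelta h.ρ₃ h.ρ₁ h.br_right,
    tame_vacuumShock h.ρ₁ h.mergedMass_pos h.br_upper⟩
  bounded_flux := Fin.forall_fin_two.2 ⟨bounded_flux_right h.ρ₃ h.ρ₁ h.br_right _,
    bounded_flux_vacuum h.ρ₁ h.mergedMass_pos h.br_upper Iio_subset_Iic_self⟩
  measurableSet_region := isOpen_mergedOuter.measurableSet
  measurableSet_source := by measurability
  injective := by
    have hne : ∀ σ σ' : ℝ, 0 < σ → σ' < 0 →
        (rightShock S₁ S₂ S₃ s).Ξ σ ≠ (upperShock S₁ S₂ S₃ s).Ξ σ' := fun σ σ' hσ hσ' he =>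
      lt_asymm (h.upperShock_coords hσ').2.1 (he ▸ h.side_rightShock hσ)
    refine Fin.forall_fin_two.2 ⟨Fin.forall_fin_two.2 ⟨?_, ?_⟩, Fin.forall_fin_two.2 ⟨?_, ?_⟩⟩
    · exact fun σ σ' _ _ he => ⟨rfl, h.rightShock_injective he⟩
    · exact fun σ σ' hσ hσ' he => absurd he (hne σ σ' hσ hσ')
    · exact fun σ σ' hσ hσ' he => absurd he.symm (hne σ' σ hσ' hσ)
    · exact fun σ σ' _ _ he => ⟨rfl, vacuumShock_Ξ_injective h.br_upper he⟩
  source := by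
    refine Fin.forall_fin_two.2 ⟨fun σ hσ r hr => ⟨?_, ?_⟩, fun σ hσ r hr => ⟨?_, ?_⟩⟩
    · exact mul_nonneg hr.le (sub_nonneg.2 (h.rightShock_fst_gt hσ).le)
    · refine mul_nonneg hr.le (sub_nonneg.2 ?_)
      exact (h.mergeConfig.lt_meeting.trans_eq (h.rightShock_Ξ_snd σ).symm).le
    · obtain ⟨hA, hC, -⟩ := h.upperShock_coords hσ
      exact mul_nonneg hr.le (sub_nonneg.2 (h.mergeConfig.fst_gt_of_coords hA hC.le).le)
    · obtain ⟨hA, hC, -⟩ := h.upperShock_coords hσ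
      exact mul_nonneg hr.le (sub_nonneg.2 (h.mergeConfig.snd_gt_of_coords hA hC.le).le)
  exit := by
    have hc := h.mergeConfig
    refine Fin.forall_fin_two.2 ⟨fun σ hσ r hr => ?_, fun σ hσ r hr => ?_⟩
    · have h1 : S₁.u < (S₁.vel + r • ((rightShock S₁ S₂ S₃ s).Ξ σ - S₁.vel)).1 := by
        have := mul_pos hr (sub_pos.2 (h.rightShock_fst_gt hσ))
        simpa [State.vel] using this
      have hC : coordC S₁.vel ((lowerShock S₁ S₂ S₃).Ξ s) (mergedVel S₁ S₂ S₃ s)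
          (S₁.vel + r • ((rightShock S₁ S₂ S₃ s).Ξ σ - S₁.vel)) < 0 := by
        rw [coordC_ray, add_sub_cancel]; exact mul_neg_of_pos_of_neg hr (h.side_rightShock hσ)
      refine (mergedOuter_of_side_neg h1 hC).trans ?_
      have hd := sub_pos.2 hc.lt_meeting
      have e : (S₁.vel + r • ((rightShock S₁ S₂ S₃ s).Ξ σ - S₁.vel)).2 =
          ((lowerShock S₁ S₂ S₃).Ξ s).2 +
            (r - 1) * (((lowerShock S₁ S₂ S₃).Ξ s).2 - S₁.vel.2) := by
        simp only [Prod.snd_add, Prod.smul_snd, Prod.snd_sub, smul_eq_mul, h.rightShock_Ξ_snd]; ring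
      rw [e, lt_add_iff_pos_right]
      constructor
      · intro h2
        linarith [pos_of_mul_pos_left h2 hd.le]
      · exact fun h2 => mul_pos (sub_pos.2 h2) hd
    · obtain ⟨hA, hC, h0⟩ := h.upperShock_coords hσ
      have hA' : 0 < coordA S₁.vel ((lowerShock S₁ S₂ S₃).Ξ s) (mergedVel S₁ S₂ S₃ s)
          (S₁.vel + r • ((upperShock S₁ S₂ S₃ s).Ξ σ - S₁.vel)) := by
        rw [coordA_ray, add_sub_cancel]; exact mul_pos hr hA
      have hC' : 0 < coordC S₁.vel ((lowerShock S₁ S₂ S₃).Ξ s) (mergedVel S₁ S₂ S₃ s)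
          (S₁.vel + r • ((upperShock S₁ S₂ S₃ s).Ξ σ - S₁.vel)) := by
        rw [coordC_ray, add_sub_cancel]; exact mul_pos hr hC
      refine (mergedOuter_of_side_pos (hc.fst_gt_of_coords hA' hC'.le) hC').trans ?_
      rw [← conic_ray_pos_iff hc.pos' hA h0 hr]
      exact ⟨fun h1 => h1 hA', fun h1 _ => h1⟩
  hit_or_stay := by
    have hc := h.mergeConfig
    filter_upwards [ae_fst_ne_zero, ae_snd_ne_zero, hc.ae_side_ne_zero] with x h1 h2 hx hQ
    have hx1 : 0 < x.1 := lt_of_le_of_ne hQ.1 h1.symm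
    have hx2 : 0 < x.2 := lt_of_le_of_ne hQ.2 h2.symm
    rcases lt_or_gt_of_ne hx with hC | hC
    · obtain ⟨τ, hτ, hr'⟩ := h.exists_rightShock_ray (V := S₁.vel)
        (div_pos (sub_pos.2 hc.lt_meeting) hx2) fun ρ hρ hZ => by
          rw [← hc.side_of_snd_eq hZ, coordC_ray]
          exact mul_neg_of_pos_of_neg hρ hC
      exact Or.inl ⟨0, τ, hτ, hr'⟩
    rcases lt_or_ge 0 (coordA S₁.vel ((lowerShock S₁ S₂ S₃).Ξ s) (mergedVel S₁ S₂ S₃ s)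
      (S₁.vel + x)) with hA | hA
    · obtain ⟨r, hr, h0⟩ := exists_conic_ray hc.pos' hA hC
      obtain ⟨σ, hσ, he⟩ := h.exists_upperShock (by rw [coordA_ray]; exact mul_pos hr hA)
        (by rw [coordC_ray]; exact mul_pos hr hC) h0
      exact Or.inl ⟨1, σ, hσ, r⁻¹, inv_pos.2 hr, eq_smul_sub_of_eq_add_smul hr he⟩
    · refine Or.inr fun r hr => (mergedOuter_of_side_pos ?_ ?_).2 fun hA' => ?_
      · have := mul_pos hr hx1
        simpa [State.vel, corner] using this
      · rw [coordC_ray]; exact mul_pos hr hC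
      · rw [coordA_ray] at hA'
        exact absurd (mul_nonpos_of_nonneg_of_nonpos hr.le hA) (not_le.2 hA')
  not_mem := by
    have hc := h.mergeConfig
    refine Eventually.of_forall fun x hx r hr hD => hx ?_
    have h1 : S₁.u < (S₁.vel + r • x).1 := hD.1
    have hx1 : 0 < x.1 := by
      simp only [Prod.fst_add, Prod.smul_fst, smul_eq_mul, State.vel, lt_add_iff_pos_right] at h1
      exact pos_of_mul_pos_right h1 hr.le
    refine ⟨hx1.le, ?_⟩
    by_contra hcon
    have h2 : (S₁.vel + r • x).2 < S₁.vel.2 := by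
      simp only [Prod.snd_add, Prod.smul_snd, smul_eq_mul]
      linarith [mul_neg_of_pos_of_neg hr (not_le.1 hcon)]
    refine hD.2 (Or.inl ⟨?_, (h2.trans hc.lt_meeting).le⟩)
    refine le_of_not_gt fun hC => ?_
    exact lt_asymm h2 (hc.snd_gt_of_side h1 hC.le)

/-- As in Case 9, with a second cancellation of cone terms over the collision point: what the two
incoming shocks deliver, the first one with the factor `exp s`, is what the new shock starts with
(`upperShock_cons`). -/
theorem isDistributionalSolution_collision :
    IsDistributionalSolution (patch S₁ S₂ S₃ (collisionRegions S₁ S₂ S₃ s))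
      ![leftShock S₁ S₂ S₃, lowerShock S₁ S₂ S₃, rightShock S₁ S₂ S₃ s, upperShock S₁ S₂ S₃ s]
      ![Ici 0, Icc s 0, Ici 0, Iic 0] (riemannData S₁ S₂ S₃) := by
  intro φ hφ hc k
  obtain ⟨b1, b2⟩ := integral_bulkPairing_patch (S₁ := S₁) (S₂ := S₂) (S₃ := S₃)
    h.disjoint_collisionRegions (fun i => (isOpen_collisionRegions i).measurableSet) hφ hc k
  obtain ⟨i1, i2⟩ := integral_riemannData (S₁ := S₁) (S₂ := S₂) (S₃ := S₃) hφ hc k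
  obtain ⟨l1, l2⟩ := integral_pairing_straightDelta h.ρ₂ h.ρ₃ h.br_corner hφ hc k
  obtain ⟨d1, d2⟩ := integral_pairing_vacuumShock_Icc (n₀ := (leftShock S₁ S₂ S₃).n 0) h.ρ₃
    h.leftShock_pos.1 h.br_lower hφ hc k h.neg
  obtain ⟨r1, r2⟩ := integral_pairing_straightDelta h.ρ₃ h.ρ₁ h.br_right hφ hc k
  obtain ⟨u1, u2⟩ := integral_pairing_vacuumShock_Iic (n₀ := mergedEnergy S₁ S₂ S₃ s) h.ρ₁
    h.mergedMass_pos h.br_upper hφ hc k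
  have s1 := h.isSweptBy_mergedOuter.integral_region hφ hc
  have s2 := h.isSweptBy_leftRegion.integral_region hφ hc
  have s3 := h.isSweptBy_lowerRegion_collision.integral_region hφ hc
  rw [sum_flux_eq] at s1 s2 s3
  rw [Fin.sum_univ_two] at s1
  rw [Fin.sum_univ_one] at s2
  rw [Fin.sum_univ_three] at s3
  refine ⟨b1, forall_fin_four l1 d1 r1 u1, i1, ?_⟩
  rw [Fin.sum_univ_four, b2, i2]
  have t1 : ∫ p in {p : ℝ × ℝ × ℝ | 0 < p.1 ∧ p.1⁻¹ • p.2 ∈ collisionRegions S₁ S₂ S₃ s 1},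
      fderiv ℝ φ p (1, S₁.vel.1, S₁.vel.2) =
        (fluxPairing φ S₁.vel (rightShock S₁ S₂ S₃ s) (Ioi 0) +
          fluxPairing φ S₁.vel (upperShock S₁ S₂ S₃ s) (Iio 0)) - _ := s1
  have t2 : ∫ p in {p : ℝ × ℝ × ℝ | 0 < p.1 ∧ p.1⁻¹ • p.2 ∈ collisionRegions S₁ S₂ S₃ s 2},
      fderiv ℝ φ p (1, S₂.vel.1, S₂.vel.2) = _ := s2
  have t3 : ∫ p in {p : ℝ × ℝ × ℝ | 0 < p.1 ∧ p.1⁻¹ • p.2 ∈ collisionRegions S₁ S₂ S₃ s 3},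
      fderiv ℝ φ p (1, S₃.vel.1, S₃.vel.2) =
        (fluxPairing φ S₃.vel (leftShock S₁ S₂ S₃) (Ioi 0) +
          fluxPairing φ S₃.vel (lowerShock S₁ S₂ S₃) (Ioo s 0) +
          fluxPairing φ S₃.vel (rightShock S₁ S₂ S₃ s) (Ioi 0)) - _ := s3
  have tl : ∫ q in paramSet (Ici 0), (leftShock S₁ S₂ S₃).pairing φ k q =
        (leftShock S₁ S₂ S₃).cons 0 k * conePairing φ (corner S₁ S₂ S₃) -
        (S₂.cons k * fluxPairing φ S₂.vel (leftShock S₁ S₂ S₃) (Ioi 0) +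
          S₃.cons k * fluxPairing φ S₃.vel (leftShock S₁ S₂ S₃) (Ioi 0)) := l2
  have td : ∫ q in paramSet (Icc s 0), (lowerShock S₁ S₂ S₃).pairing φ k q =
      Real.exp s * (lowerShock S₁ S₂ S₃).cons s k *
        conePairing φ ((lowerShock S₁ S₂ S₃).Ξ s) -
        (leftShock S₁ S₂ S₃).cons 0 k * conePairing φ (corner S₁ S₂ S₃) -
          S₃.cons k * fluxPairing φ S₃.vel (lowerShock S₁ S₂ S₃) (Ioo s 0) := by
    have e : (lowerShock S₁ S₂ S₃).cons 0 k = (leftShock S₁ S₂ S₃).cons 0 k :=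
      h.emergesAt_lowerShock.2.1 k
    rw [← e]
    exact d2
  have tr : ∫ q in paramSet (Ici 0), (rightShock S₁ S₂ S₃ s).pairing φ k q =
        (rightShock S₁ S₂ S₃ s).cons 0 k * conePairing φ ((lowerShock S₁ S₂ S₃).Ξ s) -
        (S₃.cons k * fluxPairing φ S₃.vel (rightShock S₁ S₂ S₃ s) (Ioi 0) +
          S₁.cons k * fluxPairing φ S₁.vel (rightShock S₁ S₂ S₃ s) (Ioi 0)) := r2
  have tu : ∫ q in paramSet (Iic 0), (upperShock S₁ S₂ S₃ s).pairing φ k q =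
      -((Real.exp s * (lowerShock S₁ S₂ S₃).cons s k + (rightShock S₁ S₂ S₃ s).cons 0 k) *
          conePairing φ ((lowerShock S₁ S₂ S₃).Ξ s)) -
        S₁.cons k * fluxPairing φ S₁.vel (upperShock S₁ S₂ S₃ s) (Iio 0) := by
    rw [← h.upperShock_cons k]
    exact u2
  simp only [Matrix.cons_val]
  rw [t1, t2, t3, tl, td, tr, tu]
  ring

theorem hasCaseFiveSolution : HasCaseFiveSolution S₁ S₂ S₃ :=
  ⟨lowerShock S₁ S₂ S₃, upperShock S₁ S₂ S₃ s, s, collisionRegions S₁ S₂ S₃ s,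
    patch S₁ S₂ S₃ (collisionRegions S₁ S₂ S₃ s), h.isDeltaShock_leftShock,
      h.isDeltaShock_rightShock,
    h.emergesAt_lowerShock, h.neg, h.meet, h.deltaVel_fst_lt,
    fun _ hσ => (h.lowerShock_snd_lt_meeting hσ.1 hσ.2).trans_eq h.meet,
    vacuumShock_Ξ_zero, h.upperShock_cons, h.isDeltaShock_upperShock, h.upperShock_behaviour,
    h.isWavePattern_collision, h.separates_leftShock (subset_lowerRegion
      h.mergeConfig.corner_snd_lt),
    h.separates_lowerShock_collision, h.separates_rightShock, h.separates_upperShock,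
    fun _ hy => h.contact_states hy, fun _ hy hy' => h.contact_vacuum hy hy',
    h.isDistributionalSolution_collision⟩

end Meets

theorem mainTheorem4 (S₁ S₂ S₃ : State)
    (hρ₁ : 0 < S₁.ρ) (hρ₂ : 0 < S₂.ρ) (hρ₃ : 0 < S₃.ρ)
    (hH₁ : 0 < S₁.H) (hH₂ : 0 < S₂.H) (hH₃ : 0 < S₃.H)
    (hu₁₂ : S₁.u = S₂.u) (hu₂₃ : S₂.u < S₃.u) :
    (S₂.v < (deltaVel S₂ S₃).2 → (deltaVel S₂ S₃).2 < S₁.v → S₁.v < S₃.v →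
      HasCaseFiveSolution S₁ S₂ S₃) ∧
    (S₂.v < S₁.v → S₁.v = S₃.v → HasCaseNineSolution S₁ S₂ S₃) := by
  refine ⟨fun h1 h2 h3 => ?_, fun h1 h2 => ?_⟩
  · have hv : S₂.v < S₃.v := h1.trans (h2.trans h3)
    have h : Admissible S₁ S₂ S₃ :=
      ⟨hρ₁, hρ₂, hρ₃, hH₁, hH₂, hH₃, hu₁₂, hu₂₃, hv, h2⟩
    obtain ⟨s, hs⟩ := h.exists_meets h3
    exact hs.hasCaseFiveSolution
  · have hv : S₂.v < S₃.v := h1.trans_eq h2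
    -- In Case 9 the corner lies below `S₁.v = S₃.v` because `v_δ²³` is a weighted mean of `v₂ <
    -- v₃`.
    have h : Admissible S₁ S₂ S₃ := ⟨hρ₁, hρ₂, hρ₃, hH₁, hH₂, hH₃, hu₁₂, hu₂₃, hv,
      (deltaVel_snd_mem hρ₂ hρ₃ hv).2.trans_eq h2.symm⟩
    exact h.hasCaseNineSolution h2
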